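/- **Notation.** Let $N\ge 1$, $G(x,t)=(4\pi t)^{-N/2}e^{-|x|^2/(4t)}$ be the heat kernel on $\mathbf R^N$, and $e^{t\Delta}\phi(x)=\int_{\mathbf R^N}G(x-y,t)\phi(y)\,dy$. For multi-indices $\alpha\in(\mathbf N\cup\{0\})^N$ put $g(x,t)=G(x,t+1)$ and $g_\alpha(x,t)=\frac{(-1)^{|\alpha|}}{\alpha!}\partial_x^\alpha g(x,t)$; $\beta\le\alpha$ is the componentwise order. Write $\|\cdot\|_q$ for the norm of $L^q(\mathbf R^N)$ and, for $k\ge 0$, $|||f|||_k=\int_{\mathbf R^N}|f(x)|(1+|x|^k)\,dx$ for the norm of $L^1_k=L^1(\mathbf R^N,(1+|x|^k)dx)$. For $f\in L^1_K$, $|\alpha|\le K$ and $t\ge0$ define inductively $$M_\alpha(f,t)=\int_{\mathbf R^N}x^\alpha f(x)\,dx-\sum_{\beta\le\alpha,\ \beta\ne\alpha}M_\beta(f,t)\int_{\mathbf R^N}x^\alpha g_\beta(x,t)\,dx ,$$ and let $[P_K(t)f](x)=f(x)-\sum_{|\alpha|\le K}M_\alpha(f,t)\,g_\alpha(x,t)$.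 For a function $w=w(x,t)$, $q\in[1,\infty]$ and $\ell\ge 0$ put $$\mathcal N_{q,\ell}[w](t)=t^{\frac N2(1-\frac1q)}\|w(t)\|_q+t^{-\frac \ell2}|||w(t)|||_\ell .$$ **Theorem 6.1.** Let $p\ge 1$, $K\ge 0$, $A\in\mathbf R$, and let $\varphi\in L^\infty(\mathbf R^N)\cap L^1_K$. Let $a=a(x,t)$ be measurable on $\mathbf R^N\times(0,\infty)$ with $$\operatorname*{ess\,sup}_{t>0}\,(1+t)^{-A}\|a(t)\|_\infty<\infty,\qquad A_p:=-A+\frac{N(p-1)}2-1>0 .$$ Write $F(x,t,w)=a(x,t)|w|^{p-1}w$. Let $u$ be a global-in-time solution of $\partial_tu=\Delta u+a(x,t)|u|^{p-1}u$ in $\mathbf R^N\times(0,\infty)$, $u(\cdot,0)=\varphi$, that is, a continuous function on $\mathbf R^N\times(0,\infty)$ such that $$u(x,t)=e^{t\Delta}\varphi(x)+\int_0^t\int_{\mathbf R^N}G(x-y,t-s)F(y,s,u(y,s))\,dy\,ds$$ for all $x\in\mathbf R^N$, $t>0$, with absolutely convergent integrals. Assume $$\sup_{t>0}\,(1+t)^{N/2}\|u(t)\|_\infty<\infty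 .$$ Put $f(x,t)=F(x,t,u(x,t))$. Then all the integrals used below converge, the functions $U_n(t)$ and $\tilde u(t)$ are measurable, and the following holds as $t\to\infty$. (1) For $|\alpha|\le K$ let $c_\alpha(t)=M_\alpha(\varphi,0)+\int_0^tM_\alpha(f(s),s)\,ds$. If $A_p>|\alpha|/2$, there is a constant $c_\alpha$ with $|c_\alpha(t)-c_\alpha|=O(t^{-A_p+|\alpha|/2})$. If $A_p<|\alpha|/2$, then $c_\alpha(t)=O(t^{-A_p+|\alpha|/2})$. If $A_p=|\alpha|/2$, then $c_\alpha(t)=O(\log t)$. (2) Let $U_0(x,t)=\sum_{|\alpha|\le K}c_\alpha(t)g_\alpha(x,t)$ and, for $n\ge1$, with $F_{n-1}(x,t)=F(x,t,U_{n-1}(x,t))$, $$U_n(x,t)=U_0(x,t)+\int_0^te^{(t-s)\Delta}P_K(s)F_{n-1}(s)\,ds .$$ Then, for $n\ge 1$, also $$U_n(x,t)=\sum_{|\alpha|\le K}\Big[M_\alpha(\varphi,0)+\int_0^tM_\alpha(f(s)-F_{n-1}(s),s)\,ds\Big]g_\alpha(x,t)+\int_0^te^{(t-s)\Delta}F_{n-1}(s)\,ds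 .$$ For all $n\ge 0$, $q\in[1,\infty]$ and $\ell\in[0,K]$, $$\sup_{t>0}t^{\frac N2(1-\frac1q)}\|U_n(t)\|_q+\sup_{t>0}(1+t)^{-\frac\ell2}|||U_n(t)|||_\ell<\infty$$ and $$\mathcal N_{q,\ell}[u-U_n](t)=\begin{cases}o(t^{-K/2})+O(t^{-(n+1)A_p}) & \text{if }(n+1)A_p\ne K/2,\\ O(t^{-K/2}\log t)&\text{if }(n+1)A_p=K/2.\end{cases}$$ (3) Let $M=\int_{\mathbf R^N}\varphi\,dx+\int_0^\infty\int_{\mathbf R^N}f(x,t)\,dx\,dt$. Then $M=\lim_{t\to\infty}\int_{\mathbf R^N}u(x,t)\,dx=\lim_{t\to\infty}c_0(t)$, and for all $q\in[1,\infty]$, $\ell\in[0,K]$, $$\mathcal N_{q,\ell}[u-Mg](t)=\begin{cases}o(t^{-K/2})+O(t^{-A_p})&\text{if }0\le K<1,\ A_p\ne K/2,\\ O(t^{-K/2}\log t)&\text{if }0\le K<1,\ A_p=K/2,\\ O(t^{-1/2})+O(t^{-A_p})&\text{if }K\ge1,\ A_p\ne1/2,\\ O(t^{-1/2}\log t)&\text{if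 }K\ge1,\ A_p=1/2.\end{cases}$$ Moreover, if $K\ge1$ and, with $f_M(x,t)=F(x,t,Mg(x,t))$, $\int_0^\infty|M_\alpha(f_M(t),t)|\,dt<\infty$ for every $\alpha$ with $|\alpha|=1$, then $\mathcal N_{q,\ell}[u-Mg](t)=O(t^{-1/2})+O(t^{-A_p})$ for all $q\in[1,\infty]$, $\ell\in[0,K]$. (4) Let $0\le K<1$, let $f_M$ be as in (3), and put $$\tilde u(x,t)=M'g(x,t)+\int_0^te^{(t-s)\Delta}f_M(s)\,ds,\qquad M'=\int_{\mathbf R^N}\varphi\,dx+\int_0^\infty\int_{\mathbf R^N}[f(x,t)-f_M(x,t)]\,dx\,dt .$$ Then, for all $q\in[1,\infty]$ and $\ell\in[0,K]$, $$\mathcal N_{q,\ell}[u-\tilde u](t)=\begin{cases}o(t^{-K/2})+O(t^{-2A_p})&\text{if }2A_p\ne K/2,\\ O(t^{-K/2}\log t)&\text{if }2A_p=K/2.\end{cases}$$ -/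

import Mathlib

open MeasureTheory Set Filter Asymptotics Topology
open scoped ENNReal

namespace HeatExpansion

/-! Functions of space-time are curried with the time first: `u t x`. -/

/-- The Euclidean space of dimension `N`. -/
abbrev Space (N : ℕ) : Type := EuclideanSpace ℝ (Fin N)

/-- Multi-indices of length `N`; the order `β ≤ α` is componentwise. -/
abbrev MultiIndex (N : ℕ) : Type := Fin N → ℕ

/-- The order `|α|` of a multi-index. -/
def order {N : ℕ} (α : MultiIndex N) : ℕ := ∑ i, α i

/-- The finite set of the multi-indices `α` with `|α| ≤ K`. -/
noncomputable def indicesUpTo (N : ℕ) (K : ℝ) : Finset (MultiIndex N) :=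
  (Finset.Iic (fun _ => ⌊K⌋₊)).filter (fun α => order α ≤ ⌊K⌋₊)

theorem mem_indicesUpTo {N : ℕ} {K : ℝ} (hK : 0 ≤ K) (α : MultiIndex N) :
    α ∈ indicesUpTo N K ↔ (order α : ℝ) ≤ K := by
  rw [indicesUpTo, Finset.mem_filter, Finset.mem_Iic, Nat.le_floor_iff hK]
  refine ⟨fun h => h.2, fun h => ⟨fun i => ?_, h⟩⟩
  exact (Finset.single_le_sum (f := α) (fun j _ => Nat.zero_le _) (Finset.mem_univ i)).trans
    (Nat.le_floor h)

/-- The monomial `x ^ α`. -/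
noncomputable def monomial {N : ℕ} (α : MultiIndex N) (x : Space N) : ℝ := ∏ i, x i ^ α i

/-- The partial derivative in the `i`-th coordinate. -/
noncomputable def partialDeriv {N : ℕ} (i : Fin N) (f : Space N → ℝ) : Space N → ℝ :=
  fun x => fderiv ℝ f x (EuclideanSpace.single i 1)

/-- The derivative `∂ ^ α = ∂_1 ^ α_1 ⋯ ∂_N ^ α_N`. -/
noncomputable def multiDeriv {N : ℕ} (α : MultiIndex N) (f : Space N → ℝ) : Space N → ℝ :=
  (List.finRange N).foldr (fun i h => (partialDeriv i)^[α i] h) f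

/-- The heat kernel `(4 π t) ^ (-N/2) exp (-|x|² / (4 t))`. -/
noncomputable def heatKernel {N : ℕ} (t : ℝ) (x : Space N) : ℝ :=
  (4 * Real.pi * t) ^ (-(N : ℝ) / 2) * Real.exp (-‖x‖ ^ 2 / (4 * t))

/-- The heat semigroup applied to `φ`. -/
noncomputable def heatFlow {N : ℕ} (t : ℝ) (φ : Space N → ℝ) (x : Space N) : ℝ :=
  ∫ y, heatKernel t (x - y) * φ y

/-- The integral of the heat semigroup at time `t - s` applied to `h s`, over `s` from `0`
to `t`. -/
noncomputable def duhamel {N : ℕ} (h : ℝ → Space N → ℝ) (t : ℝ) (x : Space N) : ℝ :=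
  ∫ s in (0 : ℝ)..t, heatFlow (t - s) (h s) x

/-- Absolute convergence of the double integral in `duhamel h t x`. -/
def DuhamelIntegrable {N : ℕ} (h : ℝ → Space N → ℝ) (t : ℝ) (x : Space N) : Prop :=
  Integrable (fun z : ℝ × Space N => heatKernel (t - z.1) (x - z.2) * h z.1 z.2)
    ((volume.restrict (Ioc 0 t)).prod volume)

/-- The shifted kernel `g(x,t) = G(x,t+1)`. -/
noncomputable def shiftedKernel {N : ℕ} (t : ℝ) (x : Space N) : ℝ := heatKernel (t + 1) x

/-- `g_α = ((-1) ^ |α| / α!) ∂_x ^ α g`. -/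
noncomputable def gDeriv {N : ℕ} (α : MultiIndex N) (t : ℝ) (x : Space N) : ℝ :=
  (-1) ^ order α / ((∏ i, (α i).factorial : ℕ) : ℝ) * multiDeriv α (shiftedKernel t) x

/-- The corrected moments `M_α(f,t)`, by recursion on the multi-index; the sum runs over the
`β ≤ α` with `β ≠ α`. -/
noncomputable def moment {N : ℕ} (α : MultiIndex N) (f : Space N → ℝ) (t : ℝ) : ℝ :=
  (∫ x, monomial α x * f x) -
    ∑ β ∈ (Finset.Iio α).attach, moment β.1 f t * ∫ x, monomial α x * gDeriv β.1 t x
termination_by order α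
decreasing_by
  obtain ⟨hle, i, hi⟩ := Pi.lt_def.mp (Finset.mem_Iio.mp β.2)
  exact Finset.sum_lt_sum (fun j _ => hle j) ⟨i, Finset.mem_univ i, hi⟩

theorem moment_eq {N : ℕ} (α : MultiIndex N) (f : Space N → ℝ) (t : ℝ) :
    moment α f t = (∫ x, monomial α x * f x) -
      ∑ β ∈ Finset.Iio α, moment β f t * ∫ x, monomial α x * gDeriv β t x := by
  rw [moment, Finset.sum_attach (Finset.Iio α)
    (fun β => moment β f t * ∫ x, monomial α x * gDeriv β t x)]

/-- The operator `P_K(t)`. -/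
noncomputable def momentProj {N : ℕ} (K t : ℝ) (f : Space N → ℝ) (x : Space N) : ℝ :=
  f x - ∑ α ∈ indicesUpTo N K, moment α f t * gDeriv α t x

/-- The norm of `L¹(ℝ^N, (1 + |x| ^ k) dx)`, with values in `[0,∞]`. -/
noncomputable def weightedNorm {N : ℕ} (k : ℝ) (f : Space N → ℝ) : ℝ≥0∞ :=
  ∫⁻ x, ‖f x‖ₑ * ENNReal.ofReal (1 + ‖x‖ ^ k)

/-- Membership in `L¹(ℝ^N, (1 + |x| ^ k) dx)`. -/
def MemWeighted {N : ℕ} (k : ℝ) (f : Space N → ℝ) : Prop :=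
  AEStronglyMeasurable f volume ∧ weightedNorm k f < ⊤

/-- The nonlinear term `a |w| ^ (p-1) w`. -/
noncomputable def powerTerm {N : ℕ} (a : ℝ → Space N → ℝ) (p : ℝ) (w : ℝ → Space N → ℝ) :
    ℝ → Space N → ℝ :=
  fun t x => a t x * |w t x| ^ (p - 1) * w t x

/-- Global-in-time solutions of `∂_t u = Δ u + a |u| ^ (p-1) u`, `u(0) = φ`: continuous functions
on `ℝ^N × (0,∞)` that satisfy the integral equation (with convergent integrals). -/
structure IsSolution {N : ℕ} (a : ℝ → Space N → ℝ) (p : ℝ) (φ : Space N → ℝ)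
    (u : ℝ → Space N → ℝ) : Prop where
  continuousOn : ContinuousOn (fun z : ℝ × Space N => u z.1 z.2) (Ioi 0 ×ˢ univ)
  duhamelIntegrable : ∀ t > 0, ∀ x, DuhamelIntegrable (powerTerm a p u) t x
  integral_eq : ∀ t > 0, ∀ x, u t x = heatFlow t φ x + duhamel (powerTerm a p u) t x

/-- `c_α(t) = M_α(φ,0) + ∫_0^t M_α(F(s),s) ds` with `F = a |u| ^ (p-1) u`. -/
noncomputable def coeff {N : ℕ} (a : ℝ → Space N → ℝ) (p : ℝ) (φ : Space N → ℝ)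
    (u : ℝ → Space N → ℝ) (α : MultiIndex N) (t : ℝ) : ℝ :=
  moment α φ 0 + ∫ s in (0 : ℝ)..t, moment α (powerTerm a p u s) s

/-- The approximations `U_n`. -/
noncomputable def approx {N : ℕ} (a : ℝ → Space N → ℝ) (p : ℝ) (φ : Space N → ℝ) (K : ℝ)
    (u : ℝ → Space N → ℝ) : ℕ → ℝ → Space N → ℝ
  | 0 => fun t x => ∑ α ∈ indicesUpTo N K, coeff a p φ u α t * gDeriv α t x
  | n + 1 => fun t x =>
      (∑ α ∈ indicesUpTo N K, coeff a p φ u α t * gDeriv α t x) +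
        duhamel (fun s => momentProj K s (powerTerm a p (approx a p φ K u n) s)) t x

/-- `M = ∫ φ dx + ∫_0^∞ ∫ F dx dt` with `F = a |u| ^ (p-1) u`. -/
noncomputable def totalMass {N : ℕ} (a : ℝ → Space N → ℝ) (p : ℝ) (φ : Space N → ℝ)
    (u : ℝ → Space N → ℝ) : ℝ :=
  (∫ x, φ x) + ∫ t in Ioi (0 : ℝ), ∫ x, powerTerm a p u t x

/-- `f_M = a |M g| ^ (p-1) M g`. -/
noncomputable def massTerm {N : ℕ} (a : ℝ → Space N → ℝ) (p : ℝ) (φ : Space N → ℝ)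
    (u : ℝ → Space N → ℝ) : ℝ → Space N → ℝ :=
  powerTerm a p (fun t x => totalMass a p φ u * shiftedKernel t x)

/-- `M' = ∫ φ dx + ∫_0^∞ ∫ (F - f_M) dx dt`. -/
noncomputable def correctedMass {N : ℕ} (a : ℝ → Space N → ℝ) (p : ℝ) (φ : Space N → ℝ)
    (u : ℝ → Space N → ℝ) : ℝ :=
  (∫ x, φ x) + ∫ t in Ioi (0 : ℝ), ∫ x, (powerTerm a p u t x - massTerm a p φ u t x)

/-- The profile `M' g + ∫_0^t e^{(t-s)Δ} f_M(s) ds`. -/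
noncomputable def profile {N : ℕ} (a : ℝ → Space N → ℝ) (p : ℝ) (φ : Space N → ℝ)
    (u : ℝ → Space N → ℝ) (t : ℝ) (x : Space N) : ℝ :=
  correctedMass a p φ u * shiftedKernel t x + duhamel (massTerm a p φ u) t x

/-- `t ^ (N/2 (1-1/q)) ‖w(t)‖_q + t ^ (-ℓ/2) |||w(t)|||_ℓ`, with values in `[0,∞]`. -/
noncomputable def scaledNorm {N : ℕ} (q : ℝ≥0∞) (l : ℝ) (w : ℝ → Space N → ℝ) (t : ℝ) : ℝ≥0∞ :=
  ENNReal.ofReal (t ^ ((N : ℝ) / 2 * (1 - (q⁻¹).toReal))) * eLpNorm (w t) q volume +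
    ENNReal.ofReal (t ^ (-l / 2)) * weightedNorm l (w t)

/-- `X(t) = O(r(t))` as `t → ∞`; in particular `X` is eventually finite. -/
def IsBigOInf (X : ℝ → ℝ≥0∞) (r : ℝ → ℝ) : Prop :=
  ∃ h : ℝ → ℝ, h =O[atTop] r ∧ ∀ᶠ t in atTop, X t = ENNReal.ofReal (h t)

/-- `X(t) = o(r₁(t)) + O(r₂(t))` as `t → ∞`; in particular `X` is eventually finite. -/
def IsLittleOAddBigOInf (X : ℝ → ℝ≥0∞) (r₁ r₂ : ℝ → ℝ) : Prop :=
  ∃ h₁ h₂ : ℝ → ℝ, h₁ =o[atTop] r₁ ∧ h₂ =O[atTop] r₂ ∧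
    ∀ᶠ t in atTop, X t = ENNReal.ofReal (h₁ t + h₂ t)

/-- `X(t) = O(r₁(t)) + O(r₂(t))` as `t → ∞`; in particular `X` is eventually finite. -/
def IsBigOAddBigOInf (X : ℝ → ℝ≥0∞) (r₁ r₂ : ℝ → ℝ) : Prop :=
  ∃ h₁ h₂ : ℝ → ℝ, h₁ =O[atTop] r₁ ∧ h₂ =O[atTop] r₂ ∧
    ∀ᶠ t in atTop, X t = ENNReal.ofReal (h₁ t + h₂ t)

end HeatExpansion

open HeatExpansion

namespace HeatExpansion

/-! ### One-dimensional Gaussian kernels and their derivatives -/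

/-! Two facts about the functions `g_α` carry the expansion. Their moments are triangular: `∫ x^α
g_β` vanishes unless `β ≤ α` and equals `1` for `β = α`. The recursion for `M_α` is therefore an
elimination, and `P_K(t) f` has no moments of order at most `K`
(`integral_monomial_mul_momentProj`). Moreover the heat flow carries `g_α(s)` to `g_α(t)` in time `t
- s` (`heatFlow_gDeriv`). Hence the moment part of Duhamel's formula integrates explicitly to `∑
c_α(t) g_α(t) = U_0(t)`, and `u - U_0` is the `remainder`: the flow of `P_K(0) φ` plus the Duhamel
integral of `P_K(s) f(s)`.

Sizes are measured by `xnorm K (t + 1)`, the `L¹` norm with weight `1 + (|x|/√(t+1))^K` plus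
`(t+1)^(N/2)` times the `L^∞` norm. It respects the parabolic scaling and controls every norm of the
statement (`exists_scaledNorm_le`). In these norms the flow from time `S` to time `T` is bounded,
and on functions with vanishing moments it gains a factor `(S/T)^(K/2)`
(`exists_boundedBy_heatFlow_of_vanishingMoments`), because the Taylor polynomial of degree `⌊K⌋` in
`y` may be subtracted from the kernel `G(x - y)`. A sharper form keeps the Taylor gain under the
integral over `y`; dominated convergence then turns `O` into `o`.

A source of decay `γ` has norm `O((s+1)^(-γ-1))`. After the moment correction its Duhamel integral
is bounded by `(t+1)^(-K/2) ∫_0^t (s+1)^(K/2-γ-1) ds`, which produces the three regimes `γ < K/2`,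
`γ = K/2` (the logarithm) and `γ > K/2`. In the last one, splitting the time integral at `t/2`
improves the bound to `o(t^(-K/2)) + O(t^(-γ))`.

The nonlinear term maps functions of size `O(1)` to sources of decay `A_p`, and it is Lipschitz: if
`w₁ - w₂ = O(t^(-σ))`, the difference of the nonlinear terms is a source of decay `A_p + σ`. Since
`u - U_{n+1}` is the remainder with source `F(u) - F(U_n)`, every iteration improves the decay by
`A_p` until `K/2` is passed (`exists_source_sub_approx`). The weighted bound on `u` that starts this
comes from the domination `|u| ≤ C e^{tΔ}|φ|`, a Gronwall argument (`enorm_le_absFlow`).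

For the mass profile, `u - M g` is the remainder plus `(c_0 - M) g` plus the terms `c_α g_α` with
`|α| ≥ 1`, and the first order coefficients dominate the latter. In the critical case `A_p = 1/2`,
comparing `f` with `f_M` (their difference decays faster) removes the logarithm when the first
moments of `f_M` are integrable. For `K < 1` the same comparison at order zero gives `ũ`. -/

theorem exists_one_add_pow_mul_exp_le (n : ℕ) {c : ℝ} (hc : 0 < c) :
    ∃ C : ℝ, 0 < C ∧ ∀ r : ℝ, 0 ≤ r → (1 + r) ^ n * Real.exp r ≤ C * Real.exp (c * r ^ 2) := by
  refine ⟨n.factorial * Real.exp (1 + c⁻¹), by positivity, fun r hr => ?_⟩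
  have h1 : (1 + r) ^ n ≤ n.factorial * Real.exp (1 + r) := by
    have := Real.pow_div_factorial_le_exp (1 + r) (by positivity) n
    rwa [div_le_iff₀ (by positivity), mul_comm] at this
  have h2 : 2 * r ≤ c⁻¹ + c * r ^ 2 := by
    have h3 : 0 ≤ c * (r - c⁻¹) ^ 2 := by positivity
    have h4 : c * (r - c⁻¹) ^ 2 = c * r ^ 2 - 2 * r + c⁻¹ := by field_simp; ring
    linarith
  calc (1 + r) ^ n * Real.exp r ≤ n.factorial * Real.exp (1 + r) * Real.exp r := by gcongr
    _ = n.factorial * Real.exp (1 + 2 * r) := by rw [mul_assoc, ← Real.exp_add]; ring_nf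
    _ ≤ n.factorial * Real.exp (1 + (c⁻¹ + c * r ^ 2)) := by gcongr
    _ = _ := by rw [← add_assoc, Real.exp_add]; ring

/-- The alternative `k < 0` plays the role of a hypothesis `0 ≤ k`: for negative `k` the power blows
up at the origin, and every use discards that case. -/
theorem exists_one_add_rpow_le (k : ℝ) {c : ℝ} (hc : 0 < c) :
    ∃ C : ℝ, 0 < C ∧ ∀ r : ℝ, 0 ≤ r → 1 + r ^ k ≤ C * Real.exp (c * r ^ 2) ∨ k < 0 := by
  by_cases hk : k < 0
  · exact ⟨1, one_pos, fun r _ => Or.inr hk⟩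
  push Not at hk
  obtain ⟨C, hC, h⟩ := exists_one_add_pow_mul_exp_le ⌈k⌉₊ hc
  refine ⟨2 * C, by positivity, fun r hr => Or.inl ?_⟩
  have h0 := h r hr
  have h1 : (1 + r) ^ k ≤ (1 + r) ^ ⌈k⌉₊ := by
    rw [← Real.rpow_natCast]
    exact Real.rpow_le_rpow_of_exponent_le (by linarith) (Nat.le_ceil k)
  have h2 : r ^ k ≤ (1 + r) ^ k := Real.rpow_le_rpow hr (by linarith) hk
  have h3 : (1 : ℝ) ≤ (1 + r) ^ k := Real.one_le_rpow (by linarith) hk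
  have h4 : (1 + r) ^ ⌈k⌉₊ ≤ (1 + r) ^ ⌈k⌉₊ * Real.exp r :=
    le_mul_of_one_le_right (by positivity) (Real.one_le_exp hr)
  linarith

theorem exists_polynomial_bound (P : Polynomial ℝ) :
    ∃ C : ℝ, 0 < C ∧ ∀ x : ℝ, |P.eval x| ≤ C * (1 + |x|) ^ P.natDegree := by
  refine ⟨1 + ∑ i ∈ Finset.range (P.natDegree + 1), |P.coeff i|, by positivity, fun x => ?_⟩
  rw [Polynomial.eval_eq_sum_range]
  refine (Finset.abs_sum_le_sum_abs _ _).trans ?_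
  have : ∀ i ∈ Finset.range (P.natDegree + 1), |P.coeff i * x ^ i| ≤
      |P.coeff i| * (1 + |x|) ^ P.natDegree := by
    intro i hi
    rw [abs_mul, abs_pow]
    gcongr
    calc |x| ^ i ≤ (1 + |x|) ^ i := by gcongr; linarith
      _ ≤ (1 + |x|) ^ P.natDegree :=
        pow_le_pow_right₀ (by linarith [abs_nonneg x]) (by rw [Finset.mem_range] at hi; omega)
  refine (Finset.sum_le_sum this).trans ?_
  rw [← Finset.sum_mul]
  gcongr
  linarith

/-- The heat kernel on the line. -/
noncomputable def gauss1 (τ x : ℝ) : ℝ := (√(4 * Real.pi * τ))⁻¹ * Real.exp (-x ^ 2 / (4 * τ))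

/-- The normalized derivatives `((-1) ^ k / k!) ∂ ^ k` of the heat kernel on the line. -/
noncomputable def kern1 (k : ℕ) (τ x : ℝ) : ℝ :=
  (-1) ^ k / (k.factorial : ℝ) * iteratedDeriv k (gauss1 τ) x

theorem contDiff_gauss1 (τ : ℝ) : ContDiff ℝ ⊤ (gauss1 τ) := by
  unfold gauss1; fun_prop

theorem gauss1_nonneg (τ x : ℝ) : 0 ≤ gauss1 τ x := by unfold gauss1; positivity

theorem kern1_zero (τ : ℝ) : kern1 0 τ = gauss1 τ := by
  ext x; simp [kern1]

theorem gauss1_scale {τ : ℝ} (hτ : 0 < τ) :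
    gauss1 τ = fun x => (√τ)⁻¹ * gauss1 1 ((√τ)⁻¹ * x) := by
  ext x
  unfold gauss1
  rw [mul_one, Real.sqrt_mul (by positivity), mul_inv, mul_pow, inv_pow, Real.sq_sqrt hτ.le]
  rw [show -(τ⁻¹ * x ^ 2) / (4 * 1) = -x ^ 2 / (4 * τ) by field_simp]
  ring

/-- Self-similarity reduces bounds and moments at every time to time `1`. Of the `k + 1` powers, one
belongs to the kernel and one to each derivative. -/
theorem kern1_scale (k : ℕ) {τ : ℝ} (hτ : 0 < τ) (x : ℝ) :
    kern1 k τ x = (√τ)⁻¹ ^ (k + 1) * kern1 k 1 ((√τ)⁻¹ * x) := by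
  unfold kern1
  have h := iteratedDeriv_comp_const_mul (n := k) ((contDiff_gauss1 1).of_le le_top) (√τ)⁻¹
  rw [gauss1_scale hτ, iteratedDeriv_const_mul_field, h]
  ring

/-- With the factor `(-1)^k / k!` built in, differentiation is a shift of the index up to the factor
`-(k+1)`. Integration by parts thereby becomes a recursion for the moments. -/
theorem hasDerivAt_kern1 (k : ℕ) (τ x : ℝ) :
    HasDerivAt (kern1 k τ) (-(k + 1) * kern1 (k + 1) τ x) x := by
  have h1 : HasDerivAt (iteratedDeriv k (gauss1 τ)) (iteratedDeriv (k + 1) (gauss1 τ) x) x := by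
    rw [iteratedDeriv_succ]
    exact (((contDiff_gauss1 τ).differentiable_iteratedDeriv k
      (WithTop.coe_lt_top _)) x).hasDerivAt
  refine (h1.const_mul ((-1) ^ k / (k.factorial : ℝ))).congr_deriv ?_
  unfold kern1
  rw [Nat.factorial_succ]
  push_cast
  field_simp
  ring

theorem continuous_kern1 (k : ℕ) (τ : ℝ) : Continuous (kern1 k τ) :=
  continuous_iff_continuousAt.2 fun x => (hasDerivAt_kern1 k τ x).continuousAt

theorem exists_iteratedDeriv_gauss1 (k : ℕ) :
    ∃ P : Polynomial ℝ, iteratedDeriv k (gauss1 1) = fun x => P.eval x * gauss1 1 x := by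
  induction k with
  | zero => exact ⟨1, by ext x; simp⟩
  | succ k ih =>
    obtain ⟨P, hP⟩ := ih
    refine ⟨Polynomial.derivative P - Polynomial.C (1 / 2) * Polynomial.X * P, ?_⟩
    rw [iteratedDeriv_succ, hP]
    ext x
    have h1 : HasDerivAt (gauss1 1) (-(x / 2) * gauss1 1 x) x := by
      unfold gauss1
      have : HasDerivAt (fun x : ℝ => -x ^ 2 / (4 * 1)) (-(2 * x) / (4 * 1)) x := by
        simpa using ((hasDerivAt_pow 2 x).neg.div_const (4 * 1))
      refine ((this.exp).const_mul _).congr_deriv ?_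
      ring
    refine ((P.hasDerivAt x).mul h1).deriv.trans ?_
    simp
    ring

/-- Half of the Gaussian exponent `1/4` is spent on absorbing the Hermite polynomial, which leaves
`1/8`. -/
theorem exists_kern1_bound (k : ℕ) :
    ∃ C : ℝ, 0 < C ∧ ∀ x : ℝ, |kern1 k 1 x| ≤ C * Real.exp (-x ^ 2 / 8) := by
  obtain ⟨P, hP⟩ := exists_iteratedDeriv_gauss1 k
  obtain ⟨C, hC, h⟩ := exists_polynomial_bound P
  obtain ⟨D, hD, h'⟩ := exists_one_add_pow_mul_exp_le P.natDegree (c := 1 / 8) (by norm_num)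
  refine ⟨(1 / (k.factorial : ℝ)) * (C * D * (√(4 * Real.pi * 1))⁻¹), by positivity, fun x => ?_⟩
  unfold kern1
  rw [hP, abs_mul, abs_div, abs_pow, abs_neg, abs_one, one_pow,
    abs_of_nonneg (a := (k.factorial : ℝ)) (by positivity), abs_mul,
    abs_of_nonneg (gauss1_nonneg 1 x), mul_assoc]
  refine mul_le_mul_of_nonneg_left ?_ (by positivity)
  unfold gauss1
  have h2 : (1 + |x|) ^ P.natDegree ≤ D * Real.exp (1 / 8 * x ^ 2) := by
    have := h' |x| (abs_nonneg x)
    rw [sq_abs] at this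
    exact (le_mul_of_one_le_right (by positivity) (Real.one_le_exp (abs_nonneg x))).trans this
  calc |P.eval x| * ((√(4 * Real.pi * 1))⁻¹ * Real.exp (-x ^ 2 / (4 * 1)))
      ≤ C * (D * Real.exp (1 / 8 * x ^ 2)) *
        ((√(4 * Real.pi * 1))⁻¹ * Real.exp (-x ^ 2 / (4 * 1))) := by
        gcongr
        exact (h x).trans (by gcongr)
    _ = C * D * (√(4 * Real.pi * 1))⁻¹ *
        (Real.exp (1 / 8 * x ^ 2) * Real.exp (-x ^ 2 / (4 * 1))) := by ring
    _ = _ := by rw [← Real.exp_add]; ring_nf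

theorem exists_kern1_bound_time (k : ℕ) {τ : ℝ} (hτ : 0 < τ) :
    ∃ C : ℝ, 0 < C ∧ ∀ x : ℝ, |kern1 k τ x| ≤ C * Real.exp (-x ^ 2 / (8 * τ)) := by
  obtain ⟨C, hC, h⟩ := exists_kern1_bound k
  have : 0 < √τ := Real.sqrt_pos.2 hτ
  refine ⟨(√τ)⁻¹ ^ (k + 1) * C, by positivity, fun x => ?_⟩
  rw [kern1_scale k hτ, abs_mul, abs_of_nonneg (by positivity), mul_assoc]
  gcongr
  refine (h _).trans_eq ?_
  rw [mul_pow, inv_pow, Real.sq_sqrt hτ.le]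
  congr 2
  field_simp

theorem integrable_pow_mul_kern1 (a b : ℕ) {τ : ℝ} (hτ : 0 < τ) :
    Integrable (fun x => x ^ a * kern1 b τ x) := by
  obtain ⟨C, hC, h⟩ := exists_kern1_bound_time b hτ
  obtain ⟨D, hD, h'⟩ := exists_one_add_pow_mul_exp_le a (c := 1 / (16 * τ)) (by positivity)
  have hint := (integrable_exp_neg_mul_sq (b := 1 / (16 * τ)) (by positivity)).const_mul (D * C)
  refine hint.mono' ((by fun_prop : Continuous fun x : ℝ => x ^ a).mul
    (continuous_kern1 b τ)).aestronglyMeasurable (Eventually.of_forall fun x => ?_)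
  rw [Real.norm_eq_abs, abs_mul, abs_pow]
  have h1 : |x| ^ a ≤ D * Real.exp (1 / (16 * τ) * x ^ 2) := by
    have := h' |x| (abs_nonneg x)
    rw [sq_abs] at this
    refine le_trans ?_ ((le_mul_of_one_le_right (by positivity)
      (Real.one_le_exp (abs_nonneg x))).trans this)
    gcongr
    linarith
  calc |x| ^ a * |kern1 b τ x| ≤ D * Real.exp (1 / (16 * τ) * x ^ 2) *
        (C * Real.exp (-x ^ 2 / (8 * τ))) := by gcongr; exact h x
    _ = D * C * (Real.exp (1 / (16 * τ) * x ^ 2) * Real.exp (-x ^ 2 / (8 * τ))) := by ring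
    _ = _ := by
      rw [← Real.exp_add]
      congr 2
      field_simp
      ring

/-- The moments of the normalized derivatives of the heat kernel at time `1`. -/
noncomputable def kernMoment (a b : ℕ) : ℝ := ∫ x, x ^ a * kern1 b 1 x

theorem integral_pow_mul_kern1 (a b : ℕ) {τ : ℝ} (hτ : 0 < τ) :
    ∫ x, x ^ a * kern1 b τ x = √τ ^ a * (√τ)⁻¹ ^ b * kernMoment a b := by
  have hs : 0 < √τ := Real.sqrt_pos.2 hτ
  have h := Measure.integral_comp_mul_left (fun x => x ^ a * kern1 b 1 x) (√τ)⁻¹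
  simp only [inv_inv, smul_eq_mul, abs_of_pos hs] at h
  have h2 : ∀ x, x ^ a * kern1 b τ x = (√τ ^ a * (√τ)⁻¹ ^ (b + 1)) *
      (((√τ)⁻¹ * x) ^ a * kern1 b 1 ((√τ)⁻¹ * x)) := by
    intro x
    rw [kern1_scale b hτ, mul_pow, inv_pow (√τ) a]
    field_simp
  simp_rw [h2]
  rw [integral_const_mul, h, kernMoment]
  rw [pow_succ]
  field_simp

theorem kernMoment_zero_zero : kernMoment 0 0 = 1 := by
  simp only [kernMoment, kern1_zero, pow_zero, one_mul, gauss1]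
  rw [integral_const_mul]
  have := integral_gaussian (1 / 4)
  have h2 : (fun x : ℝ => Real.exp (-x ^ 2 / (4 * 1))) = fun x => Real.exp (-(1 / 4) * x ^ 2) := by
    ext x; ring_nf
  rw [h2, this, mul_one, show Real.pi / (1 / 4) = 4 * Real.pi by ring]
  exact inv_mul_cancel₀ (by positivity)

theorem kernMoment_zero_succ (b : ℕ) : kernMoment 0 (b + 1) = 0 := by
  have h := integral_eq_zero_of_hasDerivAt_of_integrable (fun x => hasDerivAt_kern1 b 1 x)
    (by simpa using (integrable_pow_mul_kern1 0 (b + 1) one_pos).const_mul (-(b + 1 : ℝ)))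
    (by simpa using integrable_pow_mul_kern1 0 b one_pos)
  rw [integral_const_mul] at h
  have h2 : (-((b : ℝ) + 1)) ≠ 0 := by
    have : (0 : ℝ) < b + 1 := by positivity
    linarith
  simpa [kernMoment] using (mul_eq_zero.1 h).resolve_left h2

/-- The derivative of `x ^ (a+1) * kern1 b` integrates to zero. Descending along the diagonals of
`(a, b)` gives the triangular structure: `1` on the diagonal and `0` for `a < b`. -/
theorem kernMoment_succ_succ (a b : ℕ) :
    ((b : ℝ) + 1) * kernMoment (a + 1) (b + 1) = (a + 1) * kernMoment a b := by
  have hd : ∀ x, HasDerivAt (fun x => x ^ (a + 1) * kern1 b 1 x)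
      (((a : ℝ) + 1) * (x ^ a * kern1 b 1 x) -
        ((b : ℝ) + 1) * (x ^ (a + 1) * kern1 (b + 1) 1 x)) x := by
    intro x
    have := (hasDerivAt_pow (a + 1) x).mul (hasDerivAt_kern1 b 1 x)
    refine this.congr_deriv ?_
    push_cast
    ring
  have h := integral_eq_zero_of_hasDerivAt_of_integrable hd
    (((integrable_pow_mul_kern1 a b one_pos).const_mul _).sub
      ((integrable_pow_mul_kern1 (a + 1) (b + 1) one_pos).const_mul _))
    (integrable_pow_mul_kern1 (a + 1) b one_pos)
  rw [integral_sub ((integrable_pow_mul_kern1 a b one_pos).const_mul _)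
      ((integrable_pow_mul_kern1 (a + 1) (b + 1) one_pos).const_mul _), integral_const_mul,
    integral_const_mul] at h
  unfold kernMoment
  linarith

theorem kernMoment_self (a : ℕ) : kernMoment a a = 1 := by
  induction a with
  | zero => exact kernMoment_zero_zero
  | succ a ih =>
    have := kernMoment_succ_succ a a
    rw [ih] at this
    exact mul_left_cancel₀ (by positivity : ((a : ℝ) + 1) ≠ 0) this

theorem kernMoment_of_lt {a b : ℕ} (h : a < b) : kernMoment a b = 0 := by
  induction a generalizing b with
  | zero =>
    obtain ⟨c, rfl⟩ := Nat.exists_eq_succ_of_ne_zero h.ne'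
    exact kernMoment_zero_succ c
  | succ a ih =>
    obtain ⟨c, rfl⟩ := Nat.exists_eq_succ_of_ne_zero (Nat.ne_of_gt (Nat.zero_lt_of_lt h))
    have := kernMoment_succ_succ a c
    rw [ih (by omega), mul_zero] at this
    exact (mul_eq_zero.1 this).resolve_left (by positivity)

/-! ### Convolution with the Gaussian on the line. -/

theorem integral_gauss1_mul_gauss1 {s t : ℝ} (hs : 0 < s) (ht : 0 < t) (x : ℝ) :
    ∫ y, gauss1 t y * gauss1 s (x - y) = gauss1 (t + s) x := by
  have hts : 0 < t + s := by positivity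
  -- Completing the square in `y` leaves a Gaussian centred at `t / (t + s) * x`.
  have h : ∀ y, gauss1 t y * gauss1 s (x - y) =
      ((√(4 * Real.pi * t))⁻¹ * (√(4 * Real.pi * s))⁻¹ * Real.exp (-x ^ 2 / (4 * (t + s)))) *
        Real.exp (-((t + s) / (4 * t * s)) * (y - t / (t + s) * x) ^ 2) := by
    intro y
    unfold gauss1
    have : Real.exp (-y ^ 2 / (4 * t)) * Real.exp (-(x - y) ^ 2 / (4 * s)) =
        Real.exp (-x ^ 2 / (4 * (t + s))) *
        Real.exp (-((t + s) / (4 * t * s)) * (y - t / (t + s) * x) ^ 2) := by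
      rw [← Real.exp_add, ← Real.exp_add]
      congr 1
      field_simp
      ring
    rw [mul_mul_mul_comm, this]
    ring
  simp_rw [h]
  rw [integral_const_mul,
    integral_sub_right_eq_self (fun y => Real.exp (-((t + s) / (4 * t * s)) * y ^ 2)),
    integral_gaussian]
  unfold gauss1
  have : (√(4 * Real.pi * t))⁻¹ * (√(4 * Real.pi * s))⁻¹ * √(Real.pi / ((t + s) / (4 * t * s))) =
      (√(4 * Real.pi * (t + s)))⁻¹ := by
    rw [← Real.sqrt_inv, ← Real.sqrt_inv, ← Real.sqrt_inv, ← Real.sqrt_mul (by positivity),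
      ← Real.sqrt_mul (by positivity)]
    congr 1
    field_simp
  rw [← this]
  ring

theorem integrable_gauss1 {t : ℝ} (ht : 0 < t) : Integrable (gauss1 t) := by
  simpa [kern1_zero] using integrable_pow_mul_kern1 0 0 ht

/-- Convolution commutes with differentiation: the case `k + 1` is the `x`-derivative of the case
`k`, taken under the integral, and uniqueness of derivatives identifies the two sides. -/
theorem integral_gauss1_mul_kern1 (k : ℕ) {s t : ℝ} (hs : 0 < s) (ht : 0 < t) (x : ℝ) :
    ∫ y, gauss1 t y * kern1 k s (x - y) = kern1 k (t + s) x := by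
  induction k generalizing x with
  | zero => simpa only [kern1_zero] using integral_gauss1_mul_gauss1 hs ht x
  | succ k ih =>
    have bdd : ∀ k, ∃ C : ℝ, 0 < C ∧ ∀ x, |kern1 k s x| ≤ C := by
      intro k
      obtain ⟨C, hC, h⟩ := exists_kern1_bound_time k hs
      refine ⟨C, hC, fun x => (h x).trans (mul_le_of_le_one_right hC.le ?_)⟩
      rw [Real.exp_le_one_iff, neg_div]
      exact neg_nonpos.2 (by positivity)
    obtain ⟨C, hC, h⟩ := bdd (k + 1)
    obtain ⟨C', -, h0⟩ := bdd k
    have cg : Continuous (gauss1 t) := (contDiff_gauss1 t).continuous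
    have hder := (hasDerivAt_integral_of_dominated_loc_of_deriv_le (μ := volume) (x₀ := x)
      (F := fun x y => gauss1 t y * kern1 k s (x - y))
      (F' := fun x y => gauss1 t y * (-(k + 1) * kern1 (k + 1) s (x - y)))
      (bound := fun y => gauss1 t y * ((k + 1) * C)) (s := univ) univ_mem
      (Eventually.of_forall fun z => (cg.mul
        ((continuous_kern1 k s).comp (by fun_prop))).aestronglyMeasurable)
      (by
        refine ((integrable_gauss1 ht).mul_const C').mono' (cg.mul
          ((continuous_kern1 k s).comp (by fun_prop))).aestronglyMeasurable
          (Eventually.of_forall fun y => ?_)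
        rw [norm_mul, Real.norm_of_nonneg (gauss1_nonneg t y)]
        exact mul_le_mul_of_nonneg_left (h0 _) (gauss1_nonneg t y))
      (cg.mul (continuous_const.mul
        ((continuous_kern1 (k + 1) s).comp (by fun_prop)))).aestronglyMeasurable
      (Eventually.of_forall fun y z _ => by
        rw [norm_mul, Real.norm_of_nonneg (gauss1_nonneg t y), norm_mul, norm_neg,
          Real.norm_of_nonneg (by positivity)]
        exact mul_le_mul_of_nonneg_left (mul_le_mul_of_nonneg_left (h _) (by positivity))
          (gauss1_nonneg t y))
      ((integrable_gauss1 ht).mul_const _)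
      (Eventually.of_forall fun y z _ => by
        have := (hasDerivAt_kern1 k s (z - y)).comp z ((hasDerivAt_id z).sub_const y)
        simpa using this.const_mul (gauss1 t y))).2
    have hfun : (fun z => ∫ y, gauss1 t y * kern1 k s (z - y)) = kern1 k (t + s) := funext ih
    rw [hfun] at hder
    have hu := hder.unique (hasDerivAt_kern1 k (t + s) x)
    have : ∀ y, gauss1 t y * (-((k : ℝ) + 1) * kern1 (k + 1) s (x - y)) =
        -((k : ℝ) + 1) * (gauss1 t y * kern1 (k + 1) s (x - y)) := fun y => by ring
    simp_rw [this] at hu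
    rw [integral_const_mul] at hu
    exact mul_left_cancel₀ (by have : (0 : ℝ) < k + 1 := by positivity
                               linarith) hu

theorem integral_gauss1_sub_mul_kern1 (k : ℕ) {s t : ℝ} (hs : 0 < s) (ht : 0 < t) (x : ℝ) :
    ∫ y, gauss1 t (x - y) * kern1 k s y = kern1 k (t + s) x := by
  rw [← integral_gauss1_mul_kern1 k hs ht x,
    ← integral_sub_left_eq_self (fun y => gauss1 t y * kern1 k s (x - y)) volume x]
  simp


/-! ### The kernels `g_α` as products of one-dimensional kernels -/

variable {N : ℕ}

theorem integral_space_prod (f : Fin N → ℝ → ℝ) :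
    ∫ x : Space N, ∏ i, f i (x i) = ∏ i, ∫ y, f i y := by
  rw [← integral_fintype_prod_volume_eq_prod,
    ← (EuclideanSpace.volume_preserving_symm_measurableEquiv_toLp (Fin N)).integral_comp']
  rfl

theorem integrable_space_prod {f : Fin N → ℝ → ℝ} (hf : ∀ i, Integrable (f i)) :
    Integrable (fun x : Space N => ∏ i, f i (x i)) := by
  have h := Integrable.fintype_prod (μ := fun _ : Fin N => (volume : Measure ℝ)) hf
  exact (EuclideanSpace.volume_preserving_symm_measurableEquiv_toLp (Fin N)).integrable_comp_of_integrable h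

theorem partialDeriv_prod {f : Fin N → ℝ → ℝ} (hf : ∀ i, Differentiable ℝ (f i)) (j : Fin N) :
    partialDeriv j (fun x : Space N => ∏ i, f i (x i)) =
      fun x => ∏ i, (Function.update f j (deriv (f j))) i (x i) := by
  ext x
  have hd : DifferentiableAt ℝ (fun x : Space N => ∏ i, f i (x i)) x := by
    refine (HasFDerivAt.finsetProd (𝕜 := ℝ) (g := fun i (x : Space N) => f i (x i))
      fun i _ => DifferentiableAt.hasFDerivAt ?_).differentiableAt
    exact (hf i (x i)).comp x (by fun_prop : DifferentiableAt ℝ (fun x : Space N => x i) x)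
  unfold partialDeriv
  rw [← hd.lineDeriv_eq_fderiv, lineDeriv]
  have h1 : (fun t : ℝ => ∏ i, f i ((x + t • EuclideanSpace.single j (1 : ℝ)) i)) =
      fun t => f j (x j + t) * ∏ i ∈ Finset.univ.erase j, f i (x i) := by
    ext t
    rw [← Finset.mul_prod_erase _ _ (Finset.mem_univ j)]
    congr 1
    · simp
    · refine Finset.prod_congr rfl fun i hi => ?_
      simp [Finset.ne_of_mem_erase hi]
  rw [h1, deriv_mul_const (by fun_prop), deriv_comp_const_add, add_zero,
    ← Finset.mul_prod_erase _ _ (Finset.mem_univ j)]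
  congr 1
  · simp
  · refine Finset.prod_congr rfl fun i hi => ?_
    rw [Function.update_of_ne (Finset.ne_of_mem_erase hi)]

theorem iterate_partialDeriv_prod {f : Fin N → ℝ → ℝ} (hf : ∀ i, ContDiff ℝ (⊤ : ℕ∞) (f i))
    (j : Fin N) (m : ℕ) :
    (partialDeriv j)^[m] (fun x : Space N => ∏ i, f i (x i)) =
      fun x => ∏ i, (Function.update f j (iteratedDeriv m (f j))) i (x i) := by
  induction m with
  | zero => simp
  | succ m ih =>
    rw [Function.iterate_succ_apply', ih, partialDeriv_prod]
    · simp [iteratedDeriv_succ]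
    · intro i
      by_cases h : i = j
      · subst h
        simpa using (hf i).differentiable_iteratedDeriv m
          (by exact_mod_cast WithTop.coe_lt_top m)
      · rw [Function.update_of_ne h]
        exact (hf i).differentiable (by simp)

theorem multiDeriv_prod {f : Fin N → ℝ → ℝ} (hf : ∀ i, ContDiff ℝ (⊤ : ℕ∞) (f i))
    (α : MultiIndex N) :
    multiDeriv α (fun x : Space N => ∏ i, f i (x i)) =
      fun x => ∏ i, iteratedDeriv (α i) (f i) (x i) := by
  -- The coordinates are treated one at a time. As the list has no repetitions, the factor of
  -- coordinate `j` is still undifferentiated when its turn comes.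
  have key : ∀ l : List (Fin N), l.Nodup →
      l.foldr (fun i h => (partialDeriv i)^[α i] h) (fun x : Space N => ∏ i, f i (x i)) =
        fun x => ∏ i, (if i ∈ l then iteratedDeriv (α i) (f i) else f i) (x i) := by
    intro l
    induction l with
    | nil => intro _; simp
    | cons j l ih =>
      intro hl
      rw [List.nodup_cons] at hl
      rw [List.foldr_cons, ih hl.2, iterate_partialDeriv_prod]
      · ext x
        refine Finset.prod_congr rfl fun i _ => ?_
        by_cases h : i = j
        · subst h
          simp [hl.1]
        · rw [Function.update_of_ne h]
          simp [h]
      · intro i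
        split_ifs
        · rw [iteratedDeriv_eq_iterate]
          exact ContDiff.iterate_deriv (α i) (hf i)
        · exact hf i
  unfold multiDeriv
  rw [key _ (List.nodup_finRange N)]
  simp

theorem heatKernel_eq_prod {τ : ℝ} (hτ : 0 < τ) (x : Space N) :
    heatKernel τ x = ∏ i, gauss1 τ (x i) := by
  unfold heatKernel gauss1
  rw [Finset.prod_mul_distrib, Finset.prod_const, ← Real.exp_sum, EuclideanSpace.real_norm_sq_eq,
    Finset.card_univ, Fintype.card_fin]
  congr 1
  · rw [Real.sqrt_eq_rpow, ← Real.rpow_neg (by positivity), ← Real.rpow_natCast,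
      ← Real.rpow_mul (by positivity)]
    congr 1
    ring
  · rw [← Finset.sum_div, Finset.sum_neg_distrib]

/-- The moments, the pointwise bounds and the semigroup law of `g_α` are all read off coordinate by
coordinate from this product. -/
theorem gDeriv_eq_prod (α : MultiIndex N) {t : ℝ} (ht : 0 < t + 1) (x : Space N) :
    gDeriv α t x = ∏ i, kern1 (α i) (t + 1) (x i) := by
  unfold gDeriv kern1
  have : (shiftedKernel t : Space N → ℝ) = fun x => ∏ i, gauss1 (t + 1) (x i) := by
    ext x; exact heatKernel_eq_prod ht x
  rw [this, multiDeriv_prod fun _ => (contDiff_gauss1 _).of_le le_top, Finset.prod_mul_distrib,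
    Finset.prod_div_distrib, Finset.prod_pow_eq_pow_sum]
  simp [order]

theorem gDeriv_zero (t : ℝ) : gDeriv (0 : MultiIndex N) t = shiftedKernel t := by
  ext x
  have : multiDeriv (0 : MultiIndex N) (shiftedKernel t) = shiftedKernel t := by
    unfold multiDeriv
    generalize List.finRange N = l
    induction l with
    | nil => rfl
    | cons j l ih => simp
  simp [gDeriv, order, this]

theorem order_zero : order (0 : MultiIndex N) = 0 := by simp [order]

theorem continuous_gDeriv (α : MultiIndex N) {t : ℝ} (ht : 0 < t + 1) :
    Continuous (gDeriv α t) := by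
  rw [show gDeriv α t = _ from funext (gDeriv_eq_prod α ht)]
  exact continuous_finsetProd _ fun i _ => (continuous_kern1 _ _).comp (by fun_prop)

theorem continuous_monomial (α : MultiIndex N) : Continuous (monomial α) := by
  unfold monomial
  fun_prop

theorem abs_monomial_le (α : MultiIndex N) (x : Space N) : |monomial α x| ≤ ‖x‖ ^ order α := by
  unfold monomial order
  rw [Finset.abs_prod, ← Finset.prod_pow_eq_pow_sum]
  refine Finset.prod_le_prod (fun _ _ => abs_nonneg _) fun i _ => ?_
  rw [abs_pow]
  gcongr
  exact PiLp.norm_apply_le x i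

theorem integrable_monomial_mul_gDeriv (α β : MultiIndex N) {t : ℝ} (ht : 0 < t + 1) :
    Integrable (fun x => monomial α x * gDeriv β t x) := by
  simp_rw [gDeriv_eq_prod β ht, monomial, ← Finset.prod_mul_distrib]
  exact integrable_space_prod fun i => integrable_pow_mul_kern1 (α i) (β i) ht

theorem integrable_gDeriv (β : MultiIndex N) {t : ℝ} (ht : 0 < t + 1) :
    Integrable (gDeriv β t) := by
  simpa [monomial] using integrable_monomial_mul_gDeriv 0 β ht

theorem integral_monomial_mul_gDeriv (α β : MultiIndex N) {t : ℝ} (ht : 0 < t + 1) :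
    ∫ x, monomial α x * gDeriv β t x =
      √(t + 1) ^ order α * (√(t + 1))⁻¹ ^ order β * ∏ i, kernMoment (α i) (β i) := by
  simp_rw [gDeriv_eq_prod β ht, monomial, ← Finset.prod_mul_distrib]
  rw [integral_space_prod (fun i y => y ^ α i * kern1 (β i) (t + 1) y)]
  simp_rw [integral_pow_mul_kern1 _ _ ht]
  rw [Finset.prod_mul_distrib, Finset.prod_mul_distrib, Finset.prod_pow_eq_pow_sum,
    Finset.prod_pow_eq_pow_sum]
  rfl

/-- A single coordinate with `α i < β i` contributes a vanishing factor; this is the triangularity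
in the componentwise order. -/
theorem integral_monomial_mul_gDeriv_of_not_le {α β : MultiIndex N} (h : ¬ β ≤ α) {t : ℝ}
    (ht : 0 < t + 1) : ∫ x, monomial α x * gDeriv β t x = 0 := by
  rw [Pi.le_def] at h
  push Not at h
  obtain ⟨i, hi⟩ := h
  rw [integral_monomial_mul_gDeriv α β ht, Finset.prod_eq_zero (Finset.mem_univ i), mul_zero]
  exact kernMoment_of_lt hi

theorem integral_monomial_mul_gDeriv_self (α : MultiIndex N) {t : ℝ} (ht : 0 < t + 1) :
    ∫ x, monomial α x * gDeriv α t x = 1 := by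
  have : √(t + 1) ≠ 0 := (Real.sqrt_pos.2 ht).ne'
  rw [integral_monomial_mul_gDeriv α α ht, Finset.prod_eq_one fun i _ => kernMoment_self (α i),
    inv_pow, mul_inv_cancel₀ (by positivity), one_mul]

theorem exists_gDeriv_bound (α : MultiIndex N) :
    ∃ C : ℝ, 0 < C ∧ ∀ t : ℝ, 0 < t + 1 → ∀ x : Space N, |gDeriv α t x| ≤
      C * (√(t + 1))⁻¹ ^ (N + order α) * Real.exp (-‖x‖ ^ 2 / (8 * (t + 1))) := by
  choose C hC h using exists_kern1_bound
  refine ⟨∏ i, C (α i), Finset.prod_pos fun i _ => hC _, fun t ht x => ?_⟩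
  have h1 : (√(t + 1))⁻¹ ^ (N + order α) = ∏ i, (√(t + 1))⁻¹ ^ (α i + 1) := by
    rw [Finset.prod_pow_eq_pow_sum, Finset.sum_add_distrib]
    simp [order, add_comm]
  have h2 : Real.exp (-‖x‖ ^ 2 / (8 * (t + 1))) =
      ∏ i, Real.exp (-((√(t + 1))⁻¹ * x i) ^ 2 / 8) := by
    rw [← Real.exp_sum, EuclideanSpace.real_norm_sq_eq, ← Finset.sum_div, Finset.sum_neg_distrib]
    simp_rw [mul_pow]
    rw [← Finset.mul_sum, inv_pow, Real.sq_sqrt ht.le]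
    congr 1
    field_simp
  rw [gDeriv_eq_prod α ht, Finset.abs_prod, h1, h2, ← Finset.prod_mul_distrib,
    ← Finset.prod_mul_distrib]
  refine Finset.prod_le_prod (fun _ _ => abs_nonneg _) fun i _ => ?_
  rw [kern1_scale _ ht, abs_mul, abs_of_nonneg (by positivity), mul_comm (C (α i)), mul_assoc]
  gcongr
  exact h _ _

/-! ### The heat kernel and the flow of the functions `g_α`. -/

theorem heatKernel_nonneg {τ : ℝ} (hτ : 0 ≤ τ) (x : Space N) : 0 ≤ heatKernel τ x := by
  unfold heatKernel
  positivity

theorem continuous_heatKernel (τ : ℝ) : Continuous (heatKernel τ : Space N → ℝ) := by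
  unfold heatKernel
  fun_prop

/-- The kernel at time `τ` is `g_0` at time `τ - 1`. This is why facts on `gDeriv` are proved under
`0 < t + 1` and not only for positive times. -/
theorem heatKernel_eq_gDeriv (τ : ℝ) : (heatKernel τ : Space N → ℝ) = gDeriv 0 (τ - 1) := by
  rw [gDeriv_zero]
  ext x
  simp [shiftedKernel]

theorem integrable_heatKernel {τ : ℝ} (hτ : 0 < τ) : Integrable (heatKernel τ : Space N → ℝ) := by
  rw [heatKernel_eq_gDeriv]
  exact integrable_gDeriv 0 (by linarith)

theorem integral_heatKernel {τ : ℝ} (hτ : 0 < τ) : ∫ x : Space N, heatKernel τ x = 1 := by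
  have := integral_monomial_mul_gDeriv_self (0 : MultiIndex N) (t := τ - 1) (by linarith)
  rw [← heatKernel_eq_gDeriv] at this
  simpa [monomial] using this

/-- The heat flow commutes with derivatives, so it merely moves the time parameter of `g_α`. Terms
of the form `M_α g_α` can thus be carried through Duhamel's formula exactly. -/
theorem heatFlow_gDeriv (α : MultiIndex N) {s τ : ℝ} (hs : 0 < s + 1) (hτ : 0 < τ)
    (x : Space N) : heatFlow τ (gDeriv α s) x = gDeriv α (s + τ) x := by
  unfold heatFlow
  simp_rw [heatKernel_eq_prod hτ, gDeriv_eq_prod α hs, ← Finset.prod_mul_distrib]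
  rw [gDeriv_eq_prod α (by linarith)]
  have := integral_space_prod (fun i y => gauss1 τ (x i - y) * kern1 (α i) (s + 1) y)
  simp only [PiLp.sub_apply]
  rw [this]
  refine Finset.prod_congr rfl fun i _ => ?_
  rw [integral_gauss1_sub_mul_kern1 _ hs hτ]
  congr 1
  ring

theorem integral_heatKernel_mul_heatKernel {s τ : ℝ} (hs : 0 < s) (hτ : 0 < τ) (x : Space N) :
    ∫ y, heatKernel τ (x - y) * heatKernel s y = heatKernel (s + τ) x := by
  have := heatFlow_gDeriv (0 : MultiIndex N) (s := s - 1) (by linarith) hτ x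
  rw [show s - 1 + τ = s + τ - 1 by ring, ← heatKernel_eq_gDeriv, ← heatKernel_eq_gDeriv] at this
  exact this

/-! ### Corrected moments -/

theorem order_le_of_le {α β : MultiIndex N} (h : β ≤ α) : order β ≤ order α :=
  Finset.sum_le_sum fun i _ => h i

theorem mem_indicesUpTo_of_le {K : ℝ} (hK : 0 ≤ K) {α β : MultiIndex N} (h : β ≤ α)
    (hα : (order α : ℝ) ≤ K) : β ∈ indicesUpTo N K := by
  rw [mem_indicesUpTo hK]
  exact le_trans (by exact_mod_cast order_le_of_le h) hα

/-- By triangularity only `β ≤ α` survive in the sum, and `β = α` contributes `M_α` itself; the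
recursion defining `M_α` says precisely that the total is zero. -/
theorem integral_monomial_mul_momentProj {K : ℝ} (hK : 0 ≤ K) {t : ℝ} (ht : 0 < t + 1)
    {α : MultiIndex N} (hα : (order α : ℝ) ≤ K) {f : Space N → ℝ}
    (hf : Integrable (fun x => monomial α x * f x)) :
    ∫ x, monomial α x * momentProj K t f x = 0 := by
  unfold momentProj
  have h1 : ∀ x, monomial α x * (f x - ∑ β ∈ indicesUpTo N K, moment β f t * gDeriv β t x) =
      monomial α x * f x - ∑ β ∈ indicesUpTo N K, moment β f t *
        (monomial α x * gDeriv β t x) := by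
    intro x
    rw [mul_sub, Finset.mul_sum]
    congr 1
    exact Finset.sum_congr rfl fun β _ => by ring
  have hint : ∀ β ∈ indicesUpTo N K, Integrable fun x => moment β f t *
      (monomial α x * gDeriv β t x) :=
    fun β _ => (integrable_monomial_mul_gDeriv α β ht).const_mul _
  simp_rw [h1]
  rw [integral_sub hf (integrable_finsetSum _ hint), integral_finsetSum _ hint]
  simp_rw [integral_const_mul]
  have h2 : ∑ β ∈ indicesUpTo N K, moment β f t * ∫ x, monomial α x * gDeriv β t x =
      ∑ β ∈ Finset.Iic α, moment β f t * ∫ x, monomial α x * gDeriv β t x := by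
    symm
    refine Finset.sum_subset (fun β hβ => mem_indicesUpTo_of_le hK (Finset.mem_Iic.1 hβ) hα) ?_
    intro β _ hβ
    rw [Finset.mem_Iic] at hβ
    rw [integral_monomial_mul_gDeriv_of_not_le hβ ht, mul_zero]
  rw [h2, ← Finset.Iio_insert, Finset.sum_insert (by simp),
    integral_monomial_mul_gDeriv_self α ht, moment_eq α f t]
  ring

theorem moment_sub {K : ℝ} {t : ℝ} {α : MultiIndex N} (hα : (order α : ℝ) ≤ K)
    {f g : Space N → ℝ}
    (hf : ∀ β : MultiIndex N, (order β : ℝ) ≤ K → Integrable (fun x => monomial β x * f x))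
    (hg : ∀ β : MultiIndex N, (order β : ℝ) ≤ K → Integrable (fun x => monomial β x * g x)) :
    moment α (fun x => f x - g x) t = moment α f t - moment α g t := by
  induction α using WellFoundedLT.induction with
  | ind α ih =>
    rw [moment_eq, moment_eq α f, moment_eq α g]
    simp_rw [mul_sub]
    rw [integral_sub (hf α hα) (hg α hα)]
    have : ∀ β ∈ Finset.Iio α,
        moment β (fun x => f x - g x) t * ∫ x, monomial α x * gDeriv β t x =
        moment β f t * (∫ x, monomial α x * gDeriv β t x) -
          moment β g t * ∫ x, monomial α x * gDeriv β t x := by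
      intro β hβ
      rw [Finset.mem_Iio] at hβ
      rw [ih β hβ (le_trans (by exact_mod_cast order_le_of_le hβ.le) hα), sub_mul]
    rw [Finset.sum_congr rfl this, Finset.sum_sub_distrib]
    ring

theorem moment_zero (f : Space N → ℝ) (t : ℝ) : moment 0 f t = ∫ x, f x := by
  rw [moment_eq]
  have : Finset.Iio (0 : MultiIndex N) = ∅ := by
    ext β
    simp
  simp [this, monomial]


/-! ### Scale-invariant weighted norms -/

/-- The weight `1 + (|x| / √T) ^ K`. -/
noncomputable def weight (K T : ℝ) (x : Space N) : ℝ := 1 + (‖x‖ / √T) ^ K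

/-- The weighted `L¹` norm at the spatial scale `√T`. -/
noncomputable def wnorm (K T : ℝ) (f : Space N → ℝ) : ℝ≥0∞ :=
  ∫⁻ x, ‖f x‖ₑ * ENNReal.ofReal (weight K T x)

/-- The sum of the weighted `L¹` norm and the normalized `L^∞` norm at the spatial scale `√T`. -/
noncomputable def xnorm (K T : ℝ) (f : Space N → ℝ) : ℝ≥0∞ :=
  wnorm K T f + ENNReal.ofReal (√T ^ N) * eLpNorm f ⊤ volume

theorem one_le_weight (K T : ℝ) (x : Space N) : 1 ≤ weight K T x := by
  have : 0 ≤ (‖x‖ / √T) ^ K := by positivity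
  unfold weight
  linarith

theorem weight_nonneg (K T : ℝ) (x : Space N) : 0 ≤ weight K T x :=
  zero_le_one.trans (one_le_weight K T x)

theorem measurable_weight (K T : ℝ) : Measurable (weight K T : Space N → ℝ) := by
  unfold weight
  fun_prop

theorem measurable_ofReal_weight (K T : ℝ) :
    Measurable fun x : Space N => ENNReal.ofReal (weight K T x) :=
  ENNReal.measurable_ofReal.comp (measurable_weight K T)

theorem weight_anti {K S T : ℝ} (hK : 0 ≤ K) (hS : 0 < S) (hST : S ≤ T) (x : Space N) :
    weight K T x ≤ weight K S x := by
  unfold weight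
  have := Real.sqrt_pos.2 hS
  gcongr

theorem pow_le_one_add_rpow {K : ℝ} {a : ℝ} (ha : 0 ≤ a) (haK : a ≤ K) {r : ℝ} (hr : 0 ≤ r) :
    r ^ a ≤ 1 + r ^ K := by
  rcases le_total r 1 with h | h
  · have h1 := Real.rpow_le_one hr h ha
    have : 0 ≤ r ^ K := by positivity
    linarith
  · have := Real.rpow_le_rpow_of_exponent_le h haK
    linarith

theorem wnorm_mono {K T : ℝ} {f g : Space N → ℝ} {c : ℝ≥0∞}
    (h : ∀ᵐ x, ‖f x‖ₑ ≤ c * ‖g x‖ₑ) (hg : AEStronglyMeasurable g) :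
    wnorm K T f ≤ c * wnorm K T g := by
  unfold wnorm
  have hm : AEMeasurable (fun x => ‖g x‖ₑ * ENNReal.ofReal (weight K T x)) :=
    hg.enorm.mul (measurable_ofReal_weight K T).aemeasurable
  rw [← lintegral_const_mul'' _ hm]
  refine lintegral_mono_ae (h.mono fun x hx => ?_)
  rw [← mul_assoc]
  gcongr

theorem xnorm_mono {K T : ℝ} {f g : Space N → ℝ} {c : ℝ≥0∞}
    (h : ∀ᵐ x, ‖f x‖ₑ ≤ c * ‖g x‖ₑ) (hg : AEStronglyMeasurable g) :
    xnorm K T f ≤ c * xnorm K T g := by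
  unfold xnorm
  rw [mul_add]
  refine add_le_add (wnorm_mono h hg) ?_
  rw [mul_left_comm]
  gcongr
  rw [eLpNorm_exponent_top, eLpNorm_exponent_top]
  refine essSup_le_of_ae_le _ ?_
  filter_upwards [h, enorm_ae_le_eLpNormEssSup g volume] with x hx hx'
  exact hx.trans (by gcongr)

theorem wnorm_le_xnorm (K T : ℝ) (f : Space N → ℝ) : wnorm K T f ≤ xnorm K T f := le_self_add

theorem lintegral_le_wnorm (K T : ℝ) (f : Space N → ℝ) : ∫⁻ x, ‖f x‖ₑ ≤ wnorm K T f := by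
  refine lintegral_mono fun x => ?_
  exact le_mul_of_one_le_right (by positivity) (ENNReal.one_le_ofReal.2 (one_le_weight K T x))

theorem wnorm_add_le {K T : ℝ} {f g : Space N → ℝ} (hf : AEStronglyMeasurable f) :
    wnorm K T (fun x => f x + g x) ≤ wnorm K T f + wnorm K T g := by
  unfold wnorm
  have hm : AEMeasurable (fun x => ‖f x‖ₑ * ENNReal.ofReal (weight K T x)) :=
    hf.enorm.mul (measurable_ofReal_weight K T).aemeasurable
  rw [← lintegral_add_left' hm]
  refine lintegral_mono fun x => ?_
  rw [← add_mul]
  gcongr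
  exact enorm_add_le _ _

theorem xnorm_add_le {K T : ℝ} {f g : Space N → ℝ} (hf : AEStronglyMeasurable f)
    (hg : AEStronglyMeasurable g) :
    xnorm K T (fun x => f x + g x) ≤ xnorm K T f + xnorm K T g := by
  unfold xnorm
  rw [add_add_add_comm, ← mul_add]
  gcongr
  · exact wnorm_add_le hf
  · exact eLpNorm_add_le hf hg le_top

theorem xnorm_neg (K T : ℝ) (f : Space N → ℝ) : xnorm K T (fun x => - f x) = xnorm K T f := by
  unfold xnorm wnorm
  congr 1
  · simp
  · rw [show (fun x => - f x) = -f from rfl, eLpNorm_neg]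

theorem xnorm_sub_le {K T : ℝ} {f g : Space N → ℝ} (hf : AEStronglyMeasurable f)
    (hg : AEStronglyMeasurable g) :
    xnorm K T (fun x => f x - g x) ≤ xnorm K T f + xnorm K T g := by
  simp_rw [sub_eq_add_neg]
  refine (xnorm_add_le hf hg.neg).trans_eq ?_
  congr 1
  exact xnorm_neg K T g

theorem xnorm_const_mul_le {K T : ℝ} (c : ℝ) {f : Space N → ℝ} (hf : AEStronglyMeasurable f) :
    xnorm K T (fun x => c * f x) ≤ ‖c‖ₑ * xnorm K T f :=
  xnorm_mono (Eventually.of_forall fun x => by rw [enorm_mul]) hf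

theorem xnorm_zero (K T : ℝ) : xnorm K T (fun _ : Space N => (0 : ℝ)) = 0 := by
  have : eLpNorm (fun _ : Space N => (0 : ℝ)) ⊤ volume = 0 := eLpNorm_zero'
  simp [xnorm, wnorm, this]

theorem xnorm_sum_le {ι : Type*} {K T : ℝ} (s : Finset ι) {f : ι → Space N → ℝ}
    (hf : ∀ i ∈ s, AEStronglyMeasurable (f i)) :
    xnorm K T (fun x => ∑ i ∈ s, f i x) ≤ ∑ i ∈ s, xnorm K T (f i) := by
  classical
  induction s using Finset.induction_on with
  | empty => simp [xnorm_zero]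
  | insert i s hi ih =>
    simp_rw [Finset.sum_insert hi]
    refine (xnorm_add_le (hf i (Finset.mem_insert_self i s))
      (Finset.aestronglyMeasurable_fun_sum _ fun j hj => hf j (Finset.mem_insert_of_mem hj))).trans ?_
    gcongr
    exact ih fun j hj => hf j (Finset.mem_insert_of_mem hj)

/-- The weight and the Gaussian live on the same scale `√T`. Half of the Gaussian absorbs the weight
with a constant independent of `T`, and the other half integrates to a multiple of `√T ^ N`. -/
theorem exists_lintegral_exp_mul_weight_le (N : ℕ) {K : ℝ} (hK : 0 ≤ K) {c : ℝ} (hc : 0 < c) :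
    ∃ C : ℝ, 0 < C ∧ ∀ T : ℝ, 0 < T →
      ∫⁻ x : Space N, ENNReal.ofReal (Real.exp (-(c * ‖x‖ ^ 2 / T))) *
        ENNReal.ofReal (weight K T x) ≤ ENNReal.ofReal (C * √T ^ N) := by
  obtain ⟨C, hC, h⟩ := exists_one_add_rpow_le K (c := c / 2) (by positivity)
  refine ⟨C * √(Real.pi / (c / 2)) ^ N, by positivity, fun T hT => ?_⟩
  have hs : 0 < √T := Real.sqrt_pos.2 hT
  have h1 : ∀ x : Space N, ENNReal.ofReal (Real.exp (-(c * ‖x‖ ^ 2 / T))) *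
      ENNReal.ofReal (weight K T x) ≤
      ENNReal.ofReal (C * Real.exp (-(c / 2 / T) * ‖x‖ ^ 2)) := by
    intro x
    rw [← ENNReal.ofReal_mul (by positivity)]
    refine ENNReal.ofReal_le_ofReal ?_
    have h2 := (h (‖x‖ / √T) (by positivity)).resolve_right (not_lt.2 hK)
    calc Real.exp (-(c * ‖x‖ ^ 2 / T)) * weight K T x
        ≤ Real.exp (-(c * ‖x‖ ^ 2 / T)) * (C * Real.exp (c / 2 * (‖x‖ / √T) ^ 2)) := by
          unfold weight; gcongr
      _ = C * (Real.exp (-(c * ‖x‖ ^ 2 / T)) * Real.exp (c / 2 * (‖x‖ / √T) ^ 2)) := by ring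
      _ = _ := by
        rw [← Real.exp_add, div_pow, Real.sq_sqrt hT.le]
        congr 2
        ring
  have hb : 0 < c / 2 / T := by positivity
  have hi : Integrable (fun x : Space N => Real.exp (-(c / 2 / T) * ‖x‖ ^ 2)) := by
    have := GaussianFourier.integrable_cexp_neg_mul_sq_norm_add (V := Space N) (b := (c / 2 / T : ℝ))
      (by simpa using hb) 0 0
    have h' := this.norm
    refine h'.congr (Eventually.of_forall fun x => ?_)
    simp only [Complex.norm_exp]
    congr 1
    simp [← Complex.ofReal_pow]
  refine (lintegral_mono h1).trans ?_
  rw [← ofReal_integral_eq_lintegral_ofReal (hi.const_mul C)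
    (Eventually.of_forall fun x => by positivity), integral_const_mul,
    GaussianFourier.integral_rexp_neg_mul_sq_norm hb]
  refine ENNReal.ofReal_le_ofReal (le_of_eq ?_)
  rw [mul_assoc, ← mul_pow, ← Real.sqrt_mul (by positivity), finrank_euclideanSpace_fin,
    Real.sqrt_eq_rpow, ← Real.rpow_natCast, ← Real.rpow_mul (by positivity)]
  congr 2
  · field_simp
  · ring

theorem eLpNorm_top_le_of_forall {f : Space N → ℝ} {c : ℝ≥0∞} (h : ∀ x, ‖f x‖ₑ ≤ c) :
    eLpNorm f ⊤ volume ≤ c := by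
  rw [eLpNorm_exponent_top]
  exact essSup_le_of_ae_le _ (Eventually.of_forall h)

theorem exists_xnorm_gDeriv_le {K : ℝ} (hK : 0 ≤ K) (α : MultiIndex N) :
    ∃ C : ℝ, 0 < C ∧ ∀ t : ℝ, 0 < t + 1 →
      xnorm K (t + 1) (gDeriv α t) ≤ ENNReal.ofReal (C * (√(t + 1))⁻¹ ^ order α) := by
  obtain ⟨C, hC, h⟩ := exists_gDeriv_bound α
  obtain ⟨D, hD, h'⟩ := exists_lintegral_exp_mul_weight_le N hK (c := 1 / 8) (by norm_num)
  refine ⟨C * D + C, by positivity, fun t ht => ?_⟩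
  have hs : 0 < √(t + 1) := Real.sqrt_pos.2 ht
  unfold xnorm wnorm
  rw [add_mul, ENNReal.ofReal_add (by positivity) (by positivity)]
  have hexp : ∀ x : Space N, -‖x‖ ^ 2 / (8 * (t + 1)) = -(1 / 8 * ‖x‖ ^ 2 / (t + 1)) := by
    intro x; field_simp
  gcongr
  · calc ∫⁻ x, ‖gDeriv α t x‖ₑ * ENNReal.ofReal (weight K (t + 1) x)
        ≤ ∫⁻ x : Space N, ENNReal.ofReal (C * (√(t + 1))⁻¹ ^ (N + order α)) *
          (ENNReal.ofReal (Real.exp (-(1 / 8 * ‖x‖ ^ 2 / (t + 1)))) *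
            ENNReal.ofReal (weight K (t + 1) x)) := by
          refine lintegral_mono fun x => ?_
          rw [← mul_assoc, ← ENNReal.ofReal_mul (by positivity), ← hexp,
            Real.enorm_eq_ofReal_abs]
          gcongr
          exact h t ht x
      _ ≤ ENNReal.ofReal (C * (√(t + 1))⁻¹ ^ (N + order α)) *
          ENNReal.ofReal (D * √(t + 1) ^ N) := by
          rw [lintegral_const_mul' _ _ ENNReal.ofReal_ne_top]
          gcongr
          exact h' _ ht
      _ = _ := by
        rw [← ENNReal.ofReal_mul (by positivity)]
        congr 1
        rw [pow_add, inv_pow, inv_pow]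
        field_simp
  · calc ENNReal.ofReal (√(t + 1) ^ N) * eLpNorm (gDeriv α t) ⊤ volume
        ≤ ENNReal.ofReal (√(t + 1) ^ N) *
          ENNReal.ofReal (C * (√(t + 1))⁻¹ ^ (N + order α)) := by
          gcongr
          refine eLpNorm_top_le_of_forall fun x => ?_
          rw [Real.enorm_eq_ofReal_abs]
          refine ENNReal.ofReal_le_ofReal ((h t ht x).trans ?_)
          refine mul_le_of_le_one_right (by positivity) ?_
          rw [Real.exp_le_one_iff, hexp]
          exact neg_nonpos.2 (by positivity)
      _ = _ := by
        rw [← ENNReal.ofReal_mul (by positivity)]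
        congr 1
        rw [pow_add, inv_pow, inv_pow]
        field_simp

theorem lintegral_monomial_mul_le {K T : ℝ} (hT : 0 < T) {α : MultiIndex N}
    (hα : (order α : ℝ) ≤ K) (f : Space N → ℝ) :
    ∫⁻ x, ‖monomial α x * f x‖ₑ ≤ ENNReal.ofReal (√T ^ order α) * wnorm K T f := by
  have hs : 0 < √T := Real.sqrt_pos.2 hT
  unfold wnorm
  rw [← lintegral_const_mul' _ _ ENNReal.ofReal_ne_top]
  refine lintegral_mono fun x => ?_
  rw [enorm_mul, mul_left_comm, mul_comm]
  gcongr
  rw [← ENNReal.ofReal_mul (by positivity), Real.enorm_eq_ofReal_abs]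
  refine ENNReal.ofReal_le_ofReal ((abs_monomial_le α x).trans ?_)
  have h := pow_le_one_add_rpow (Nat.cast_nonneg (order α)) hα
    (show 0 ≤ ‖x‖ / √T by positivity)
  rw [Real.rpow_natCast, div_pow, div_le_iff₀ (by positivity), mul_comm] at h
  exact h

theorem integrable_monomial_mul {K T : ℝ} (hT : 0 < T) {α : MultiIndex N}
    (hα : (order α : ℝ) ≤ K) {f : Space N → ℝ} (hf : AEStronglyMeasurable f)
    (hfin : wnorm K T f < ⊤) : Integrable (fun x => monomial α x * f x) := by
  refine ⟨(continuous_monomial α).aestronglyMeasurable.mul hf, ?_⟩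
  exact (lintegral_monomial_mul_le hT hα f).trans_lt
    (ENNReal.mul_lt_top ENNReal.ofReal_lt_top hfin)

theorem integrable_of_wnorm_lt_top {K T : ℝ} {f : Space N → ℝ} (hf : AEStronglyMeasurable f)
    (hfin : wnorm K T f < ⊤) : Integrable f :=
  ⟨hf, (lintegral_le_wnorm K T f).trans_lt hfin⟩

/-- The growth `√(t+1) ^ |α|` of the moments is exactly what the decay of the norm of `g_α`
compensates, so `P_K(t)` will be bounded uniformly in `t`. -/
theorem exists_enorm_moment_le {K : ℝ} (α : MultiIndex N)
    (hα : (order α : ℝ) ≤ K) :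
    ∃ C : ℝ, 0 < C ∧ ∀ t : ℝ, 0 < t + 1 → ∀ f : Space N → ℝ,
      ‖moment α f t‖ₑ ≤ ENNReal.ofReal (C * √(t + 1) ^ order α) * wnorm K (t + 1) f := by
  induction α using WellFoundedLT.induction with
  | ind α ih =>
    -- The dummy value `0` outside `β < α` lets `choose` produce one function of constants on all
    -- multi-indices.
    have ih' : ∀ β : MultiIndex N, ∃ C : ℝ, β < α → 0 < C ∧ ∀ t : ℝ, 0 < t + 1 →
        ∀ f : Space N → ℝ,
        ‖moment β f t‖ₑ ≤ ENNReal.ofReal (C * √(t + 1) ^ order β) * wnorm K (t + 1) f := by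
      intro β
      by_cases h : β < α
      · obtain ⟨C, hC⟩ := ih β h (le_trans (by exact_mod_cast order_le_of_le h.le) hα)
        exact ⟨C, fun _ => hC⟩
      · exact ⟨0, fun h' => absurd h' h⟩
    choose C hC using ih'
    have hpos : ∀ β ∈ Finset.Iio α, 0 ≤ C β * |∏ i, kernMoment (α i) (β i)| := fun β hβ =>
      mul_nonneg (hC β (Finset.mem_Iio.1 hβ)).1.le (abs_nonneg _)
    refine ⟨1 + ∑ β ∈ Finset.Iio α, C β * |∏ i, kernMoment (α i) (β i)|, ?_, fun t ht f => ?_⟩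
    · linarith [Finset.sum_nonneg hpos]
    have hs : 0 < √(t + 1) := Real.sqrt_pos.2 ht
    rw [moment_eq]
    refine (enorm_sub_le).trans ?_
    rw [add_mul, one_mul, ENNReal.ofReal_add (by positivity)
      (mul_nonneg (Finset.sum_nonneg hpos) (by positivity)), add_mul]
    gcongr
    · exact (enorm_integral_le_lintegral_enorm _).trans (lintegral_monomial_mul_le ht hα f)
    · refine (enorm_sum_le _ _).trans ?_
      rw [Finset.sum_mul, ENNReal.ofReal_sum_of_nonneg
        fun β hβ => mul_nonneg (hpos β hβ) (by positivity), Finset.sum_mul]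
      refine Finset.sum_le_sum fun β hβ => ?_
      obtain ⟨hCβ, h⟩ := hC β (Finset.mem_Iio.1 hβ)
      rw [enorm_mul, integral_monomial_mul_gDeriv α β ht]
      refine (mul_le_mul_left (h t ht f) _).trans_eq ?_
      rw [Real.enorm_eq_ofReal_abs, mul_right_comm, ← ENNReal.ofReal_mul (by positivity), abs_mul,
        abs_of_nonneg (by positivity), inv_pow]
      congr 2
      field_simp

theorem exists_xnorm_sum_moment_le {K : ℝ} (hK : 0 ≤ K) :
    ∃ C : ℝ, 0 < C ∧ ∀ t : ℝ, 0 < t + 1 → ∀ f : Space N → ℝ,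
      xnorm K (t + 1) (fun x => ∑ α ∈ indicesUpTo N K, moment α f t * gDeriv α t x) ≤
        ENNReal.ofReal C * wnorm K (t + 1) f := by
  choose C hC h using fun α : MultiIndex N => exists_xnorm_gDeriv_le hK α
  have h0 : ∀ α : MultiIndex N, ∃ D : ℝ, 0 < D ∧ ((order α : ℝ) ≤ K → ∀ t : ℝ, 0 < t + 1 →
      ∀ f : Space N → ℝ,
      ‖moment α f t‖ₑ ≤ ENNReal.ofReal (D * √(t + 1) ^ order α) * wnorm K (t + 1) f) := by
    intro α
    by_cases hα : (order α : ℝ) ≤ K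
    · obtain ⟨D, hD, h⟩ := exists_enorm_moment_le α hα
      exact ⟨D, hD, fun _ => h⟩
    · exact ⟨1, one_pos, fun h => absurd h hα⟩
  choose D hD h' using h0
  refine ⟨1 + ∑ α ∈ indicesUpTo N K, D α * C α, ?_, fun t ht f => ?_⟩
  · have := Finset.sum_nonneg fun (α : MultiIndex N) (_ : α ∈ indicesUpTo N K) =>
      (mul_pos (hD α) (hC α)).le
    linarith
  have hs : 0 < √(t + 1) := Real.sqrt_pos.2 ht
  refine (xnorm_sum_le _ fun α _ =>
    ((continuous_gDeriv α ht).const_mul _).aestronglyMeasurable).trans ?_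
  rw [ENNReal.ofReal_add zero_le_one (Finset.sum_nonneg fun α _ => (mul_pos (hD α) (hC α)).le),
    add_mul, ENNReal.ofReal_sum_of_nonneg fun α _ => (mul_pos (hD α) (hC α)).le, Finset.sum_mul]
  refine le_trans ?_ le_add_self
  refine Finset.sum_le_sum fun α hα => ?_
  refine (xnorm_const_mul_le _ (continuous_gDeriv α ht).aestronglyMeasurable).trans ?_
  refine (mul_le_mul' (h' α ((mem_indicesUpTo hK α).1 hα) t ht f) (h α t ht)).trans_eq ?_
  have := hD α
  rw [mul_right_comm, ← ENNReal.ofReal_mul (by positivity), inv_pow]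
  congr 2
  field_simp

theorem aestronglyMeasurable_momentProj {K t : ℝ} (ht : 0 < t + 1) {f : Space N → ℝ}
    (hf : AEStronglyMeasurable f) : AEStronglyMeasurable (momentProj K t f) :=
  hf.sub (Finset.aestronglyMeasurable_fun_sum _ fun α _ =>
    ((continuous_gDeriv α ht).const_mul _).aestronglyMeasurable)

theorem exists_xnorm_momentProj_le (N : ℕ) {K : ℝ} (hK : 0 ≤ K) :
    ∃ C : ℝ, 0 < C ∧ ∀ t : ℝ, 0 < t + 1 → ∀ f : Space N → ℝ, AEStronglyMeasurable f →
      xnorm K (t + 1) (momentProj K t f) ≤ ENNReal.ofReal C * xnorm K (t + 1) f := by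
  obtain ⟨C, hC, h⟩ := exists_xnorm_sum_moment_le (N := N) hK
  refine ⟨1 + C, by positivity, fun t ht f hf => ?_⟩
  refine (xnorm_sub_le hf (Finset.aestronglyMeasurable_fun_sum _ fun α _ =>
    ((continuous_gDeriv α ht).const_mul _).aestronglyMeasurable)).trans ?_
  rw [ENNReal.ofReal_add zero_le_one hC.le, ENNReal.ofReal_one, add_mul, one_mul]
  gcongr
  exact (h t ht f).trans (by gcongr; exact wnorm_le_xnorm _ _ _)

/-! ### Comparison with the norms of the statement -/

theorem wnorm_one (K : ℝ) (f : Space N → ℝ) : wnorm K 1 f = weightedNorm K f := by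
  simp [wnorm, weightedNorm, weight]

theorem weightedNorm_le_wnorm {K T l : ℝ} (hT : 1 ≤ T) (hl : 0 ≤ l) (hlK : l ≤ K)
    (f : Space N → ℝ) :
    weightedNorm l f ≤ ENNReal.ofReal (2 * T ^ (l / 2)) * wnorm K T f := by
  have hs : 0 < √T := Real.sqrt_pos.2 (by linarith)
  unfold wnorm weightedNorm
  rw [← lintegral_const_mul' _ _ ENNReal.ofReal_ne_top]
  refine lintegral_mono fun x => ?_
  rw [mul_left_comm]
  gcongr
  rw [← ENNReal.ofReal_mul (by positivity)]
  refine ENNReal.ofReal_le_ofReal ?_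
  have h1 : (1 : ℝ) ≤ T ^ (l / 2) := Real.one_le_rpow hT (by positivity)
  have h2 := pow_le_one_add_rpow hl hlK (show 0 ≤ ‖x‖ / √T by positivity)
  rw [Real.div_rpow (norm_nonneg _) hs.le, Real.sqrt_eq_rpow, ← Real.rpow_mul (by linarith),
    div_le_iff₀ (by positivity), ← Real.sqrt_eq_rpow, one_div_mul_eq_div] at h2
  have h3 := one_le_weight K T x
  unfold weight at h3 ⊢
  nlinarith

theorem rpow_mul_weightedNorm_le {K t l : ℝ} (ht : 1 ≤ t) (hl : 0 ≤ l) (hlK : l ≤ K)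
    (f : Space N → ℝ) :
    ENNReal.ofReal (t ^ (-l / 2)) * weightedNorm l f ≤
      ENNReal.ofReal (2 * 2 ^ (l / 2)) * wnorm K (t + 1) f := by
  refine (mul_le_mul_right (weightedNorm_le_wnorm (T := t + 1) (by linarith) hl hlK f) _).trans ?_
  rw [← mul_assoc, ← ENNReal.ofReal_mul (by positivity)]
  refine mul_le_mul_left (ENNReal.ofReal_le_ofReal ?_) _
  have : (t + 1) ^ (l / 2) ≤ (2 * t) ^ (l / 2) := by gcongr; linarith
  rw [Real.mul_rpow (by norm_num) (by linarith)] at this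
  calc t ^ (-l / 2) * (2 * (t + 1) ^ (l / 2))
      ≤ t ^ (-l / 2) * (2 * (2 ^ (l / 2) * t ^ (l / 2))) := by gcongr
    _ = 2 * 2 ^ (l / 2) * (t ^ (-l / 2) * t ^ (l / 2)) := by ring
    _ = _ := by
      rw [← Real.rpow_add (by linarith), neg_div, neg_add_cancel, Real.rpow_zero, mul_one]

theorem one_add_rpow_mul_weightedNorm_le {K t l : ℝ} (ht : 0 < t) (hl : 0 ≤ l) (hlK : l ≤ K)
    (f : Space N → ℝ) :
    ENNReal.ofReal ((1 + t) ^ (-l / 2)) * weightedNorm l f ≤ 2 * wnorm K (t + 1) f := by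
  refine (mul_le_mul_right (weightedNorm_le_wnorm (T := t + 1) (by linarith) hl hlK f) _).trans ?_
  rw [← mul_assoc, ← ENNReal.ofReal_mul (by positivity), add_comm 1 t, mul_left_comm,
    ← Real.rpow_add (by linarith), neg_div, neg_add_cancel, Real.rpow_zero, mul_one]
  simp

theorem ENNReal.rpow_mul_rpow_le_add (a b : ℝ≥0∞) {θ : ℝ} (h0 : 0 ≤ θ) (h1 : θ ≤ 1) :
    a ^ (1 - θ) * b ^ θ ≤ a + b := by
  have ha : a ≤ max a b := le_max_left _ _
  have hb : b ≤ max a b := le_max_right _ _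
  calc a ^ (1 - θ) * b ^ θ ≤ (max a b) ^ (1 - θ) * (max a b) ^ θ := by
        gcongr
    _ = max a b := by
      rw [← ENNReal.rpow_add_of_nonneg _ _ (by linarith) h0, sub_add_cancel, ENNReal.rpow_one]
    _ ≤ a + b := max_le le_self_add le_add_self

/-- Interpolation `‖f‖_q ≤ ‖f‖_∞^(1-θ) ‖f‖_1^θ` with `θ = 1/q`: the power of `t` supplies exactly
the factor `√T ^ N` that accompanies the sup norm, to the power `1 - θ`. -/
theorem rpow_mul_eLpNorm_le_xnorm {K t T : ℝ} (ht : 0 < t) (htT : t ≤ T) {q : ℝ≥0∞}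
    (hq : 1 ≤ q) (f : Space N → ℝ) :
    ENNReal.ofReal (t ^ ((N : ℝ) / 2 * (1 - (q⁻¹).toReal))) * eLpNorm f q volume ≤
      xnorm K T f := by
  have hT : 0 < T := ht.trans_le htT
  have hpow : ∀ θ : ℝ, 0 ≤ θ → θ ≤ 1 → t ^ ((N : ℝ) / 2 * (1 - θ)) ≤ (√T ^ N) ^ (1 - θ) := by
    intro θ h0 h1
    rw [Real.rpow_mul ht.le]
    refine Real.rpow_le_rpow (by positivity) ?_ (by linarith)
    rw [Real.sqrt_eq_rpow, ← Real.rpow_natCast, ← Real.rpow_mul hT.le, one_div_mul_eq_div]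
    gcongr
  by_cases hq' : q = ⊤
  · subst hq'
    refine le_trans ?_ le_add_self
    gcongr
    simpa using hpow 0 le_rfl zero_le_one
  have hq0 : q ≠ 0 := (zero_lt_one.trans_le hq).ne'
  set r := q.toReal with hr
  have hr1 : 1 ≤ r := by
    rw [hr, ← ENNReal.toReal_one]
    exact ENNReal.toReal_mono hq' hq
  have hr0 : 0 < r := by linarith
  set θ := (q⁻¹).toReal with hθ
  have hθr : θ = r⁻¹ := by rw [hθ, ENNReal.toReal_inv]
  have hθ0 : 0 ≤ θ := by rw [hθr]; positivity
  have hθ1 : θ ≤ 1 := by rw [hθr]; exact inv_le_one_of_one_le₀ hr1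
  set A := eLpNorm f ⊤ volume with hA
  have h1 : eLpNorm f q volume ≤ A ^ (1 - θ) * (∫⁻ x, ‖f x‖ₑ) ^ θ := by
    rw [eLpNorm_eq_lintegral_rpow_enorm_toReal hq0 hq', one_div, ← hr, ← hθr]
    have h2 : ∫⁻ x, ‖f x‖ₑ ^ r ≤ A ^ (r - 1) * ∫⁻ x, ‖f x‖ₑ := by
      by_cases hAt : A ^ (r - 1) = ⊤
      · by_cases hz : ∫⁻ x, ‖f x‖ₑ = 0
        · have hAtop : A = ⊤ := by
            rw [ENNReal.rpow_eq_top_iff] at hAt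
            rcases hAt with h | h
            · exact absurd h.2 (by linarith)
            · exact h.1
          by_cases hall : ∫⁻ x, ‖f x‖ₑ ^ r = 0
          · rw [hall]; exact zero_le
          · exfalso
            have hle : ∀ᵐ x, ‖f x‖ₑ = 0 := by
              -- As `f` is not assumed measurable, `∫⁻ ‖f‖ₑ = 0` does not give `f = 0` a.e. A
              -- measurable minorant `g` of `‖f‖ₑ ^ r` with the same integral does the job: `g ^ r⁻¹
              -- ≤ ‖f‖ₑ` forces `g = 0` a.e.
              obtain ⟨g, hgm, hge, hgi⟩ := exists_measurable_le_lintegral_eq volume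
                (fun x => ‖f x‖ₑ ^ r)
              have h3 : ∫⁻ x, (g x) ^ r⁻¹ = 0 := by
                refine le_antisymm (le_trans (lintegral_mono fun x => ?_) hz.le) zero_le
                calc g x ^ r⁻¹ ≤ (‖f x‖ₑ ^ r) ^ r⁻¹ := by gcongr; exact hge x
                  _ = ‖f x‖ₑ := ENNReal.rpow_rpow_inv hr0.ne' _
              rw [lintegral_eq_zero_iff (hgm.pow_const _)] at h3
              exfalso
              apply hall
              rw [hgi]
              refine (lintegral_congr_ae (h3.mono fun x hx => ?_)).trans lintegral_zero
              simpa [ENNReal.rpow_eq_zero_iff, hr0, hr0.le, not_lt.2 hr0.le] using hx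
            apply hall
            refine (lintegral_congr_ae (hle.mono fun x hx => ?_)).trans lintegral_zero
            simp [hx, hr0]
        · rw [hAt, ENNReal.top_mul hz]
          exact le_top
      · rw [← lintegral_const_mul' _ _ hAt]
        refine lintegral_mono_ae ?_
        filter_upwards [enorm_ae_le_eLpNormEssSup f volume] with x hx
        rw [← eLpNorm_exponent_top] at hx
        calc ‖f x‖ₑ ^ r = ‖f x‖ₑ ^ (r - 1) * ‖f x‖ₑ ^ (1 : ℝ) := by
              rw [← ENNReal.rpow_add_of_nonneg _ _ (by linarith) zero_le_one, sub_add_cancel]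
          _ ≤ A ^ (r - 1) * ‖f x‖ₑ := by
              rw [ENNReal.rpow_one]
              gcongr
    calc (∫⁻ x, ‖f x‖ₑ ^ r) ^ θ ≤ (A ^ (r - 1) * ∫⁻ x, ‖f x‖ₑ) ^ θ := by gcongr
      _ = _ := by
        rw [ENNReal.mul_rpow_of_nonneg _ _ hθ0, ← ENNReal.rpow_mul]
        congr 2
        rw [hθr, sub_mul, mul_inv_cancel₀ hr0.ne', one_mul]
  calc ENNReal.ofReal (t ^ ((N : ℝ) / 2 * (1 - θ))) * eLpNorm f q volume
      ≤ ENNReal.ofReal (√T ^ N) ^ (1 - θ) * (A ^ (1 - θ) * (∫⁻ x, ‖f x‖ₑ) ^ θ) := by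
        gcongr
        rw [ENNReal.ofReal_rpow_of_nonneg (by positivity) (by linarith)]
        exact ENNReal.ofReal_le_ofReal (hpow θ hθ0 hθ1)
    _ = (ENNReal.ofReal (√T ^ N) * A) ^ (1 - θ) * (∫⁻ x, ‖f x‖ₑ) ^ θ := by
        rw [ENNReal.mul_rpow_of_nonneg _ _ (by linarith), mul_assoc]
    _ ≤ ENNReal.ofReal (√T ^ N) * A + ∫⁻ x, ‖f x‖ₑ := ENNReal.rpow_mul_rpow_le_add _ _ hθ0 hθ1
    _ ≤ xnorm K T f := by
        rw [add_comm]
        unfold xnorm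
        gcongr
        exact lintegral_le_wnorm K T f

theorem exists_scaledNorm_le {K l : ℝ} (hl : 0 ≤ l) (hlK : l ≤ K) {q : ℝ≥0∞} (hq : 1 ≤ q) :
    ∃ C : ℝ, 0 < C ∧ ∀ (w : ℝ → Space N → ℝ) (t : ℝ), 1 ≤ t →
      scaledNorm q l w t ≤ ENNReal.ofReal C * xnorm K (t + 1) (w t) := by
  refine ⟨1 + 2 * 2 ^ (l / 2), by positivity, fun w t ht => ?_⟩
  unfold scaledNorm
  rw [ENNReal.ofReal_add zero_le_one (by positivity), add_mul, ENNReal.ofReal_one, one_mul]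
  refine add_le_add ?_ ?_
  · exact rpow_mul_eLpNorm_le_xnorm (by linarith) (by linarith) hq _
  · exact (rpow_mul_weightedNorm_le ht hl hlK _).trans (by gcongr; exact wnorm_le_xnorm _ _ _)


/-! ### Estimates for the heat semigroup -/

/-- The function `Φ` is bounded by `B` in the weighted `L¹` norm and, after normalization,
everywhere. -/
def BoundedBy (K T : ℝ) (Φ : Space N → ℝ) (B : ℝ≥0∞) : Prop :=
  wnorm K T Φ ≤ B ∧ ∀ x, ENNReal.ofReal (√T ^ N) * ‖Φ x‖ₑ ≤ B

theorem BoundedBy.mono {K T : ℝ} {Φ : Space N → ℝ} {B B' : ℝ≥0∞} (h : BoundedBy K T Φ B)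
    (hB : B ≤ B') : BoundedBy K T Φ B' :=
  ⟨h.1.trans hB, fun x => (h.2 x).trans hB⟩

theorem BoundedBy.xnorm_le {K T : ℝ} {Φ : Space N → ℝ} {B : ℝ≥0∞} (h : BoundedBy K T Φ B) :
    xnorm K T Φ ≤ 2 * B := by
  unfold xnorm
  rw [two_mul]
  refine add_le_add h.1 ?_
  rcases eq_or_ne (ENNReal.ofReal (√T ^ N)) 0 with h0 | h0
  · rw [h0, zero_mul]
    exact zero_le
  · rw [mul_comm, ← ENNReal.le_div_iff_mul_le (Or.inl h0) (Or.inl ENNReal.ofReal_ne_top)]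
    refine eLpNorm_top_le_of_forall fun x => ?_
    rw [ENNReal.le_div_iff_mul_le (Or.inl h0) (Or.inl ENNReal.ofReal_ne_top), mul_comm]
    exact h.2 x

/-- Tonelli's theorem in the form of a weighted Schur test: `A` is the weight on the source variable
that the kernel induces from `w`. It is stated for a majorant kernel because the Taylor remainder is
only estimated. -/
theorem lintegral_mul_le_of_kernel {k : Space N → Space N → ℝ≥0∞}
    (hk : Measurable (Function.uncurry k)) {w A : Space N → ℝ≥0∞} (hw : Measurable w)
    {Φ h : Space N → ℝ} (hh : AEStronglyMeasurable h)
    (hΦ : ∀ x, ‖Φ x‖ₑ ≤ ∫⁻ y, k x y * ‖h y‖ₑ) (hA : ∀ y, ∫⁻ x, k x y * w x ≤ A y) :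
    ∫⁻ x, ‖Φ x‖ₑ * w x ≤ ∫⁻ y, A y * ‖h y‖ₑ := by
  have hky : ∀ x, Measurable (k x) := fun x => hk.of_uncurry_left
  have hkx : ∀ y, Measurable (fun x => k x y) := fun y => hk.of_uncurry_right
  calc ∫⁻ x, ‖Φ x‖ₑ * w x ≤ ∫⁻ x, ∫⁻ y, k x y * ‖h y‖ₑ * w x := by
        refine lintegral_mono fun x => ?_
        have hm : AEMeasurable (fun y => k x y * ‖h y‖ₑ) := (hky x).aemeasurable.mul hh.enorm
        rw [lintegral_mul_const'' _ hm]
        gcongr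
        exact hΦ x
    _ = ∫⁻ y, ∫⁻ x, k x y * ‖h y‖ₑ * w x := by
        refine lintegral_lintegral_swap ?_
        exact (hk.aemeasurable.mul (hh.enorm.comp_snd)).mul (hw.comp measurable_fst).aemeasurable
    _ ≤ ∫⁻ y, A y * ‖h y‖ₑ := by
        refine lintegral_mono fun y => ?_
        simp_rw [mul_right_comm _ ‖h y‖ₑ _]
        have hm : Measurable fun x => k x y * w x := (hkx y).mul hw
        rw [lintegral_mul_const _ hm]
        gcongr
        exact hA y

theorem heatKernel_eq {τ : ℝ} (hτ : 0 < τ) (x : Space N) :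
    heatKernel τ x = (√(4 * Real.pi))⁻¹ ^ N * (√τ)⁻¹ ^ N * Real.exp (-(1 / 4 * ‖x‖ ^ 2 / τ)) := by
  unfold heatKernel
  rw [← mul_pow, ← mul_inv, ← Real.sqrt_mul (by positivity), Real.sqrt_eq_rpow,
    ← Real.rpow_neg (by positivity), ← Real.rpow_mul_natCast (by positivity)]
  congr 2
  · ring
  · field_simp

theorem measurable_uncurry_heatKernel :
    Measurable (fun z : ℝ × Space N => heatKernel z.1 z.2) := by
  unfold heatKernel
  fun_prop

theorem heatKernel_le_inv_sqrt {τ : ℝ} (hτ : 0 < τ) (x : Space N) :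
    heatKernel τ x ≤ (√τ)⁻¹ ^ N := by
  rw [heatKernel_eq hτ]
  have h1 : (√(4 * Real.pi))⁻¹ ^ N ≤ 1 := by
    refine pow_le_one₀ (by positivity) (inv_le_one_of_one_le₀ ?_)
    rw [Real.one_le_sqrt]
    linarith [Real.pi_gt_three]
  have h2 : Real.exp (-(1 / 4 * ‖x‖ ^ 2 / τ)) ≤ 1 := by
    rw [Real.exp_le_one_iff]
    exact neg_nonpos.2 (by positivity)
  calc _ ≤ 1 * (√τ)⁻¹ ^ N * 1 := by gcongr
    _ = _ := by ring

/-- Submultiplicativity up to `2 ^ K`, from `(a + b)^K ≤ (2 max(a, b))^K`: the weight at `x` is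
split between the kernel variable `x - y` and the source point `y`. -/
theorem weight_add_le {K T : ℝ} (hK : 0 ≤ K) (x y : Space N) :
    weight K T x ≤ 2 ^ K * (weight K T (x - y) * weight K T y) := by
  unfold weight
  set a := ‖x - y‖ / √T
  set b := ‖y‖ / √T
  have ha : 0 ≤ a := by positivity
  have hb : 0 ≤ b := by positivity
  have hx : ‖x‖ / √T ≤ a + b := by
    rw [← add_div]
    gcongr
    simpa using norm_add_le (x - y) y
  have h1 : (‖x‖ / √T) ^ K ≤ 2 ^ K * (a ^ K + b ^ K) := by
    calc (‖x‖ / √T) ^ K ≤ (2 * max a b) ^ K := by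
          refine Real.rpow_le_rpow (by positivity) (hx.trans ?_) hK
          linarith [le_max_left a b, le_max_right a b]
      _ = 2 ^ K * (max a b) ^ K := Real.mul_rpow (by norm_num) (le_max_of_le_left ha)
      _ ≤ _ := by
        gcongr
        rcases max_cases a b with h | h <;> rw [h.1]
        · linarith [show 0 ≤ b ^ K by positivity]
        · linarith [show 0 ≤ a ^ K by positivity]
  have h2 : (1 : ℝ) ≤ 2 ^ K := Real.one_le_rpow (by norm_num) hK
  have h3 : 0 ≤ a ^ K * b ^ K := by positivity
  nlinarith

theorem exists_lintegral_heatKernel_mul_weight_le (N : ℕ) {K : ℝ} (hK : 0 ≤ K) :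
    ∃ C : ℝ, 0 < C ∧ ∀ τ T : ℝ, 0 < τ → τ ≤ T → ∀ y : Space N,
      ∫⁻ x, ENNReal.ofReal (heatKernel τ (x - y)) * ENNReal.ofReal (weight K T x) ≤
        ENNReal.ofReal (C * weight K T y) := by
  obtain ⟨C, hC, h⟩ := exists_lintegral_exp_mul_weight_le N hK (c := 1 / 4) (by norm_num)
  refine ⟨2 ^ K * C, by positivity, fun τ T hτ hT y => ?_⟩
  have hs : 0 < √τ := Real.sqrt_pos.2 hτ
  have hw := weight_nonneg K T y
  calc ∫⁻ x, ENNReal.ofReal (heatKernel τ (x - y)) * ENNReal.ofReal (weight K T x)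
      ≤ ∫⁻ x, ENNReal.ofReal (2 ^ K * weight K T y * (√τ)⁻¹ ^ N) *
          (ENNReal.ofReal (Real.exp (-(1 / 4 * ‖x - y‖ ^ 2 / τ))) *
            ENNReal.ofReal (weight K τ (x - y))) := by
        refine lintegral_mono fun x => ?_
        rw [← ENNReal.ofReal_mul (heatKernel_nonneg hτ.le _), ← ENNReal.ofReal_mul (by positivity),
          ← ENNReal.ofReal_mul (by positivity)]
        refine ENNReal.ofReal_le_ofReal ?_
        have h1 : heatKernel τ (x - y) ≤
            (√τ)⁻¹ ^ N * Real.exp (-(1 / 4 * ‖x - y‖ ^ 2 / τ)) := by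
          rw [heatKernel_eq hτ, mul_assoc]
          refine mul_le_of_le_one_left (by positivity)
            (pow_le_one₀ (by positivity) (inv_le_one_of_one_le₀ ?_))
          rw [Real.one_le_sqrt]
          linarith [Real.pi_gt_three]
        -- The kernel lives on the scale `√τ ≤ √T`. Passing to the larger weight at scale `τ` costs
        -- nothing and makes the bound on the Gaussian integral uniform.
        have h2 : weight K T x ≤ 2 ^ K * (weight K τ (x - y) * weight K T y) := by
          refine (weight_add_le hK x y).trans ?_
          gcongr
          exact weight_anti hK hτ hT _
        calc heatKernel τ (x - y) * weight K T x
            ≤ ((√τ)⁻¹ ^ N * Real.exp (-(1 / 4 * ‖x - y‖ ^ 2 / τ))) *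
              (2 ^ K * (weight K τ (x - y) * weight K T y)) :=
              mul_le_mul h1 h2 (weight_nonneg _ _ _) (by positivity)
          _ = _ := by ring
    _ ≤ ENNReal.ofReal (2 ^ K * weight K T y * (√τ)⁻¹ ^ N) * ENNReal.ofReal (C * √τ ^ N) := by
        rw [lintegral_const_mul' _ _ ENNReal.ofReal_ne_top,
          lintegral_sub_right_eq_self (fun x : Space N =>
            ENNReal.ofReal (Real.exp (-(1 / 4 * ‖x‖ ^ 2 / τ))) * ENNReal.ofReal (weight K τ x)) y]
        gcongr
        exact h τ hτ
    _ = _ := by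
        rw [← ENNReal.ofReal_mul (by positivity), inv_pow]
        congr 1
        field_simp

theorem enorm_heatFlow_le {τ : ℝ} (hτ : 0 ≤ τ) (h : Space N → ℝ) (x : Space N) :
    ‖heatFlow τ h x‖ₑ ≤ ∫⁻ y, ENNReal.ofReal (heatKernel τ (x - y)) * ‖h y‖ₑ := by
  refine (enorm_integral_le_lintegral_enorm _).trans_eq (lintegral_congr fun y => ?_)
  rw [enorm_mul, Real.enorm_eq_ofReal (heatKernel_nonneg hτ _)]

theorem lintegral_heatKernel {τ : ℝ} (hτ : 0 < τ) (x : Space N) :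
    ∫⁻ y, ENNReal.ofReal (heatKernel τ (x - y)) = 1 := by
  rw [lintegral_sub_left_eq_self (fun y : Space N => ENNReal.ofReal (heatKernel τ y)) x,
    ← ofReal_integral_eq_lintegral_ofReal (integrable_heatKernel hτ)
      (Eventually.of_forall fun y => heatKernel_nonneg hτ.le y), integral_heatKernel hτ,
    ENNReal.ofReal_one]

theorem enorm_heatFlow_le_eLpNorm_top {τ : ℝ} (hτ : 0 < τ) (h : Space N → ℝ) (x : Space N) :
    ‖heatFlow τ h x‖ₑ ≤ eLpNorm h ⊤ volume := by
  refine (enorm_heatFlow_le hτ.le h x).trans ?_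
  have hm : Measurable fun y => ENNReal.ofReal (heatKernel τ (x - y)) :=
    ENNReal.measurable_ofReal.comp ((continuous_heatKernel τ).measurable.comp (by fun_prop))
  calc ∫⁻ y, ENNReal.ofReal (heatKernel τ (x - y)) * ‖h y‖ₑ
      ≤ ∫⁻ y, ENNReal.ofReal (heatKernel τ (x - y)) * eLpNorm h ⊤ volume := by
        refine lintegral_mono_ae ?_
        rw [eLpNorm_exponent_top]
        filter_upwards [enorm_ae_le_eLpNormEssSup h volume] with y hy
        gcongr
    _ = _ := by rw [lintegral_mul_const _ hm, lintegral_heatKernel hτ, one_mul]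

theorem enorm_heatFlow_le_lintegral {τ : ℝ} (hτ : 0 < τ) (h : Space N → ℝ) (x : Space N) :
    ‖heatFlow τ h x‖ₑ ≤ ENNReal.ofReal ((√τ)⁻¹ ^ N) * ∫⁻ y, ‖h y‖ₑ := by
  refine (enorm_heatFlow_le hτ.le h x).trans ?_
  rw [← lintegral_const_mul' _ _ ENNReal.ofReal_ne_top]
  refine lintegral_mono fun y => ?_
  gcongr
  exact heatKernel_le_inv_sqrt hτ _

theorem measurable_heatKernel_sub (τ : ℝ) :
    Measurable (Function.uncurry fun x y : Space N => ENNReal.ofReal (heatKernel τ (x - y))) :=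
  ENNReal.measurable_ofReal.comp
    ((continuous_heatKernel τ).measurable.comp (measurable_fst.sub measurable_snd))

/-- For the sup part there are two regimes. If `T - S ≥ T/4`, the `L¹`–`L^∞` smoothing costs at most
`(√T/√(T-S))^N ≤ 2^N`. Otherwise `S` and `T` are comparable and the contraction in `L^∞` suffices.
-/
theorem exists_boundedBy_heatFlow (N : ℕ) {K : ℝ} (hK : 0 ≤ K) :
    ∃ C : ℝ, 0 < C ∧ ∀ S T : ℝ, 0 < S → S < T → ∀ h : Space N → ℝ, AEStronglyMeasurable h →
      BoundedBy K T (heatFlow (T - S) h) (ENNReal.ofReal C * xnorm K S h) := by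
  obtain ⟨C, hC, hCw⟩ := exists_lintegral_heatKernel_mul_weight_le N hK
  refine ⟨C + 2 ^ N, by positivity, fun S T hS hST h hh => ⟨?_, fun x => ?_⟩⟩
  · have h1 := lintegral_mul_le_of_kernel (measurable_heatKernel_sub (T - S))
      (measurable_ofReal_weight K T) hh (enorm_heatFlow_le (τ := T - S) (by linarith) h)
      (hCw (T - S) T (by linarith) (by linarith))
    refine h1.trans ?_
    calc ∫⁻ y, ENNReal.ofReal (C * weight K T y) * ‖h y‖ₑ
        ≤ ∫⁻ y, ENNReal.ofReal C * (‖h y‖ₑ * ENNReal.ofReal (weight K S y)) := by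
          refine lintegral_mono fun y => ?_
          rw [ENNReal.ofReal_mul hC.le, mul_assoc, mul_comm (ENNReal.ofReal (weight K T y))]
          gcongr
          exact weight_anti hK hS hST.le y
      _ = ENNReal.ofReal C * wnorm K S h := by
          rw [lintegral_const_mul' _ _ ENNReal.ofReal_ne_top]
          rfl
      _ ≤ _ := by
          gcongr
          · linarith [show (0 : ℝ) ≤ 2 ^ N by positivity]
          · exact wnorm_le_xnorm K S h
  · have hT : 0 < T := hS.trans hST
    have key : ENNReal.ofReal (√T ^ N) * ‖heatFlow (T - S) h x‖ₑ ≤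
        ENNReal.ofReal (2 ^ N) * xnorm K S h := by
      rcases le_total (T / 4) (T - S) with hcase | hcase
      · have hτ : 0 < T - S := by linarith
        have hs : 0 < √(T - S) := Real.sqrt_pos.2 hτ
        refine (mul_le_mul_right (enorm_heatFlow_le_lintegral hτ h x) _).trans ?_
        rw [← mul_assoc, ← ENNReal.ofReal_mul (by positivity)]
        gcongr
        · rw [← mul_pow]
          refine pow_le_pow_left₀ (by positivity) ?_ N
          rw [← div_eq_mul_inv, div_le_iff₀ hs]
          refine Real.sqrt_le_iff.2 ⟨by positivity, ?_⟩
          rw [mul_pow, Real.sq_sqrt hτ.le]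
          linarith
        · exact (lintegral_le_wnorm K S h).trans (wnorm_le_xnorm K S h)
      · have hτ : 0 < T - S := by linarith
        refine (mul_le_mul_right (enorm_heatFlow_le_eLpNorm_top hτ h x) _).trans ?_
        refine le_trans ?_ (mul_le_mul_right (le_add_self (a := ENNReal.ofReal (√S ^ N) *
          eLpNorm h ⊤ volume)) _)
        rw [← mul_assoc, ← ENNReal.ofReal_mul (by positivity), ← mul_pow]
        gcongr
        refine Real.sqrt_le_iff.2 ⟨by positivity, ?_⟩
        rw [mul_pow, Real.sq_sqrt hS.le]
        linarith
    refine key.trans ?_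
    gcongr
    linarith


/-! ### Decay of the heat flow of functions with vanishing moments -/

/-- The terms `b ^ i d ^ j / (i! j!)` with `i + 2 j ≤ k` of the expansion of `exp (b + d)`. -/
noncomputable def truncExp (k : ℕ) (b d : ℝ) : ℝ :=
  ∑ m ∈ Finset.range (k + 1), ∑ i ∈ Finset.range (m + 1),
    if i + 2 * (m - i) ≤ k then b ^ i * d ^ (m - i) * (m.choose i / m.factorial : ℝ) else 0

theorem choose_div_factorial_le_one {m i : ℕ} (h : i ≤ m) :
    (m.choose i / m.factorial : ℝ) ≤ 1 := by
  rw [div_le_one (by positivity)]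
  have := Nat.choose_mul_factorial_mul_factorial h
  rw [mul_assoc] at this
  exact_mod_cast Nat.le_of_dvd (Nat.factorial_pos m) ⟨_, this.symm⟩

theorem abs_expTerm_le {m i : ℕ} (hi : i ≤ m) {b d r e : ℝ} (hr : 0 ≤ r) (he : 0 ≤ e)
    (hb : |b| ≤ r * e) (hd : |d| ≤ e ^ 2) :
    |b ^ i * d ^ (m - i) * (m.choose i / m.factorial : ℝ)| ≤
      (1 + r) ^ m * e ^ (i + 2 * (m - i)) := by
  have h0 : (0 : ℝ) ≤ m.choose i / m.factorial := by positivity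
  rw [abs_mul, abs_mul, abs_pow, abs_pow, abs_of_nonneg h0]
  calc |b| ^ i * |d| ^ (m - i) * (m.choose i / m.factorial : ℝ)
      ≤ (r * e) ^ i * (e ^ 2) ^ (m - i) * 1 := by
        gcongr
        exact choose_div_factorial_le_one hi
    _ = r ^ i * e ^ (i + 2 * (m - i)) := by rw [mul_pow, pow_add, pow_mul]; ring
    _ ≤ (1 + r) ^ i * e ^ (i + 2 * (m - i)) := by gcongr; linarith
    _ ≤ (1 + r) ^ m * e ^ (i + 2 * (m - i)) := by
        gcongr
        linarith

theorem sum_range_range_le {k : ℕ} {f : ℕ → ℕ → ℝ} {c : ℝ}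
    (h : ∀ m ≤ k, ∀ i ≤ m, f m i ≤ c) (hc : 0 ≤ c) :
    ∑ m ∈ Finset.range (k + 1), ∑ i ∈ Finset.range (m + 1), f m i ≤ ((k : ℝ) + 1) ^ 2 * c := by
  calc _ ≤ ∑ m ∈ Finset.range (k + 1), ((k : ℝ) + 1) * c := by
        refine Finset.sum_le_sum fun m hm => ?_
        have hmk : m ≤ k := Nat.lt_succ_iff.1 (Finset.mem_range.1 hm)
        refine (Finset.sum_le_card_nsmul _ _ c fun i hi =>
          h m hmk i (Nat.lt_succ_iff.1 (Finset.mem_range.1 hi))).trans ?_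
        rw [Finset.card_range, nsmul_eq_mul]
        gcongr
        exact_mod_cast Nat.succ_le_succ hmk
    _ = _ := by simp; ring

/-- Here `r` and `e` stand for `|x|` and `|y|`: `b` is linear and `d` quadratic in `y`, so `i + 2j`
is the degree in `y`. The error consists of the Taylor remainder of the exponential and of the
dropped terms of degree above `k`, at most `(k+1)²` many; for `e ≤ 1` both are of order `e^(k+1)`.
-/
theorem abs_exp_sub_truncExp_le (k : ℕ) {b d r e : ℝ} (hr : 0 ≤ r) (he : 0 ≤ e) (he1 : e ≤ 1)
    (hb : |b| ≤ r * e) (hd : |d| ≤ e ^ 2) :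
    |Real.exp (b + d) - truncExp k b d| ≤
      (1 + ((k : ℝ) + 1) ^ 2) * Real.exp 1 * (e ^ (k + 1) * ((1 + r) ^ (k + 1) * Real.exp r)) := by
  have hfull : ∑ m ∈ Finset.range (k + 1), (b + d) ^ m / m.factorial =
      ∑ m ∈ Finset.range (k + 1), ∑ i ∈ Finset.range (m + 1),
        b ^ i * d ^ (m - i) * (m.choose i / m.factorial : ℝ) := by
    refine Finset.sum_congr rfl fun m _ => ?_
    rw [add_pow, Finset.sum_div]
    exact Finset.sum_congr rfl fun i _ => by ring
  have hz : |b + d| ≤ e * (1 + r) := by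
    refine (abs_add_le b d).trans ?_
    nlinarith
  have hz' : |b + d| ≤ 1 + r := hz.trans (mul_le_of_le_one_left (by positivity) he1)
  have h1 : |Real.exp (b + d) - ∑ m ∈ Finset.range (k + 1), (b + d) ^ m / m.factorial| ≤
      Real.exp 1 * (e ^ (k + 1) * ((1 + r) ^ (k + 1) * Real.exp r)) := by
    have h := Complex.norm_exp_sub_sum_le_norm_mul_exp ((b + d : ℝ) : ℂ) (k + 1)
    rw [Complex.norm_real, Real.norm_eq_abs] at h
    have hc : Complex.exp ((b + d : ℝ) : ℂ) -
        ∑ m ∈ Finset.range (k + 1), ((b + d : ℝ) : ℂ) ^ m / m.factorial =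
        ((Real.exp (b + d) - ∑ m ∈ Finset.range (k + 1), (b + d) ^ m / m.factorial : ℝ) : ℂ) := by
      push_cast
      rfl
    rw [hc, Complex.norm_real, Real.norm_eq_abs] at h
    refine h.trans ?_
    calc |b + d| ^ (k + 1) * Real.exp |b + d| ≤
          (e * (1 + r)) ^ (k + 1) * Real.exp (1 + r) := by gcongr
      _ = _ := by rw [mul_pow, Real.exp_add]; ring
  have h2 : |(∑ m ∈ Finset.range (k + 1), (b + d) ^ m / m.factorial) - truncExp k b d| ≤
      ((k : ℝ) + 1) ^ 2 * ((1 + r) ^ (k + 1) * e ^ (k + 1)) := by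
    rw [hfull, truncExp, ← Finset.sum_sub_distrib]
    simp_rw [← Finset.sum_sub_distrib]
    refine (Finset.abs_sum_le_sum_abs _ _).trans ((Finset.sum_le_sum fun m _ =>
      Finset.abs_sum_le_sum_abs _ _).trans ?_)
    refine sum_range_range_le (fun m hm i hi => ?_) (by positivity)
    split_ifs with hle
    · rw [sub_self, abs_zero]
      positivity
    · rw [sub_zero]
      refine (abs_expTerm_le hi hr he hb hd).trans ?_
      refine mul_le_mul (pow_le_pow_right₀ (by linarith) (by omega))
        (pow_le_pow_of_le_one he he1 (by omega)) (by positivity) (by positivity)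
  have h3 : (1 : ℝ) ≤ Real.exp 1 * Real.exp r :=
    one_le_mul_of_one_le_of_one_le (Real.one_le_exp zero_le_one) (Real.one_le_exp hr)
  calc |Real.exp (b + d) - truncExp k b d| ≤ _ := abs_sub_le _ _ _
    _ ≤ Real.exp 1 * (e ^ (k + 1) * ((1 + r) ^ (k + 1) * Real.exp r)) +
        ((k : ℝ) + 1) ^ 2 * ((1 + r) ^ (k + 1) * e ^ (k + 1)) * (Real.exp 1 * Real.exp r) :=
        add_le_add h1 (h2.trans (le_mul_of_one_le_right (by positivity) h3))
    _ = _ := by ring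

theorem abs_truncExp_le (k : ℕ) {b d r e : ℝ} (hr : 0 ≤ r) (he1 : 1 ≤ e)
    (hb : |b| ≤ r * e) (hd : |d| ≤ e ^ 2) :
    |truncExp k b d| ≤ ((k : ℝ) + 1) ^ 2 * (e ^ k * (1 + r) ^ (k + 1)) := by
  unfold truncExp
  refine (Finset.abs_sum_le_sum_abs _ _).trans ((Finset.sum_le_sum fun m _ =>
      Finset.abs_sum_le_sum_abs _ _).trans ?_)
  refine sum_range_range_le (fun m hm i hi => ?_) (by positivity)
  split_ifs with hle
  · refine (abs_expTerm_le hi hr (by linarith) hb hd).trans ?_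
    rw [mul_comm]
    exact mul_le_mul (pow_le_pow_right₀ he1 hle) (pow_le_pow_right₀ (by linarith) (by omega))
      (by positivity) (by positivity)
  · rw [abs_zero]
    positivity

/-- The gain `min (r ^ K) (r ^ (⌊K⌋ + 1))` in the remainder of the Taylor expansion. -/
noncomputable def gain (K r : ℝ) : ℝ := min (r ^ K) (r ^ (⌊K⌋₊ + 1))

theorem gain_nonneg (K : ℝ) {r : ℝ} (hr : 0 ≤ r) : 0 ≤ gain K r :=
  le_min (by positivity) (by positivity)

theorem gain_of_le_one {K : ℝ} {r : ℝ} (hr : 0 ≤ r) (hr1 : r ≤ 1) :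
    gain K r = r ^ (⌊K⌋₊ + 1) := by
  refine min_eq_right ?_
  rcases hr.eq_or_lt with rfl | h
  · rw [zero_pow (by omega)]
    positivity
  rw [← Real.rpow_natCast]
  exact Real.rpow_le_rpow_of_exponent_ge h hr1 (by exact_mod_cast (Nat.lt_floor_add_one K).le)

theorem gain_of_one_le {K : ℝ} {r : ℝ} (hr1 : 1 ≤ r) : gain K r = r ^ K := by
  refine min_eq_left ?_
  rw [← Real.rpow_natCast]
  exact Real.rpow_le_rpow_of_exponent_le hr1 (by exact_mod_cast (Nat.lt_floor_add_one K).le)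

theorem gain_le (K r : ℝ) : gain K r ≤ r ^ K := min_le_left _ _

theorem gain_two_mul_le {K : ℝ} {r s : ℝ} (hr : 0 ≤ r) (hs : s ≤ 2 * r)
    (hs0 : 0 ≤ s) (hK : 0 ≤ K) : gain K s ≤ 2 ^ (⌊K⌋₊ + 1) * gain K r := by
  unfold gain
  rw [mul_min_of_nonneg _ _ (by positivity)]
  refine min_le_min ?_ ?_
  · calc s ^ K ≤ (2 * r) ^ K := by gcongr
      _ = 2 ^ K * r ^ K := Real.mul_rpow (by norm_num) hr
      _ ≤ _ := by
        gcongr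
        rw [← Real.rpow_natCast]
        exact Real.rpow_le_rpow_of_exponent_le one_le_two
          (by exact_mod_cast (Nat.lt_floor_add_one K).le)
  · rw [← mul_pow]
    gcongr

theorem measurable_gain (K : ℝ) : Measurable (gain K) := by
  unfold gain
  fun_prop

/-- The exponents `⟨x, y⟩ / 2` and `-|y|² / 4` with `G(x - y, 1) = G(x, 1) exp (b + d)`. -/
noncomputable def taylorPart (k : ℕ) (x y : Space N) : ℝ :=
  heatKernel 1 x * truncExp k (inner ℝ x y / 2) (-‖y‖ ^ 2 / 4)

theorem heatKernel_one_sub (x y : Space N) :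
    heatKernel 1 (x - y) = heatKernel 1 x * Real.exp (inner ℝ x y / 2 + -‖y‖ ^ 2 / 4) := by
  unfold heatKernel
  rw [mul_assoc ((4 * Real.pi * 1) ^ (-(N : ℝ) / 2)), ← Real.exp_add, norm_sub_sq_real]
  congr 2
  ring

/-- For `|y| ≤ 1` this is the Taylor remainder. For `|y| > 1` there is no cancellation: the Taylor
part grows at most like `|y|^⌊K⌋ ≤ |y|^K`, while `G(x - y)`, which is concentrated near `y` and not
near `0`, stays as a separate term. -/
theorem exists_abs_heatKernel_sub_taylorPart_le (N : ℕ) {K : ℝ} (hK : 0 ≤ K) :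
    ∃ C : ℝ, 0 < C ∧ ∀ x y : Space N,
      |heatKernel 1 (x - y) - taylorPart ⌊K⌋₊ x y| ≤
        C * gain K ‖y‖ * Real.exp (-(1 / 8 * ‖x‖ ^ 2)) +
          {y : Space N | 1 < ‖y‖}.indicator (fun _ => heatKernel 1 (x - y)) y := by
  set k := ⌊K⌋₊
  obtain ⟨D, hD, h⟩ := exists_one_add_pow_mul_exp_le (k + 1) (c := 1 / 8) (by norm_num)
  refine ⟨(1 + ((k : ℝ) + 1) ^ 2) * Real.exp 1 * D, by positivity, fun x y => ?_⟩
  have hb : |inner ℝ x y / 2| ≤ ‖x‖ * ‖y‖ := by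
    rw [abs_div, abs_two]
    have := abs_real_inner_le_norm x y
    have h0 := abs_nonneg (inner ℝ x y : ℝ)
    linarith
  have hd : |-‖y‖ ^ 2 / 4| ≤ ‖y‖ ^ 2 := by
    rw [abs_div, abs_neg, abs_of_nonneg (by positivity), abs_of_pos (by norm_num : (0 : ℝ) < 4)]
    linarith [sq_nonneg ‖y‖]
  have hG : heatKernel 1 x ≤ Real.exp (-(1 / 4 * ‖x‖ ^ 2)) := by
    rw [heatKernel_eq one_pos, Real.sqrt_one, inv_one, one_pow, mul_one, div_one]
    refine mul_le_of_le_one_left (by positivity)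
      (pow_le_one₀ (by positivity) (inv_le_one_of_one_le₀ ?_))
    rw [Real.one_le_sqrt]
    linarith [Real.pi_gt_three]
  have hG0 : 0 ≤ heatKernel 1 x := heatKernel_nonneg zero_le_one x
  have hGx : heatKernel 1 x * ((1 + ‖x‖) ^ (k + 1) * Real.exp ‖x‖) ≤
      D * Real.exp (-(1 / 8 * ‖x‖ ^ 2)) := by
    calc heatKernel 1 x * ((1 + ‖x‖) ^ (k + 1) * Real.exp ‖x‖)
        ≤ Real.exp (-(1 / 4 * ‖x‖ ^ 2)) * (D * Real.exp (1 / 8 * ‖x‖ ^ 2)) :=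
          mul_le_mul hG (h _ (norm_nonneg x)) (by positivity) (by positivity)
      _ = D * (Real.exp (-(1 / 4 * ‖x‖ ^ 2)) * Real.exp (1 / 8 * ‖x‖ ^ 2)) := by ring
      _ = _ := by rw [← Real.exp_add]; ring_nf
  rcases le_or_gt ‖y‖ 1 with hy | hy
  · rw [Set.indicator_of_notMem (by simpa using hy), add_zero, heatKernel_one_sub, taylorPart,
      ← mul_sub, abs_mul, abs_of_nonneg hG0, gain_of_le_one (norm_nonneg y) hy]
    calc heatKernel 1 x * |_ - _| ≤ heatKernel 1 x * ((1 + ((k : ℝ) + 1) ^ 2) * Real.exp 1 *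
          (‖y‖ ^ (k + 1) * ((1 + ‖x‖) ^ (k + 1) * Real.exp ‖x‖))) := by
          gcongr
          exact abs_exp_sub_truncExp_le k (norm_nonneg x) (norm_nonneg y) hy hb hd
      _ = (1 + ((k : ℝ) + 1) ^ 2) * Real.exp 1 * ‖y‖ ^ (k + 1) *
          (heatKernel 1 x * ((1 + ‖x‖) ^ (k + 1) * Real.exp ‖x‖)) := by ring
      _ ≤ (1 + ((k : ℝ) + 1) ^ 2) * Real.exp 1 * ‖y‖ ^ (k + 1) *
          (D * Real.exp (-(1 / 8 * ‖x‖ ^ 2))) := by gcongr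
      _ = _ := by ring
  · rw [Set.indicator_of_mem (by exact hy), gain_of_one_le hy.le]
    refine (abs_sub _ _).trans ?_
    rw [abs_of_nonneg (heatKernel_nonneg zero_le_one (x - y)), add_comm]
    gcongr
    rw [taylorPart, abs_mul, abs_of_nonneg hG0]
    have hyk : ‖y‖ ^ k ≤ ‖y‖ ^ K := by
      rw [← Real.rpow_natCast]
      exact Real.rpow_le_rpow_of_exponent_le hy.le (Nat.floor_le hK)
    calc heatKernel 1 x * |truncExp k (inner ℝ x y / 2) (-‖y‖ ^ 2 / 4)|
        ≤ heatKernel 1 x * (((k : ℝ) + 1) ^ 2 * (‖y‖ ^ k * (1 + ‖x‖) ^ (k + 1))) := by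
          gcongr
          exact abs_truncExp_le k (norm_nonneg x) hy.le hb hd
      _ ≤ heatKernel 1 x * (((1 + ((k : ℝ) + 1) ^ 2) * Real.exp 1) *
          (‖y‖ ^ K * ((1 + ‖x‖) ^ (k + 1) * Real.exp ‖x‖))) := by
          gcongr
          · exact (le_add_of_nonneg_left zero_le_one).trans
              (le_mul_of_one_le_right (by positivity) (Real.one_le_exp zero_le_one))
          · exact le_mul_of_one_le_right (by positivity) (Real.one_le_exp (norm_nonneg x))
      _ = ((1 + ((k : ℝ) + 1) ^ 2) * Real.exp 1) * ‖y‖ ^ K *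
          (heatKernel 1 x * ((1 + ‖x‖) ^ (k + 1) * Real.exp ‖x‖)) := by ring
      _ ≤ ((1 + ((k : ℝ) + 1) ^ 2) * Real.exp 1) * ‖y‖ ^ K *
          (D * Real.exp (-(1 / 8 * ‖x‖ ^ 2))) := by gcongr
      _ = _ := by ring

/-- All moments of order at most `K` vanish. -/
def VanishingMoments (K : ℝ) (h : Space N → ℝ) : Prop :=
  ∀ α : MultiIndex N, (order α : ℝ) ≤ K → ∫ x, monomial α x * h x = 0

theorem integral_eval_mul_of_vanishingMoments {K S : ℝ} (hK : 0 ≤ K) (hS : 0 < S)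
    {h : Space N → ℝ}
    (hh : AEStronglyMeasurable h) (hfin : wnorm K S h < ⊤) (hv : VanishingMoments K h)
    (P : MvPolynomial (Fin N) ℝ) (hP : P.totalDegree ≤ ⌊K⌋₊) :
    Integrable (fun y : Space N => MvPolynomial.eval y.ofLp P * h y) ∧
      ∫ y : Space N, MvPolynomial.eval y.ofLp P * h y = 0 := by
  have hord : ∀ d ∈ P.support, (order (d : MultiIndex N) : ℝ) ≤ K := by
    intro d hd
    refine (Nat.le_floor_iff hK).1 (le_trans ?_ hP)
    have := MvPolynomial.le_totalDegree hd
    rwa [Finsupp.sum_fintype _ _ fun _ => rfl] at this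
  have heq : (fun y : Space N => MvPolynomial.eval y.ofLp P * h y) =
      fun y => ∑ d ∈ P.support, P.coeff d * (monomial (d : MultiIndex N) y * h y) := by
    ext y
    rw [MvPolynomial.eval_eq', Finset.sum_mul]
    exact Finset.sum_congr rfl fun d _ => by rw [mul_assoc]; rfl
  have hint : ∀ d ∈ P.support,
      Integrable fun y : Space N => P.coeff d * (monomial (d : MultiIndex N) y * h y) :=
    fun d hd => (integrable_monomial_mul hS (hord d hd) hh hfin).const_mul _
  rw [heq]
  refine ⟨integrable_finsetSum _ hint, ?_⟩
  rw [integral_finsetSum _ hint]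
  refine Finset.sum_eq_zero fun d hd => ?_
  rw [integral_const_mul, hv _ (hord d hd), mul_zero]

/-- The truncation by `i + 2j ≤ k` was chosen for this purpose: a truncation of the exponential
series alone would have degree up to `2k` in `y`, beyond the moments that are assumed to vanish. -/
theorem exists_polynomial_truncExp (k : ℕ) (x : Space N) (c : ℝ) :
    ∃ P : MvPolynomial (Fin N) ℝ, P.totalDegree ≤ k ∧ ∀ y : Space N,
      MvPolynomial.eval y.ofLp P =
        truncExp k (inner ℝ x (c • y) / 2) (-‖c • y‖ ^ 2 / 4) := by
  set B : MvPolynomial (Fin N) ℝ := ∑ l, MvPolynomial.C (c * x l / 2) * MvPolynomial.X l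
  set D : MvPolynomial (Fin N) ℝ := ∑ l, MvPolynomial.C (-c ^ 2 / 4) * MvPolynomial.X l ^ 2
  have hB : B.totalDegree ≤ 1 := by
    refine MvPolynomial.totalDegree_finsetSum_le fun l _ => ?_
    refine (MvPolynomial.totalDegree_mul _ _).trans ?_
    simp
  have hD : D.totalDegree ≤ 2 := by
    refine MvPolynomial.totalDegree_finsetSum_le fun l _ => ?_
    refine (MvPolynomial.totalDegree_mul _ _).trans ?_
    simp
  refine ⟨∑ m ∈ Finset.range (k + 1), ∑ i ∈ Finset.range (m + 1),
    if i + 2 * (m - i) ≤ k then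
      B ^ i * D ^ (m - i) * MvPolynomial.C (m.choose i / m.factorial : ℝ) else 0, ?_, fun y => ?_⟩
  · refine MvPolynomial.totalDegree_finsetSum_le fun m _ =>
      MvPolynomial.totalDegree_finsetSum_le fun i _ => ?_
    split_ifs with hle
    · refine (MvPolynomial.totalDegree_mul _ _).trans ?_
      rw [MvPolynomial.totalDegree_C, add_zero]
      refine (MvPolynomial.totalDegree_mul _ _).trans (le_trans (add_le_add
        (MvPolynomial.totalDegree_pow _ _) (MvPolynomial.totalDegree_pow _ _)) ?_)
      have h1 := Nat.mul_le_mul_left i hB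
      have h2 := Nat.mul_le_mul_left (m - i) hD
      omega
    · simp
  · have eB : MvPolynomial.eval y.ofLp B = inner ℝ x (c • y) / 2 := by
      simp only [B, map_sum, map_mul, MvPolynomial.eval_C, MvPolynomial.eval_X,
        PiLp.inner_apply, PiLp.smul_apply, Finset.sum_div]
      refine Finset.sum_congr rfl fun l _ => ?_
      simp
      ring
    have eD : MvPolynomial.eval y.ofLp D = -‖c • y‖ ^ 2 / 4 := by
      simp only [D, map_sum, map_mul, map_pow, MvPolynomial.eval_C, MvPolynomial.eval_X]
      rw [← Finset.mul_sum, norm_smul, mul_pow, EuclideanSpace.real_norm_sq_eq, Real.norm_eq_abs,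
        sq_abs]
      ring
    unfold truncExp
    simp only [map_sum]
    refine Finset.sum_congr rfl fun m _ => Finset.sum_congr rfl fun i _ => ?_
    split_ifs
    · rw [map_mul, map_mul, map_pow, map_pow, eB, eD, MvPolynomial.eval_C]
    · exact map_zero _

theorem heatKernel_scale {τ : ℝ} (hτ : 0 < τ) (x : Space N) :
    heatKernel τ x = (√τ)⁻¹ ^ N * heatKernel 1 ((√τ)⁻¹ • x) := by
  rw [heatKernel_eq hτ, heatKernel_eq one_pos, norm_smul, mul_pow, Real.norm_eq_abs, sq_abs,
    inv_pow (√τ) 2, Real.sq_sqrt hτ.le]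
  simp only [Real.sqrt_one, inv_one, one_pow, mul_one, div_one]
  rw [show 1 / 4 * (τ⁻¹ * ‖x‖ ^ 2) = 1 / 4 * ‖x‖ ^ 2 / τ by ring]
  ring

/-- For fixed `x` the Taylor part is a polynomial in `y` of degree at most `⌊K⌋`, so its integral
against `h` is zero and it can be subtracted freely. -/
theorem heatFlow_eq_of_vanishingMoments {K S : ℝ} (hK : 0 ≤ K) (hS : 0 < S) {h : Space N → ℝ}
    (hh : AEStronglyMeasurable h) (hfin : wnorm K S h < ⊤) (hv : VanishingMoments K h)
    {τ : ℝ} (hτ : 0 < τ) (x : Space N) :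
    heatFlow τ h x = ∫ y, (√τ)⁻¹ ^ N * (heatKernel 1 ((√τ)⁻¹ • x - (√τ)⁻¹ • y) -
      taylorPart ⌊K⌋₊ ((√τ)⁻¹ • x) ((√τ)⁻¹ • y)) * h y := by
  obtain ⟨P, hPd, hP⟩ := exists_polynomial_truncExp ⌊K⌋₊ ((√τ)⁻¹ • x) (√τ)⁻¹
  obtain ⟨hint, hzero⟩ := integral_eval_mul_of_vanishingMoments hK hS hh hfin hv P hPd
  have hint' : Integrable fun y => heatKernel τ (x - y) * h y := by
    refine (integrable_of_wnorm_lt_top hh hfin).bdd_mul (c := (√τ)⁻¹ ^ N)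
      ((continuous_heatKernel τ).comp (by fun_prop)).aestronglyMeasurable
      (Eventually.of_forall fun y => ?_)
    rw [Real.norm_of_nonneg (heatKernel_nonneg hτ.le _)]
    exact heatKernel_le_inv_sqrt hτ _
  have hc := hint.const_mul ((√τ)⁻¹ ^ N * heatKernel 1 ((√τ)⁻¹ • x))
  have : ∀ y, (√τ)⁻¹ ^ N * (heatKernel 1 ((√τ)⁻¹ • x - (√τ)⁻¹ • y) -
      taylorPart ⌊K⌋₊ ((√τ)⁻¹ • x) ((√τ)⁻¹ • y)) * h y =
      heatKernel τ (x - y) * h y - (√τ)⁻¹ ^ N * heatKernel 1 ((√τ)⁻¹ • x) *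
        (MvPolynomial.eval y.ofLp P * h y) := by
    intro y
    rw [hP y, heatKernel_scale hτ, taylorPart, smul_sub]
    ring
  simp_rw [this]
  rw [integral_sub hint' hc, integral_const_mul, hzero, mul_zero, sub_zero]
  rfl

/-- The condition `S ≤ 3T/4` makes `τ = T - S` comparable with `T`. The kernel is dominated by `κ`:
a Gaussian in `x` times the gain in `y`, plus the heat kernel itself for `|y| > √τ`. The integral of
the gain against `|h|` is kept as it stands, since its decay beyond `T^(-K/2)` will come from
dominated convergence. -/
theorem exists_boundedBy_heatFlow_gain (N : ℕ) {K : ℝ} (hK : 0 ≤ K) :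
    ∃ C : ℝ, 0 < C ∧ ∀ S T : ℝ, 0 < S → 0 < T → S ≤ 3 / 4 * T → ∀ h : Space N → ℝ,
      AEStronglyMeasurable h → wnorm K S h < ⊤ → VanishingMoments K h →
      BoundedBy K T (heatFlow (T - S) h)
        (ENNReal.ofReal C * ∫⁻ y, ENNReal.ofReal (gain K (‖y‖ / √T)) * ‖h y‖ₑ) := by
  obtain ⟨C₁, hC₁, h₁⟩ := exists_abs_heatKernel_sub_taylorPart_le N hK
  obtain ⟨C₂, hC₂, h₂⟩ := exists_lintegral_exp_mul_weight_le N hK (c := 1 / 8) (by norm_num)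
  obtain ⟨C₃, hC₃, h₃⟩ := exists_lintegral_heatKernel_mul_weight_le N hK
  set k := ⌊K⌋₊
  set A := (C₁ * C₂ + C₃ * 2) with hA
  set B := 2 ^ N * (C₁ + 1) with hB
  refine ⟨2 ^ (k + 1) * (A + B), by positivity, fun S T hS hT hST h hh hfin hv => ?_⟩
  set τ := T - S with hτdef
  have hτ : 0 < τ := by linarith
  have hs : 0 < √τ := Real.sqrt_pos.2 hτ
  have hsT : 0 < √T := Real.sqrt_pos.2 hT
  have hTτ : √T ≤ 2 * √τ := by
    refine Real.sqrt_le_iff.2 ⟨by positivity, ?_⟩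
    rw [mul_pow, Real.sq_sqrt hτ.le]
    linarith
  have hr : ∀ y : Space N, gain K ((√τ)⁻¹ * ‖y‖) ≤ 2 ^ (k + 1) * gain K (‖y‖ / √T) := by
    intro y
    refine gain_two_mul_le (by positivity) ?_ (by positivity) hK
    rw [inv_mul_eq_div, div_le_iff₀ hs]
    calc ‖y‖ = ‖y‖ / √T * √T := by field_simp
      _ ≤ ‖y‖ / √T * (2 * √τ) := by gcongr
      _ = _ := by ring
  have hnorm : ∀ y : Space N, ‖(√τ)⁻¹ • y‖ = (√τ)⁻¹ * ‖y‖ := fun y => by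
    rw [norm_smul, Real.norm_of_nonneg (by positivity)]
  have hg0 : ∀ y : Space N, 0 ≤ gain K ((√τ)⁻¹ * ‖y‖) := fun y =>
    gain_nonneg K (by positivity)
  set far : Set (Space N) := {y | 1 < (√τ)⁻¹ * ‖y‖} with hfar
  have hfarm : MeasurableSet far := measurableSet_lt measurable_const (by fun_prop)
  set κ : Space N → Space N → ℝ≥0∞ := fun x y =>
    ENNReal.ofReal (C₁ * (√τ)⁻¹ ^ N * gain K ((√τ)⁻¹ * ‖y‖)) *
      ENNReal.ofReal (Real.exp (-(1 / 8 * ‖x‖ ^ 2 / τ))) +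
      far.indicator (fun _ => 1) y * ENNReal.ofReal (heatKernel τ (x - y)) with hκ
  have hκm : Measurable (Function.uncurry κ) := by
    change Measurable fun z : Space N × Space N =>
      ENNReal.ofReal (C₁ * (√τ)⁻¹ ^ N * gain K ((√τ)⁻¹ * ‖z.2‖)) *
        ENNReal.ofReal (Real.exp (-(1 / 8 * ‖z.1‖ ^ 2 / τ))) +
        far.indicator (fun _ => 1) z.2 * ENNReal.ofReal (heatKernel τ (z.1 - z.2))
    have m1 : Measurable fun z : Space N × Space N => gain K ((√τ)⁻¹ * ‖z.2‖) :=
      (measurable_gain K).comp (by fun_prop)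
    have m2 : Measurable fun z : Space N × Space N => far.indicator (fun _ => (1 : ℝ≥0∞)) z.2 :=
      (measurable_const.indicator hfarm).comp measurable_snd
    have m3 : Measurable fun z : Space N × Space N => ENNReal.ofReal (heatKernel τ (z.1 - z.2)) :=
      measurable_heatKernel_sub τ
    fun_prop
  have hdom : ∀ x, ‖heatFlow τ h x‖ₑ ≤ ∫⁻ y, κ x y * ‖h y‖ₑ := by
    intro x
    rw [heatFlow_eq_of_vanishingMoments hK hS hh hfin hv hτ x]
    refine (enorm_integral_le_lintegral_enorm _).trans (lintegral_mono fun y => ?_)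
    rw [enorm_mul]
    gcongr
    rw [Real.enorm_eq_ofReal_abs, abs_mul, abs_of_nonneg (by positivity)]
    refine (ENNReal.ofReal_le_ofReal (mul_le_mul_of_nonneg_left
      (h₁ ((√τ)⁻¹ • x) ((√τ)⁻¹ • y)) (by positivity))).trans ?_
    rw [mul_add, hnorm, hnorm]
    refine ENNReal.ofReal_add_le.trans (add_le_add (le_of_eq ?_) (le_of_eq ?_))
    · have := hg0 y
      rw [← ENNReal.ofReal_mul (by positivity), mul_pow, inv_pow (√τ) 2, Real.sq_sqrt hτ.le,
        show 1 / 8 * (τ⁻¹ * ‖x‖ ^ 2) = 1 / 8 * ‖x‖ ^ 2 / τ by ring]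
      congr 1
      ring
    · by_cases hy : y ∈ far
      · rw [Set.indicator_of_mem (show (√τ)⁻¹ • y ∈ {y : Space N | 1 < ‖y‖} by
          rw [Set.mem_ofPred_eq, hnorm]; exact hy), Set.indicator_of_mem hy, one_mul, heatKernel_scale hτ, smul_sub]
      · rw [Set.indicator_of_notMem (show (√τ)⁻¹ • y ∉ {y : Space N | 1 < ‖y‖} by
          rw [Set.mem_ofPred_eq, hnorm]; exact hy), Set.indicator_of_notMem hy, zero_mul, mul_zero,
          ENNReal.ofReal_zero]
  -- Far out the gain is `r ^ K ≥ 1`, so it pays for the whole weight `1 + r ^ K`.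
  have hfargain : ∀ y ∈ far, weight K T y ≤ 2 * gain K ((√τ)⁻¹ * ‖y‖) := by
    intro y hy
    refine (weight_anti hK hτ (by linarith) y).trans ?_
    rw [gain_of_one_le (le_of_lt hy), weight, ← inv_mul_eq_div]
    linarith [Real.one_le_rpow (le_of_lt hy) hK]
  refine ⟨?_, fun x => ?_⟩
  · have hAy : ∀ y, ∫⁻ x, κ x y * ENNReal.ofReal (weight K T x) ≤
        ENNReal.ofReal (2 ^ (k + 1) * A) * ENNReal.ofReal (gain K (‖y‖ / √T)) := by
      intro y
      have hgy := hg0 y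
      simp only [hκ, add_mul]
      have m1 : Measurable fun x : Space N =>
          ENNReal.ofReal (C₁ * (√τ)⁻¹ ^ N * gain K ((√τ)⁻¹ * ‖y‖)) *
            ENNReal.ofReal (Real.exp (-(1 / 8 * ‖x‖ ^ 2 / τ))) *
            ENNReal.ofReal (weight K T x) := by
        have := measurable_ofReal_weight (N := N) K T
        fun_prop
      rw [lintegral_add_left m1]
      have e1 : ∫⁻ x : Space N, ENNReal.ofReal (C₁ * (√τ)⁻¹ ^ N * gain K ((√τ)⁻¹ * ‖y‖)) *
          ENNReal.ofReal (Real.exp (-(1 / 8 * ‖x‖ ^ 2 / τ))) * ENNReal.ofReal (weight K T x) ≤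
          ENNReal.ofReal (C₁ * C₂ * gain K ((√τ)⁻¹ * ‖y‖)) := by
        simp_rw [mul_assoc (ENNReal.ofReal (C₁ * (√τ)⁻¹ ^ N * gain K ((√τ)⁻¹ * ‖y‖)))]
        rw [lintegral_const_mul' _ _ ENNReal.ofReal_ne_top]
        calc _ ≤ ENNReal.ofReal (C₁ * (√τ)⁻¹ ^ N * gain K ((√τ)⁻¹ * ‖y‖)) *
              ENNReal.ofReal (C₂ * √τ ^ N) := by
              gcongr
              refine (lintegral_mono fun x => ?_).trans (h₂ τ hτ)
              gcongr
              exact weight_anti hK hτ (by linarith) x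
          _ = _ := by
              rw [← ENNReal.ofReal_mul (by positivity), inv_pow]
              congr 1
              field_simp
      have e2 : ∫⁻ x : Space N, far.indicator (fun _ => 1) y *
          ENNReal.ofReal (heatKernel τ (x - y)) * ENNReal.ofReal (weight K T x) ≤
          ENNReal.ofReal (C₃ * 2 * gain K ((√τ)⁻¹ * ‖y‖)) := by
        by_cases hy : y ∈ far
        · simp only [Set.indicator_of_mem hy, one_mul]
          refine (h₃ τ T hτ (by linarith) y).trans (ENNReal.ofReal_le_ofReal ?_)
          rw [mul_assoc]
          gcongr
          exact hfargain y hy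
        · simp [Set.indicator_of_notMem hy]
      refine (add_le_add e1 e2).trans ?_
      rw [← ENNReal.ofReal_add (by positivity) (by positivity),
        ← ENNReal.ofReal_mul (by positivity)]
      refine ENNReal.ofReal_le_ofReal ?_
      calc C₁ * C₂ * gain K ((√τ)⁻¹ * ‖y‖) + C₃ * 2 * gain K ((√τ)⁻¹ * ‖y‖)
          = A * gain K ((√τ)⁻¹ * ‖y‖) := by rw [hA]; ring
        _ ≤ A * (2 ^ (k + 1) * gain K (‖y‖ / √T)) := by gcongr; exact hr y
        _ = _ := by ring
    refine (lintegral_mul_le_of_kernel hκm (measurable_ofReal_weight K T) hh hdom hAy).trans ?_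
    simp_rw [mul_assoc (ENNReal.ofReal (2 ^ (k + 1) * A))]
    rw [lintegral_const_mul' _ _ ENNReal.ofReal_ne_top]
    gcongr
    have : 0 ≤ B := by positivity
    linarith
  · rw [← lintegral_const_mul' _ _ ENNReal.ofReal_ne_top]
    refine (mul_le_mul_right (hdom x) _).trans ?_
    rw [← lintegral_const_mul' _ _ ENNReal.ofReal_ne_top]
    refine lintegral_mono fun y => ?_
    rw [← mul_assoc, ← mul_assoc]
    refine mul_le_mul_left ?_ _
    have hgy := hg0 y
    have e : κ x y ≤ ENNReal.ofReal ((√τ)⁻¹ ^ N * (C₁ + 1) * gain K ((√τ)⁻¹ * ‖y‖)) := by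
      rw [mul_add, mul_one, add_mul, ENNReal.ofReal_add (by positivity) (by positivity)]
      refine add_le_add ?_ ?_
      · rw [← ENNReal.ofReal_mul (by positivity), mul_comm ((√τ)⁻¹ ^ N)]
        refine ENNReal.ofReal_le_ofReal (mul_le_of_le_one_right (by positivity) ?_)
        rw [Real.exp_le_one_iff]
        exact neg_nonpos.2 (by positivity)
      · by_cases hy : y ∈ far
        · rw [Set.indicator_of_mem hy, one_mul]
          refine ENNReal.ofReal_le_ofReal ((heatKernel_le_inv_sqrt hτ _).trans ?_)
          refine le_mul_of_one_le_right (by positivity) ?_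
          rw [gain_of_one_le (le_of_lt hy)]
          exact Real.one_le_rpow (le_of_lt hy) hK
        · simp [Set.indicator_of_notMem hy]
    refine (mul_le_mul_right e _).trans ?_
    have hgT : 0 ≤ gain K (‖y‖ / √T) := gain_nonneg K (by positivity)
    rw [← ENNReal.ofReal_mul (by positivity), ← ENNReal.ofReal_mul (by positivity)]
    refine ENNReal.ofReal_le_ofReal ?_
    calc √T ^ N * ((√τ)⁻¹ ^ N * (C₁ + 1) * gain K ((√τ)⁻¹ * ‖y‖))
        ≤ (2 * √τ) ^ N * ((√τ)⁻¹ ^ N * (C₁ + 1) * (2 ^ (k + 1) * gain K (‖y‖ / √T))) := by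
          gcongr
          exact hr y
      _ = 2 ^ (k + 1) * B * gain K (‖y‖ / √T) := by
          rw [hB, mul_pow, inv_pow]
          field_simp
      _ ≤ 2 ^ (k + 1) * (A + B) * gain K (‖y‖ / √T) := by
          gcongr
          have : 0 ≤ A := by positivity
          linarith

theorem lintegral_gain_mul_le {K S T : ℝ} (hS : 0 < S) (hT : 0 < T) (h : Space N → ℝ) :
    ∫⁻ y, ENNReal.ofReal (gain K (‖y‖ / √T)) * ‖h y‖ₑ ≤
      ENNReal.ofReal ((S / T) ^ (K / 2)) * wnorm K S h := by
  unfold wnorm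
  rw [← lintegral_const_mul' _ _ ENNReal.ofReal_ne_top]
  refine lintegral_mono fun y => ?_
  rw [mul_left_comm, mul_comm (ENNReal.ofReal _)]
  gcongr
  rw [← ENNReal.ofReal_mul (by positivity)]
  refine ENNReal.ofReal_le_ofReal ((gain_le _ _).trans ?_)
  have hs : 0 < √S := Real.sqrt_pos.2 hS
  have ht : 0 < √T := Real.sqrt_pos.2 hT
  have e : ‖y‖ / √T = √(S / T) * (‖y‖ / √S) := by
    rw [Real.sqrt_div hS.le]
    field_simp
  rw [e, Real.mul_rpow (by positivity) (by positivity), Real.sqrt_eq_rpow,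
    ← Real.rpow_mul (by positivity), one_div_mul_eq_div]
  gcongr
  unfold weight
  linarith

/-- For `S ≤ 3T/4` the gain is estimated by `(S/T)^(K/2)` times the weight at scale `S`. For larger
`S` the ratio `S/T` is bounded below, so boundedness of the flow already gives the claim without
cancellation. -/
theorem exists_boundedBy_heatFlow_of_vanishingMoments (N : ℕ) {K : ℝ} (hK : 0 ≤ K) :
    ∃ C : ℝ, 0 < C ∧ ∀ S T : ℝ, 0 < S → S < T → ∀ h : Space N → ℝ,
      AEStronglyMeasurable h → wnorm K S h < ⊤ → VanishingMoments K h →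
      BoundedBy K T (heatFlow (T - S) h)
        (ENNReal.ofReal (C * (S / T) ^ (K / 2)) * xnorm K S h) := by
  obtain ⟨C₁, hC₁, h₁⟩ := exists_boundedBy_heatFlow_gain N hK
  obtain ⟨C₂, hC₂, h₂⟩ := exists_boundedBy_heatFlow N hK
  refine ⟨C₁ + C₂ * 2 ^ (K / 2), by positivity, fun S T hS hST h hh hfin hv => ?_⟩
  have hT : 0 < T := hS.trans hST
  rcases le_total S (3 / 4 * T) with hcase | hcase
  · refine (h₁ S T hS hT hcase h hh hfin hv).mono ?_
    refine (mul_le_mul_right (lintegral_gain_mul_le hS hT h) _).trans ?_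
    rw [← mul_assoc, ← ENNReal.ofReal_mul hC₁.le]
    gcongr
    · exact le_add_of_nonneg_right (by positivity)
    · exact wnorm_le_xnorm K S h
  · refine (h₂ S T hS hST h hh).mono ?_
    gcongr
    have : (1 / 2 : ℝ) ^ (K / 2) ≤ (S / T) ^ (K / 2) := by
      refine Real.rpow_le_rpow (by norm_num) ?_ (by positivity)
      rw [le_div_iff₀ hT]
      linarith
    calc C₂ = C₂ * 2 ^ (K / 2) * (1 / 2) ^ (K / 2) := by
          rw [mul_assoc, ← Real.mul_rpow (by norm_num) (by norm_num)]
          norm_num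
      _ ≤ C₂ * 2 ^ (K / 2) * (S / T) ^ (K / 2) := by gcongr
      _ ≤ _ := by
        gcongr
        linarith


/-! ### Sources and the Duhamel integral: measurability and integrability -/

/-- Joint measurability on `(0,∞) × ℝ^N`. -/
def JointlyMeasurable (h : ℝ → Space N → ℝ) : Prop :=
  AEStronglyMeasurable (fun z : ℝ × Space N => h z.1 z.2)
    ((volume.restrict (Ioi (0 : ℝ))).prod volume)

/-- A source term of decay `γ`. -/
structure IsSource (K γ : ℝ) (h : ℝ → Space N → ℝ) : Prop where
  meas : JointlyMeasurable h
  bound : ∃ C : ℝ, 0 ≤ C ∧ ∀ᵐ s ∂volume.restrict (Ioi (0 : ℝ)),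
    xnorm K (s + 1) (h s) ≤ ENNReal.ofReal (C * (s + 1) ^ (-γ - 1))

theorem JointlyMeasurable.ae {h : ℝ → Space N → ℝ} (hh : JointlyMeasurable h) :
    ∀ᵐ s ∂volume.restrict (Ioi (0 : ℝ)), AEStronglyMeasurable (h s) volume :=
  AEStronglyMeasurable.prodMk_left hh

theorem JointlyMeasurable.sub {h₁ h₂ : ℝ → Space N → ℝ} (hh₁ : JointlyMeasurable h₁)
    (hh₂ : JointlyMeasurable h₂) : JointlyMeasurable fun s x => h₁ s x - h₂ s x :=
  AEStronglyMeasurable.sub hh₁ hh₂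

theorem ae_Ioc_of_ae_Ioi {t : ℝ} {P : ℝ → Prop}
    (h : ∀ᵐ s ∂volume.restrict (Ioi (0 : ℝ)), P s) :
    ∀ᵐ s ∂volume.restrict (Ioc (0 : ℝ) t), P s :=
  ae_restrict_of_ae_restrict_of_subset Ioc_subset_Ioi_self h

theorem ae_Ioc_lt (t : ℝ) : ∀ᵐ s ∂volume.restrict (Ioc (0 : ℝ) t), 0 < s ∧ s < t := by
  rw [← restrict_Ioo_eq_restrict_Ioc]
  exact (ae_restrict_mem measurableSet_Ioo).mono fun s hs => hs

theorem ae_Ioi_pos : ∀ᵐ s ∂volume.restrict (Ioi (0 : ℝ)), 0 < s :=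
  ae_restrict_mem measurableSet_Ioi

/-- Since `h` is only a.e. measurable, the time may be substituted only through a map `σ` that pulls
null sets back to null sets. The generality covers both a fixed target time and a variable one. -/
theorem JointlyMeasurable.heatFlow {Z : Type*} [MeasurableSpace Z] {ν : Measure Z} [SFinite ν]
    {h : ℝ → Space N → ℝ} (hh : JointlyMeasurable h) {τ σ : Z → ℝ} {X : Z → Space N}
    (hτ : Measurable τ) (hX : Measurable X)
    (hσ : Measure.QuasiMeasurePreserving σ ν (volume.restrict (Ioi 0))) :
    AEStronglyMeasurable (fun z => HeatExpansion.heatFlow (τ z) (h (σ z)) (X z)) ν := by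
  have h1 : AEStronglyMeasurable (fun z : Z × Space N => h (σ z.1) z.2)
      (ν.prod (volume : Measure (Space N))) :=
    hh.comp_quasiMeasurePreserving
      (QuasiMeasurePreserving.prodMap hσ (Measure.QuasiMeasurePreserving.id (volume : Measure (Space N))))
  have h2 : Measurable fun z : Z × Space N => heatKernel (τ z.1) (X z.1 - z.2) :=
    measurable_uncurry_heatKernel.comp
      ((hτ.comp measurable_fst).prodMk ((hX.comp measurable_fst).sub measurable_snd))
  exact (h2.aestronglyMeasurable.mul h1).integral_prod_right'

theorem JointlyMeasurable.duhamel {W : Type*} [MeasurableSpace W] {ω : Measure W} [SFinite ω]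
    {h : ℝ → Space N → ℝ} (hh : JointlyMeasurable h) {τ : W → ℝ} {X : W → Space N}
    (hτ : Measurable τ) (hX : Measurable X) (hpos : ∀ᵐ w ∂ω, 0 ≤ τ w) :
    AEStronglyMeasurable (fun w => HeatExpansion.duhamel h (τ w) (X w)) ω := by
  have h1 : AEStronglyMeasurable
      (fun z : W × ℝ => HeatExpansion.heatFlow (τ z.1 - z.2) (h z.2) (X z.1))
      (ω.prod (volume.restrict (Ioi 0))) :=
    hh.heatFlow ((hτ.comp measurable_fst).sub measurable_snd) (hX.comp measurable_fst)
      Measure.quasiMeasurePreserving_snd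
  -- The variable upper limit is rewritten as an indicator on the fixed half-line, so that
  -- measurability of parameter integrals applies.
  have hS : MeasurableSet {z : W × ℝ | z.2 ≤ τ z.1} :=
    measurableSet_le measurable_snd (hτ.comp measurable_fst)
  refine ((h1.indicator hS).integral_prod_right').congr ?_
  filter_upwards [hpos] with w hw
  unfold HeatExpansion.duhamel
  rw [intervalIntegral.integral_of_le hw]
  have : (fun s => {z : W × ℝ | z.2 ≤ τ z.1}.indicator
      (fun z : W × ℝ => HeatExpansion.heatFlow (τ z.1 - z.2) (h z.2) (X z.1)) (w, s)) =
      (Iic (τ w)).indicator (fun s => HeatExpansion.heatFlow (τ w - s) (h s) (X w)) := by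
    ext s
    simp [Set.indicator]
  rw [this, integral_indicator measurableSet_Iic, Measure.restrict_restrict measurableSet_Iic]
  congr 2
  ext s
  simp [and_comm]

theorem JointlyMeasurable.duhamel_at {h : ℝ → Space N → ℝ} (hh : JointlyMeasurable h) {t : ℝ}
    (ht : 0 ≤ t) : AEStronglyMeasurable (HeatExpansion.duhamel h t) volume :=
  hh.duhamel (ω := volume) (τ := fun _ => t) (X := id) measurable_const measurable_id
    (Eventually.of_forall fun _ => ht)

theorem JointlyMeasurable.jointlyMeasurable_duhamel {h : ℝ → Space N → ℝ}
    (hh : JointlyMeasurable h) : JointlyMeasurable (HeatExpansion.duhamel h) := by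
  refine hh.duhamel measurable_fst measurable_snd ?_
  exact Measure.quasiMeasurePreserving_fst.ae (ae_Ioi_pos.mono fun _ hs => hs.le)

theorem jointlyMeasurable_gDeriv (α : MultiIndex N) : JointlyMeasurable (gDeriv α) := by
  have h : Measurable fun z : ℝ × Space N => ∏ i, ((√(z.1 + 1))⁻¹ ^ (α i + 1) *
      kern1 (α i) 1 ((√(z.1 + 1))⁻¹ * z.2 i)) := by
    refine Finset.measurable_fun_prod _ fun i _ => ?_
    refine Measurable.mul (by fun_prop) ((continuous_kern1 (α i) 1).measurable.comp (by fun_prop))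
  refine h.aestronglyMeasurable.congr ?_
  filter_upwards [Measure.quasiMeasurePreserving_fst.ae ae_Ioi_pos] with z hz
  have hz' : 0 < z.1 + 1 := by linarith
  rw [gDeriv_eq_prod α hz']
  exact Finset.prod_congr rfl fun i _ => (kern1_scale _ hz' _).symm

theorem aestronglyMeasurable_integral_monomial_mul_gDeriv (α β : MultiIndex N) :
    AEStronglyMeasurable (fun s => ∫ x, monomial α x * gDeriv β s x)
      (volume.restrict (Ioi (0 : ℝ))) := by
  have h : Measurable fun s : ℝ => √(s + 1) ^ order α * (√(s + 1))⁻¹ ^ order β *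
      ∏ i, kernMoment (α i) (β i) := by fun_prop
  refine h.aestronglyMeasurable.congr ?_
  filter_upwards [ae_Ioi_pos] with s hs
  exact (integral_monomial_mul_gDeriv α β (by linarith)).symm

theorem JointlyMeasurable.moment {h : ℝ → Space N → ℝ} (hh : JointlyMeasurable h)
    (α : MultiIndex N) :
    AEStronglyMeasurable (fun s => HeatExpansion.moment α (h s) s)
      (volume.restrict (Ioi (0 : ℝ))) := by
  induction α using WellFoundedLT.induction with
  | ind α ih =>
    simp_rw [fun s => moment_eq α (h s) s]
    refine AEStronglyMeasurable.sub ?_ ?_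
    · refine AEStronglyMeasurable.integral_prod_right'
        (f := fun z : ℝ × Space N => monomial α z.2 * h z.1 z.2) ?_
      exact ((continuous_monomial α).comp continuous_snd).aestronglyMeasurable.mul hh
    · exact Finset.aestronglyMeasurable_fun_sum _ fun β hβ =>
        (ih β (Finset.mem_Iio.1 hβ)).mul
          (aestronglyMeasurable_integral_monomial_mul_gDeriv α β)

theorem JointlyMeasurable.coeff_mul_gDeriv {c : ℝ → ℝ}
    (hc : AEStronglyMeasurable c (volume.restrict (Ioi (0 : ℝ)))) (α : MultiIndex N) :
    JointlyMeasurable fun s x => c s * gDeriv α s x :=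
  hc.comp_fst.mul (jointlyMeasurable_gDeriv α)

theorem JointlyMeasurable.sum {ι : Type*} (s : Finset ι) {h : ι → ℝ → Space N → ℝ}
    (hh : ∀ i ∈ s, JointlyMeasurable (h i)) : JointlyMeasurable fun t x => ∑ i ∈ s, h i t x :=
  Finset.aestronglyMeasurable_fun_sum _ hh

theorem JointlyMeasurable.momentProj {h : ℝ → Space N → ℝ} (hh : JointlyMeasurable h) (K : ℝ) :
    JointlyMeasurable fun s => HeatExpansion.momentProj K s (h s) :=
  hh.sub (JointlyMeasurable.sum _ fun α _ => JointlyMeasurable.coeff_mul_gDeriv (hh.moment α) α)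

theorem aestronglyMeasurable_primitive {c : ℝ → ℝ}
    (hc : AEStronglyMeasurable c (volume.restrict (Ioi (0 : ℝ)))) :
    AEStronglyMeasurable (fun t => ∫ s in (0 : ℝ)..t, c s) (volume.restrict (Ioi (0 : ℝ))) := by
  have h1 : AEStronglyMeasurable (fun z : ℝ × ℝ => c z.2)
      ((volume.restrict (Ioi (0 : ℝ))).prod (volume.restrict (Ioi (0 : ℝ)))) := hc.comp_snd
  have hS : MeasurableSet {z : ℝ × ℝ | z.2 ≤ z.1} :=
    measurableSet_le measurable_snd measurable_fst
  refine ((h1.indicator hS).integral_prod_right').congr ?_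
  filter_upwards [ae_Ioi_pos] with t ht
  rw [intervalIntegral.integral_of_le ht.le]
  have : (fun s => {z : ℝ × ℝ | z.2 ≤ z.1}.indicator (fun z : ℝ × ℝ => c z.2) (t, s)) =
      (Iic t).indicator c := by
    ext s
    simp [Set.indicator]
  rw [this, integral_indicator measurableSet_Iic, Measure.restrict_restrict measurableSet_Iic]
  congr 2
  ext s
  simp [and_comm]

namespace IsSource

variable {K γ : ℝ} {h : ℝ → Space N → ℝ}

theorem ae_xnorm_lt_top (hh : IsSource K γ h) :
    ∀ᵐ s ∂volume.restrict (Ioi (0 : ℝ)), xnorm K (s + 1) (h s) < ⊤ := by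
  obtain ⟨C, -, hC⟩ := hh.bound
  exact hC.mono fun s hs => hs.trans_lt ENNReal.ofReal_lt_top

theorem ae_wnorm_lt_top (hh : IsSource K γ h) :
    ∀ᵐ s ∂volume.restrict (Ioi (0 : ℝ)), wnorm K (s + 1) (h s) < ⊤ :=
  hh.ae_xnorm_lt_top.mono fun _ hs => (wnorm_le_xnorm _ _ _).trans_lt hs

theorem ae_integrable (hh : IsSource K γ h) :
    ∀ᵐ s ∂volume.restrict (Ioi (0 : ℝ)), Integrable (h s) := by
  filter_upwards [hh.ae_wnorm_lt_top, hh.meas.ae] with s hs hm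
  exact integrable_of_wnorm_lt_top hm hs

theorem ae_integrable_monomial (hh : IsSource K γ h) :
    ∀ᵐ s ∂volume.restrict (Ioi (0 : ℝ)), ∀ α : MultiIndex N, (order α : ℝ) ≤ K →
      Integrable fun x => monomial α x * h s x := by
  filter_upwards [hh.ae_wnorm_lt_top, hh.meas.ae, ae_Ioi_pos] with s hs hm h0 α hα
  exact integrable_monomial_mul (by linarith) hα hm hs

theorem memWeighted (hK : 0 ≤ K) (hh : IsSource K γ h) :
    ∀ᵐ s ∂volume.restrict (Ioi (0 : ℝ)), MemWeighted K (h s) := by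
  filter_upwards [hh.ae_wnorm_lt_top, hh.meas.ae, ae_Ioi_pos] with s hs hm h0
  exact ⟨hm, (weightedNorm_le_wnorm (T := s + 1) (by linarith) hK le_rfl _).trans_lt
    (ENNReal.mul_lt_top ENNReal.ofReal_lt_top hs)⟩

theorem mono {γ' : ℝ} (hh : IsSource K γ h) (hγ : γ' ≤ γ) : IsSource K γ' h := by
  obtain ⟨C, hC0, hC⟩ := hh.bound
  refine ⟨hh.meas, C, hC0, ?_⟩
  filter_upwards [hC, ae_Ioi_pos] with s hs h0
  refine hs.trans (ENNReal.ofReal_le_ofReal ?_)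
  gcongr
  linarith

theorem sub {h' : ℝ → Space N → ℝ} (hh : IsSource K γ h) (hh' : IsSource K γ h') :
    IsSource K γ fun s x => h s x - h' s x := by
  obtain ⟨C, hC0, hC⟩ := hh.bound
  obtain ⟨C', hC0', hC'⟩ := hh'.bound
  refine ⟨hh.meas.sub hh'.meas, C + C', by positivity, ?_⟩
  filter_upwards [hC, hC', hh.meas.ae, hh'.meas.ae, ae_Ioi_pos] with s hs hs' hm hm' h0
  refine (xnorm_sub_le hm hm').trans ?_
  rw [add_mul, ENNReal.ofReal_add (by positivity) (by positivity)]
  exact add_le_add hs hs'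

theorem momentProj (hK : 0 ≤ K) (hh : IsSource K γ h) :
    IsSource K γ fun s => HeatExpansion.momentProj K s (h s) := by
  obtain ⟨C, hC0, hC⟩ := hh.bound
  obtain ⟨D, hD, hP⟩ := exists_xnorm_momentProj_le N hK
  refine ⟨hh.meas.momentProj K, D * C, by positivity, ?_⟩
  filter_upwards [hC, hh.meas.ae, ae_Ioi_pos] with s hs hm h0
  refine (hP s (by linarith) _ hm).trans ?_
  rw [mul_assoc, ENNReal.ofReal_mul hD.le]
  gcongr

theorem ae_vanishingMoments (hK : 0 ≤ K) (hh : IsSource K γ h) :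
    ∀ᵐ s ∂volume.restrict (Ioi (0 : ℝ)),
      VanishingMoments K (HeatExpansion.momentProj K s (h s)) := by
  filter_upwards [hh.ae_integrable_monomial, ae_Ioi_pos] with s hs h0 α hα
  exact integral_monomial_mul_momentProj hK (by linarith) hα (hs α hα)

theorem exists_ae_abs_moment_le (hh : IsSource K γ h) {α : MultiIndex N}
    (hα : (order α : ℝ) ≤ K) :
    ∃ C : ℝ, 0 ≤ C ∧ ∀ᵐ s ∂volume.restrict (Ioi (0 : ℝ)),
      |moment α (h s) s| ≤ C * (s + 1) ^ ((order α : ℝ) / 2 - γ - 1) := by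
  obtain ⟨C, hC0, hC⟩ := hh.bound
  obtain ⟨D, hD, hM⟩ := exists_enorm_moment_le α hα
  refine ⟨D * C, by positivity, ?_⟩
  filter_upwards [hC, ae_Ioi_pos] with s hs h0
  have h1 : 0 < s + 1 := by linarith
  have h2 := (hM s h1 (h s)).trans (mul_le_mul_right ((wnorm_le_xnorm _ _ _).trans hs) _)
  rw [← ENNReal.ofReal_mul (by positivity), Real.enorm_eq_ofReal_abs,
    ENNReal.ofReal_le_ofReal_iff (by positivity)] at h2
  refine h2.trans_eq ?_
  rw [Real.sqrt_eq_rpow, ← Real.rpow_natCast, ← Real.rpow_mul h1.le, mul_mul_mul_comm,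
    ← Real.rpow_add h1]
  congr 2
  ring

theorem integrableOn_Ioc_moment (hh : IsSource K γ h) {α : MultiIndex N}
    (hα : (order α : ℝ) ≤ K) (t : ℝ) :
    IntegrableOn (fun s => moment α (h s) s) (Ioc 0 t) := by
  obtain ⟨C, hC0, hC⟩ := hh.exists_ae_abs_moment_le hα
  have hcont : IntegrableOn (fun s : ℝ => C * (s + 1) ^ ((order α : ℝ) / 2 - γ - 1)) (Ioc 0 t) := by
    have : ContinuousOn (fun s : ℝ => C * (s + 1) ^ ((order α : ℝ) / 2 - γ - 1)) (Icc 0 t) := by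
      refine continuousOn_const.mul (ContinuousOn.rpow_const (by fun_prop) fun s hs => Or.inl ?_)
      linarith [hs.1]
    exact (this.integrableOn_compact isCompact_Icc).mono_set Ioc_subset_Icc_self
  exact hcont.mono' ((hh.meas.moment α).mono_set Ioc_subset_Ioi_self) (ae_Ioc_of_ae_Ioi hC)

theorem intervalIntegrable_moment (hh : IsSource K γ h) {α : MultiIndex N}
    (hα : (order α : ℝ) ≤ K) {t : ℝ} (ht : 0 ≤ t) :
    IntervalIntegrable (fun s => moment α (h s) s) volume 0 t :=
  (intervalIntegrable_iff_integrableOn_Ioc_of_le ht).2 (hh.integrableOn_Ioc_moment hα t)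

theorem integrableOn_Ioi_moment (hh : IsSource K γ h) {α : MultiIndex N}
    (hα : (order α : ℝ) ≤ K) (hγ : (order α : ℝ) / 2 < γ) :
    IntegrableOn (fun s => moment α (h s) s) (Ioi 0) := by
  obtain ⟨C, hC0, hC⟩ := hh.exists_ae_abs_moment_le hα
  exact ((integrableOn_add_rpow_Ioi_of_lt (by linarith) (by norm_num)).const_mul C).mono'
    (hh.meas.moment α) hC

theorem exists_ae_eLpNorm_top_le (hγ : 0 ≤ γ) (hh : IsSource K γ h) :
    ∃ C : ℝ, 0 ≤ C ∧ ∀ᵐ s ∂volume.restrict (Ioi (0 : ℝ)),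
      eLpNorm (h s) ⊤ volume ≤ ENNReal.ofReal C := by
  obtain ⟨C, hC0, hC⟩ := hh.bound
  refine ⟨C, hC0, ?_⟩
  filter_upwards [hC, ae_Ioi_pos] with s hs h0
  have h1 : eLpNorm (h s) ⊤ volume ≤ xnorm K (s + 1) (h s) := by
    refine le_trans ?_ le_add_self
    refine le_mul_of_one_le_left zero_le ?_
    rw [ENNReal.one_le_ofReal]
    exact one_le_pow₀ (by rw [Real.one_le_sqrt]; linarith)
  refine (h1.trans hs).trans (ENNReal.ofReal_le_ofReal (mul_le_of_le_one_right hC0 ?_))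
  exact Real.rpow_le_one_of_one_le_of_nonpos (by linarith) (by linarith)

/-- The heat kernel has mass one at every positive time, so the sup bound on `h s`, uniform in `s`,
suffices; there is no singularity at `s = t`. -/
theorem duhamelIntegrable (hγ : 0 ≤ γ) (hh : IsSource K γ h) (t : ℝ) (x : Space N) :
    DuhamelIntegrable h t x := by
  obtain ⟨C, hC0, hC⟩ := hh.exists_ae_eLpNorm_top_le hγ
  have hm : AEStronglyMeasurable
      (fun z : ℝ × Space N => heatKernel (t - z.1) (x - z.2) * h z.1 z.2)
      ((volume.restrict (Ioc 0 t)).prod volume) := by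
    refine (measurable_uncurry_heatKernel.comp (g := fun z : ℝ × Space N => heatKernel z.1 z.2)
      (f := fun z : ℝ × Space N => (t - z.1, x - z.2)) (by fun_prop)).aestronglyMeasurable.mul ?_
    exact hh.meas.mono_ac (Measure.AbsolutelyContinuous.prod
      (Measure.restrict_mono_set _ Ioc_subset_Ioi_self).absolutelyContinuous
      Measure.AbsolutelyContinuous.rfl)
  refine ⟨hm, ?_⟩
  rw [hasFiniteIntegral_iff_enorm, lintegral_prod _ hm.enorm]
  refine lt_of_le_of_lt (lintegral_mono_ae (g := fun _ => ENNReal.ofReal C) ?_) ?_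
  · filter_upwards [ae_Ioc_of_ae_Ioi hC, ae_Ioc_lt t] with s hs hst
    have hτ : 0 < t - s := by linarith [hst.2]
    have hk : Measurable fun y => ENNReal.ofReal (heatKernel (t - s) (x - y)) :=
      ENNReal.measurable_ofReal.comp ((continuous_heatKernel _).measurable.comp (by fun_prop))
    calc ∫⁻ y, ‖heatKernel (t - s) (x - y) * h s y‖ₑ
        ≤ ∫⁻ y, ENNReal.ofReal (heatKernel (t - s) (x - y)) * eLpNorm (h s) ⊤ volume := by
          refine lintegral_mono_ae ?_
          rw [eLpNorm_exponent_top]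
          filter_upwards [enorm_ae_le_eLpNormEssSup (h s) volume] with y hy
          rw [enorm_mul, Real.enorm_eq_ofReal (heatKernel_nonneg hτ.le _)]
          gcongr
      _ = eLpNorm (h s) ⊤ volume := by
          rw [lintegral_mul_const _ hk, lintegral_heatKernel hτ, one_mul]
      _ ≤ _ := hs
  · rw [lintegral_const]
    exact ENNReal.mul_lt_top ENNReal.ofReal_lt_top (by simp)

theorem integrable_prod (hγ : 0 < γ) (hh : IsSource K γ h) :
    Integrable (fun z : ℝ × Space N => h z.1 z.2)
      ((volume.restrict (Ioi 0)).prod volume) := by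
  obtain ⟨C, hC0, hC⟩ := hh.bound
  refine ⟨hh.meas, ?_⟩
  rw [hasFiniteIntegral_iff_enorm, lintegral_prod _ hh.meas.enorm]
  refine lt_of_le_of_lt (lintegral_mono_ae
    (g := fun s => ENNReal.ofReal (C * (s + 1) ^ (-γ - 1))) ?_) ?_
  · filter_upwards [hC] with s hs
    exact ((lintegral_le_wnorm K (s + 1) _).trans (wnorm_le_xnorm _ _ _)).trans hs
  · have := (integrableOn_add_rpow_Ioi_of_lt (a := -γ - 1) (m := 1) (c := 0)
      (by linarith) (by norm_num)).const_mul C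
    exact this.lintegral_lt_top

end IsSource

/-! ### Linearity of the flow and the Duhamel integral of a corrected source. -/

theorem integrable_heatKernel_mul {τ : ℝ} (hτ : 0 < τ) {f : Space N → ℝ} (hf : Integrable f)
    (x : Space N) : Integrable fun y => heatKernel τ (x - y) * f y := by
  refine hf.bdd_mul (c := (√τ)⁻¹ ^ N)
    ((continuous_heatKernel τ).comp (by fun_prop)).aestronglyMeasurable
    (Eventually.of_forall fun y => ?_)
  rw [Real.norm_of_nonneg (heatKernel_nonneg hτ.le _)]
  exact heatKernel_le_inv_sqrt hτ _

theorem heatFlow_sub {τ : ℝ} (hτ : 0 < τ) {f g : Space N → ℝ} (hf : Integrable f)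
    (hg : Integrable g) (x : Space N) :
    heatFlow τ (fun y => f y - g y) x = heatFlow τ f x - heatFlow τ g x := by
  unfold heatFlow
  simp_rw [mul_sub]
  exact integral_sub (integrable_heatKernel_mul hτ hf x) (integrable_heatKernel_mul hτ hg x)

theorem heatFlow_momentProj {K s τ : ℝ} (hs : 0 < s + 1) (hτ : 0 < τ) {f : Space N → ℝ}
    (hf : Integrable f) (x : Space N) :
    heatFlow τ (momentProj K s f) x =
      heatFlow τ f x - ∑ α ∈ indicesUpTo N K, moment α f s * gDeriv α (s + τ) x := by
  have hg : ∀ α ∈ indicesUpTo N K, Integrable fun x => moment α f s * gDeriv α s x :=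
    fun α _ => (integrable_gDeriv α hs).const_mul _
  unfold momentProj
  rw [heatFlow_sub hτ hf (integrable_finsetSum _ hg)]
  congr 1
  unfold heatFlow
  simp_rw [Finset.mul_sum]
  rw [integral_finsetSum _ fun α hα => integrable_heatKernel_mul hτ (hg α hα) x]
  refine Finset.sum_congr rfl fun α _ => ?_
  rw [← heatFlow_gDeriv α hs hτ x, heatFlow, ← integral_const_mul]
  congr 1
  ext y
  ring

namespace IsSource

variable {K γ : ℝ} {h : ℝ → Space N → ℝ}

theorem intervalIntegrable_heatFlow (hγ : 0 ≤ γ) (hh : IsSource K γ h) {t : ℝ} (ht : 0 ≤ t)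
    (x : Space N) : IntervalIntegrable (fun s => heatFlow (t - s) (h s) x) volume 0 t :=
  (intervalIntegrable_iff_integrableOn_Ioc_of_le ht).2
    (hh.duhamelIntegrable hγ t x).integral_prod_left

/-- The correction `M_α g_α(s)` at time `s` arrives at time `t` as `M_α g_α(t)`; the function no
longer depends on `s`, so only the coefficient is integrated. -/
theorem duhamel_momentProj (hK : 0 ≤ K) (hγ : 0 ≤ γ) (hh : IsSource K γ h) {t : ℝ} (ht : 0 < t)
    (x : Space N) :
    duhamel (fun s => HeatExpansion.momentProj K s (h s)) t x =
      duhamel h t x -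
        ∑ α ∈ indicesUpTo N K, (∫ s in (0 : ℝ)..t, moment α (h s) s) * gDeriv α t x := by
  have hint : ∀ α ∈ indicesUpTo N K,
      IntervalIntegrable (fun s => moment α (h s) s * gDeriv α t x) volume 0 t := fun α hα =>
    (hh.intervalIntegrable_moment ((mem_indicesUpTo hK α).1 hα) ht.le).mul_const _
  have hsum : IntervalIntegrable
      (fun s => ∑ α ∈ indicesUpTo N K, moment α (h s) s * gDeriv α t x) volume 0 t := by
    have := IntervalIntegrable.sum (indicesUpTo N K) hint
    exact this.congr fun s _ => by simp
  unfold duhamel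
  simp_rw [← intervalIntegral.integral_mul_const]
  rw [← intervalIntegral.integral_finsetSum hint,
    ← intervalIntegral.integral_sub (hh.intervalIntegrable_heatFlow hγ ht.le x) hsum,
    intervalIntegral.integral_of_le ht.le, intervalIntegral.integral_of_le ht.le]
  refine integral_congr_ae ?_
  filter_upwards [ae_Ioc_of_ae_Ioi hh.ae_integrable, ae_Ioc_lt t] with s hs hst
  rw [heatFlow_momentProj (by linarith [hst.1]) (by linarith [hst.2]) hs]
  simp

theorem duhamel_sub {h' : ℝ → Space N → ℝ} (hγ : 0 ≤ γ) (hh : IsSource K γ h)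
    (hh' : IsSource K γ h') {t : ℝ} (ht : 0 < t) (x : Space N) :
    duhamel (fun s x => h s x - h' s x) t x = duhamel h t x - duhamel h' t x := by
  unfold duhamel
  rw [← intervalIntegral.integral_sub (hh.intervalIntegrable_heatFlow hγ ht.le x)
    (hh'.intervalIntegrable_heatFlow hγ ht.le x), intervalIntegral.integral_of_le ht.le,
    intervalIntegral.integral_of_le ht.le]
  refine integral_congr_ae ?_
  filter_upwards [ae_Ioc_of_ae_Ioi hh.ae_integrable, ae_Ioc_of_ae_Ioi hh'.ae_integrable,
    ae_Ioc_lt t] with s hs hs' hst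
  exact heatFlow_sub (by linarith [hst.2]) hs hs' x

theorem integral_moment_sub {h' : ℝ → Space N → ℝ} (hh : IsSource K γ h)
    (hh' : IsSource K γ h') {α : MultiIndex N} (hα : (order α : ℝ) ≤ K) {t : ℝ} (ht : 0 ≤ t) :
    ∫ s in (0 : ℝ)..t, moment α (fun x => h s x - h' s x) s =
      (∫ s in (0 : ℝ)..t, moment α (h s) s) - ∫ s in (0 : ℝ)..t, moment α (h' s) s := by
  rw [← intervalIntegral.integral_sub (hh.intervalIntegrable_moment hα ht)
    (hh'.intervalIntegrable_moment hα ht), intervalIntegral.integral_of_le ht,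
    intervalIntegral.integral_of_le ht]
  refine integral_congr_ae ?_
  filter_upwards [ae_Ioc_of_ae_Ioi hh.ae_integrable_monomial,
    ae_Ioc_of_ae_Ioi hh'.ae_integrable_monomial] with s hs hs'
  exact moment_sub hα hs hs'

end IsSource

/-- Minkowski's inequality in `s`. The sup part of `BoundedBy` holds at every point and therefore
integrates for each fixed `x`; with essential suprema the exceptional null sets would depend on `s`.
-/
theorem BoundedBy.integral {K T t : ℝ} {H : ℝ → Space N → ℝ} {B : ℝ → ℝ≥0∞} (ht : 0 ≤ t)
    (hm : AEStronglyMeasurable (fun z : ℝ × Space N => H z.1 z.2)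
      ((volume.restrict (Ioc 0 t)).prod volume))
    (hB : ∀ᵐ s ∂volume.restrict (Ioc 0 t), BoundedBy K T (H s) (B s)) :
    BoundedBy K T (fun x => ∫ s in (0 : ℝ)..t, H s x) (∫⁻ s in Ioc 0 t, B s) := by
  simp_rw [intervalIntegral.integral_of_le ht]
  refine ⟨?_, fun x => ?_⟩
  · have hm' : AEMeasurable (fun z : Space N × ℝ => ‖H z.2 z.1‖ₑ *
        ENNReal.ofReal (weight K T z.1)) (volume.prod (volume.restrict (Ioc 0 t))) :=
      (hm.prod_swap.enorm).mul ((measurable_ofReal_weight K T).comp measurable_fst).aemeasurable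
    calc ∫⁻ x, ‖∫ s in Ioc 0 t, H s x‖ₑ * ENNReal.ofReal (weight K T x)
        ≤ ∫⁻ x, ∫⁻ s in Ioc 0 t, ‖H s x‖ₑ * ENNReal.ofReal (weight K T x) := by
          refine lintegral_mono fun x => ?_
          rw [lintegral_mul_const' _ _ ENNReal.ofReal_ne_top]
          gcongr
          exact enorm_integral_le_lintegral_enorm _
      _ = ∫⁻ s in Ioc 0 t, wnorm K T (H s) := lintegral_lintegral_swap hm'
      _ ≤ _ := lintegral_mono_ae (hB.mono fun s hs => hs.1)
  · refine (mul_le_mul_right (enorm_integral_le_lintegral_enorm _) _).trans ?_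
    rw [← lintegral_const_mul' _ _ ENNReal.ofReal_ne_top]
    exact lintegral_mono_ae (hB.mono fun s hs => hs.2 x)

theorem JointlyMeasurable.boundedBy_duhamel {K T t : ℝ} {h : ℝ → Space N → ℝ}
    (hh : JointlyMeasurable h) {B : ℝ → ℝ≥0∞} (ht : 0 ≤ t)
    (hB : ∀ᵐ s ∂volume.restrict (Ioc 0 t), BoundedBy K T (HeatExpansion.heatFlow (t - s) (h s)) (B s)) :
    BoundedBy K T (HeatExpansion.duhamel h t) (∫⁻ s in Ioc 0 t, B s) := by
  refine BoundedBy.integral ht ?_ hB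
  have hac : (volume.restrict (Ioc 0 t)).prod (volume : Measure (Space N)) ≪
      (volume.restrict (Ioi (0 : ℝ))).prod volume := Measure.AbsolutelyContinuous.prod
    (Measure.restrict_mono_set _ Ioc_subset_Ioi_self).absolutelyContinuous
    Measure.AbsolutelyContinuous.rfl
  refine AEStronglyMeasurable.mono_ac hac (hh.heatFlow (τ := fun z : ℝ × Space N => t - z.1)
    (by fun_prop) measurable_snd Measure.quasiMeasurePreserving_fst)


/-! ### Upper bounds of order `O` and `o` -/

/-- `Y = O(r)` as `t → ∞`, as an upper bound. -/
def Big (Y : ℝ → ℝ≥0∞) (r : ℝ → ℝ) : Prop :=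
  ∃ C : ℝ, 0 ≤ C ∧ ∀ᶠ t in atTop, Y t ≤ ENNReal.ofReal (C * r t)

/-- `Y = o(r)` as `t → ∞`, as an upper bound. -/
def Small (Y : ℝ → ℝ≥0∞) (r : ℝ → ℝ) : Prop :=
  ∀ ε : ℝ, 0 < ε → ∀ᶠ t in atTop, Y t ≤ ENNReal.ofReal (ε * r t)

/-- `Y = o(r₁) + O(r₂)` as `t → ∞`, as an upper bound. -/
def SmallAddBig (Y : ℝ → ℝ≥0∞) (r₁ r₂ : ℝ → ℝ) : Prop :=
  ∃ Y₁ Y₂ : ℝ → ℝ≥0∞, (∀ᶠ t in atTop, Y t ≤ Y₁ t + Y₂ t) ∧ Small Y₁ r₁ ∧ Big Y₂ r₂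

theorem Small.big {Y : ℝ → ℝ≥0∞} {r : ℝ → ℝ} (h : Small Y r) : Big Y r :=
  ⟨1, zero_le_one, h 1 one_pos⟩

theorem Big.add {Y₁ Y₂ : ℝ → ℝ≥0∞} {r : ℝ → ℝ} (h₁ : Big Y₁ r) (h₂ : Big Y₂ r) :
    Big (fun t => Y₁ t + Y₂ t) r := by
  obtain ⟨C₁, hC₁, h₁⟩ := h₁
  obtain ⟨C₂, hC₂, h₂⟩ := h₂
  refine ⟨C₁ + C₂, by positivity, ?_⟩
  filter_upwards [h₁, h₂] with t h₁ h₂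
  refine (add_le_add h₁ h₂).trans ?_
  rcases le_total 0 (r t) with h | h
  · rw [← ENNReal.ofReal_add (by positivity) (by positivity), add_mul]
  · rw [ENNReal.ofReal_of_nonpos (mul_nonpos_of_nonneg_of_nonpos hC₁ h),
      ENNReal.ofReal_of_nonpos (mul_nonpos_of_nonneg_of_nonpos hC₂ h), add_zero]
    exact zero_le

theorem Big.mono {Y Y' : ℝ → ℝ≥0∞} {r : ℝ → ℝ} (h : Big Y r) {c : ℝ} (hc : 0 ≤ c)
    (hY : ∀ᶠ t in atTop, Y' t ≤ ENNReal.ofReal c * Y t) : Big Y' r := by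
  obtain ⟨C, hC, h⟩ := h
  refine ⟨c * C, by positivity, ?_⟩
  filter_upwards [h, hY] with t h hY
  refine (hY.trans (mul_le_mul_right h _)).trans_eq ?_
  rw [← ENNReal.ofReal_mul hc, mul_assoc]

theorem Small.mono {Y Y' : ℝ → ℝ≥0∞} {r : ℝ → ℝ} (h : Small Y r) {c : ℝ} (hc : 0 < c)
    (hY : ∀ᶠ t in atTop, Y' t ≤ ENNReal.ofReal c * Y t) : Small Y' r := by
  intro ε hε
  filter_upwards [h (ε / c) (by positivity), hY] with t h hY
  refine (hY.trans (mul_le_mul_right h _)).trans_eq ?_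
  rw [← ENNReal.ofReal_mul hc.le]
  congr 1
  field_simp

theorem Big.rate {Y : ℝ → ℝ≥0∞} {r r' : ℝ → ℝ} (h : Big Y r)
    (hr : ∃ c : ℝ, 0 ≤ c ∧ ∀ᶠ t in atTop, r t ≤ c * r' t) : Big Y r' := by
  obtain ⟨C, hC, h⟩ := h
  obtain ⟨c, hc, hr⟩ := hr
  refine ⟨C * c, by positivity, ?_⟩
  filter_upwards [h, hr] with t h hr
  refine h.trans (ENNReal.ofReal_le_ofReal ?_)
  rw [mul_assoc]
  gcongr

theorem Small.add {Y₁ Y₂ : ℝ → ℝ≥0∞} {r : ℝ → ℝ} (h₁ : Small Y₁ r) (h₂ : Small Y₂ r) :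
    Small (fun t => Y₁ t + Y₂ t) r := by
  intro ε hε
  filter_upwards [h₁ (ε / 2) (by positivity), h₂ (ε / 2) (by positivity)] with t h₁ h₂
  refine (add_le_add h₁ h₂).trans ?_
  rcases le_total 0 (r t) with h | h
  · rw [← ENNReal.ofReal_add (by positivity) (by positivity), ← add_mul, add_halves]
  · rw [ENNReal.ofReal_of_nonpos (mul_nonpos_of_nonneg_of_nonpos (by positivity) h), add_zero]
    exact zero_le

theorem SmallAddBig.mono {Y Y' : ℝ → ℝ≥0∞} {r₁ r₂ : ℝ → ℝ} (h : SmallAddBig Y r₁ r₂) {c : ℝ}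
    (hc : 0 < c) (hY : ∀ᶠ t in atTop, Y' t ≤ ENNReal.ofReal c * Y t) :
    SmallAddBig Y' r₁ r₂ := by
  obtain ⟨Y₁, Y₂, hle, h₁, h₂⟩ := h
  refine ⟨fun t => ENNReal.ofReal c * Y₁ t, fun t => ENNReal.ofReal c * Y₂ t, ?_,
    h₁.mono hc (Eventually.of_forall fun t => le_rfl),
    h₂.mono hc.le (Eventually.of_forall fun t => le_rfl)⟩
  filter_upwards [hle, hY] with t hle hY
  rw [← mul_add]
  exact hY.trans (by gcongr)

theorem SmallAddBig.add_big {Y Y' : ℝ → ℝ≥0∞} {r₁ r₂ : ℝ → ℝ} (h : SmallAddBig Y r₁ r₂)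
    (h' : Big Y' r₂) : SmallAddBig (fun t => Y t + Y' t) r₁ r₂ := by
  obtain ⟨Y₁, Y₂, hle, h₁, h₂⟩ := h
  refine ⟨Y₁, fun t => Y₂ t + Y' t, ?_, h₁, h₂.add h'⟩
  filter_upwards [hle] with t hle
  rw [← add_assoc]
  gcongr

theorem Small.smallAddBig {Y : ℝ → ℝ≥0∞} {r : ℝ → ℝ} (h : Small Y r) (r' : ℝ → ℝ) :
    SmallAddBig Y r r' :=
  ⟨Y, fun _ => 0, Eventually.of_forall fun t => by simp, h,
    0, le_rfl, Eventually.of_forall fun t => by simp⟩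

theorem rpow_rate_log {a b : ℝ} (h : a ≤ b) :
    ∃ c : ℝ, 0 ≤ c ∧ ∀ᶠ t : ℝ in atTop, t ^ a ≤ c * (t ^ b * Real.log t) := by
  refine ⟨1, zero_le_one, ?_⟩
  filter_upwards [eventually_ge_atTop 1, eventually_ge_atTop (Real.exp 1)] with t ht ht'
  rw [one_mul]
  refine (Real.rpow_le_rpow_of_exponent_le ht h).trans (le_mul_of_one_le_right (by positivity) ?_)
  rwa [Real.le_log_iff_exp_le (by linarith)]

theorem Big.small {Y : ℝ → ℝ≥0∞} {a b : ℝ} (hab : a < b) (h : Big Y fun t => t ^ a) :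
    Small Y fun t => t ^ b := by
  obtain ⟨C, hC, h⟩ := h
  intro ε hε
  have h0 : Tendsto (fun t : ℝ => C * t ^ (-(b - a))) atTop (𝓝 (C * 0)) :=
    (tendsto_rpow_neg_atTop (sub_pos.2 hab)).const_mul C
  rw [mul_zero] at h0
  filter_upwards [h, h0.eventually_le_const hε, eventually_gt_atTop 0] with t h h0 ht
  refine h.trans (ENNReal.ofReal_le_ofReal ?_)
  calc C * t ^ a = C * t ^ (-(b - a)) * t ^ b := by
        rw [mul_assoc, ← Real.rpow_add ht]
        congr 2
        ring
    _ ≤ _ := by gcongr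

theorem Big.isBigOInf {Y : ℝ → ℝ≥0∞} {r : ℝ → ℝ} (h : Big Y r) : IsBigOInf Y r := by
  obtain ⟨C, hC, h⟩ := h
  refine ⟨fun t => (Y t).toReal, ?_, ?_⟩
  · refine IsBigO.of_bound C ?_
    filter_upwards [h] with t h
    rw [Real.norm_of_nonneg ENNReal.toReal_nonneg]
    refine (ENNReal.toReal_le_of_le_ofReal (b := C * |r t|) (by positivity) (h.trans ?_))
    exact ENNReal.ofReal_le_ofReal (by gcongr; exact le_abs_self _)
  · filter_upwards [h] with t h
    exact (ENNReal.ofReal_toReal (h.trans_lt ENNReal.ofReal_lt_top).ne).symm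

theorem Big.isBigOAddBigOInf_left {Y : ℝ → ℝ≥0∞} {r₁ : ℝ → ℝ} (h : Big Y r₁) (r₂ : ℝ → ℝ) :
    IsBigOAddBigOInf Y r₁ r₂ := by
  obtain ⟨f, hf, he⟩ := h.isBigOInf
  exact ⟨f, fun _ => 0, hf, isBigO_zero _ _, by simpa using he⟩

theorem Big.isBigOAddBigOInf_right {Y : ℝ → ℝ≥0∞} {r₂ : ℝ → ℝ} (h : Big Y r₂) (r₁ : ℝ → ℝ) :
    IsBigOAddBigOInf Y r₁ r₂ := by
  obtain ⟨f, hf, he⟩ := h.isBigOInf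
  exact ⟨fun _ => 0, f, isBigO_zero _ _, hf, by simpa using he⟩

theorem SmallAddBig.isLittleOAddBigOInf {Y : ℝ → ℝ≥0∞} {r₁ r₂ : ℝ → ℝ}
    (h : SmallAddBig Y r₁ r₂) : IsLittleOAddBigOInf Y r₁ r₂ := by
  obtain ⟨Y₁, Y₂, hle, h₁, C, hC, h₂⟩ := h
  have hfin : ∀ᶠ t in atTop, Y₁ t ≠ ⊤ ∧ Y₂ t ≠ ⊤ := by
    filter_upwards [h₁ 1 one_pos, h₂] with t h₁ h₂
    exact ⟨(h₁.trans_lt ENNReal.ofReal_lt_top).ne, (h₂.trans_lt ENNReal.ofReal_lt_top).ne⟩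
  -- The target asks for equality with a sum, not for a bound. The part of `Y` up to `Y₂` is
  -- `O(r₂)`, and the excess is at most `Y₁`.
  refine ⟨fun t => (Y t).toReal - min (Y t).toReal (Y₂ t).toReal,
    fun t => min (Y t).toReal (Y₂ t).toReal, ?_, ?_, ?_⟩
  · refine IsLittleO.of_bound fun ε hε => ?_
    filter_upwards [h₁ ε hε, hle, hfin] with t h₁ hle hfin
    have h3 : (Y t).toReal ≤ (Y₁ t).toReal + (Y₂ t).toReal := by
      rw [← ENNReal.toReal_add hfin.1 hfin.2]
      exact ENNReal.toReal_mono (ENNReal.add_ne_top.2 hfin) hle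
    have h4 : (Y₁ t).toReal ≤ ε * |r₁ t| := by
      refine ENNReal.toReal_le_of_le_ofReal (by positivity) (h₁.trans ?_)
      exact ENNReal.ofReal_le_ofReal (by gcongr; exact le_abs_self _)
    rw [Real.norm_of_nonneg (sub_nonneg.2 (min_le_left _ _)), Real.norm_eq_abs]
    have h5 : 0 ≤ (Y₁ t).toReal := ENNReal.toReal_nonneg
    rcases min_cases (Y t).toReal (Y₂ t).toReal with h | h <;> rw [h.1] <;> linarith
  · refine IsBigO.of_bound C ?_
    filter_upwards [h₂] with t h₂
    rw [Real.norm_of_nonneg (le_min ENNReal.toReal_nonneg ENNReal.toReal_nonneg), Real.norm_eq_abs]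
    refine (min_le_right _ _).trans (ENNReal.toReal_le_of_le_ofReal (by positivity) (h₂.trans ?_))
    exact ENNReal.ofReal_le_ofReal (by gcongr; exact le_abs_self _)
  · filter_upwards [hle, hfin] with t hle hfin
    rw [sub_add_cancel, ENNReal.ofReal_toReal]
    exact (hle.trans_lt (ENNReal.add_ne_top.2 hfin).lt_top).ne

/-! ### Integrals of powers -/

theorem intervalIntegral_add_one_rpow {a b β : ℝ} (ha : 0 ≤ a) (hab : a ≤ b) (hβ : β ≠ 0) :
    ∫ s in a..b, (s + 1) ^ (β - 1) = ((b + 1) ^ β - (a + 1) ^ β) / β := by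
  rw [intervalIntegral.integral_comp_add_right (fun s => s ^ (β - 1)), integral_rpow]
  · simp
  · refine Or.inr ⟨fun h => hβ (by linarith), ?_⟩
    rw [uIcc_of_le (by linarith)]
    intro h
    linarith [h.1]

theorem intervalIntegral_add_one_inv {b : ℝ} (hb : 0 ≤ b) :
    ∫ s in (0 : ℝ)..b, (s + 1) ^ ((0 : ℝ) - 1) = Real.log (b + 1) := by
  rw [intervalIntegral.integral_comp_add_right (fun s => s ^ ((0 : ℝ) - 1))]
  simp_rw [zero_sub, Real.rpow_neg_one]
  rw [integral_inv_of_pos (by norm_num) (by linarith)]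
  simp

theorem intervalIntegrable_add_one_rpow {a b : ℝ} (ha : 0 ≤ a) (hb : 0 ≤ b) (β : ℝ) :
    IntervalIntegrable (fun s : ℝ => (s + 1) ^ β) volume a b := by
  refine ContinuousOn.intervalIntegrable ?_
  refine ContinuousOn.rpow_const (by fun_prop) fun s hs => Or.inl ?_
  have : 0 ≤ s := (le_min ha hb).trans hs.1
  linarith

/-- The integral of `(s + 1) ^ (β - 1)` over `(0, t)`. -/
noncomputable def powInt (β t : ℝ) : ℝ := ∫ s in (0 : ℝ)..t, (s + 1) ^ (β - 1)

theorem powInt_nonneg (β : ℝ) {t : ℝ} (ht : 0 ≤ t) : 0 ≤ powInt β t :=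
  intervalIntegral.integral_nonneg ht fun s hs =>
    Real.rpow_nonneg (by linarith [hs.1]) _

theorem powInt_le_of_pos {β t : ℝ} (hβ : 0 < β) (ht : 0 ≤ t) : powInt β t ≤ β⁻¹ * (t + 1) ^ β := by
  rw [powInt, intervalIntegral_add_one_rpow le_rfl ht hβ.ne', div_eq_inv_mul]
  gcongr
  simp

theorem powInt_le_of_neg {β t : ℝ} (hβ : β < 0) (ht : 0 ≤ t) : powInt β t ≤ (-β)⁻¹ := by
  rw [powInt, intervalIntegral_add_one_rpow le_rfl ht hβ.ne]
  simp only [zero_add, Real.one_rpow]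
  rw [← neg_div_neg_eq, neg_sub, div_eq_inv_mul]
  have : 0 < (t + 1) ^ β := by positivity
  exact mul_le_of_le_one_right (inv_nonneg.2 (by linarith)) (by linarith)

theorem powInt_zero {t : ℝ} (ht : 0 ≤ t) : powInt 0 t = Real.log (t + 1) :=
  intervalIntegral_add_one_inv ht

theorem lintegral_Ioc_add_one_rpow {c : ℝ} (hc : 0 ≤ c) (β : ℝ) {t : ℝ} (ht : 0 ≤ t) :
    ∫⁻ s in Ioc 0 t, ENNReal.ofReal (c * (s + 1) ^ (β - 1)) =
      ENNReal.ofReal (c * powInt β t) := by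
  rw [powInt, ← intervalIntegral.integral_const_mul, intervalIntegral.integral_of_le ht,
    ofReal_integral_eq_lintegral_ofReal]
  · exact ((intervalIntegrable_iff_integrableOn_Ioc_of_le ht).1
      (intervalIntegrable_add_one_rpow le_rfl ht _)).const_mul c
  · refine (ae_restrict_mem measurableSet_Ioc).mono fun s hs => ?_
    exact mul_nonneg hc (Real.rpow_nonneg (by linarith [hs.1]) _)

theorem abs_intervalIntegral_le {m : ℝ → ℝ} {C β : ℝ}
    (h : ∀ᵐ s ∂volume.restrict (Ioi (0 : ℝ)), |m s| ≤ C * (s + 1) ^ (β - 1)) {a b : ℝ}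
    (ha : 0 ≤ a) (hab : a ≤ b) :
    |∫ s in a..b, m s| ≤ C * ∫ s in a..b, (s + 1) ^ (β - 1) := by
  rw [← intervalIntegral.integral_const_mul, ← Real.norm_eq_abs]
  refine intervalIntegral.norm_integral_le_of_norm_le hab ?_
    ((intervalIntegrable_add_one_rpow ha (ha.trans hab) _).const_mul C)
  rw [ae_restrict_iff' measurableSet_Ioi] at h
  exact h.mono fun s hs hs' => hs (ha.trans_lt hs'.1)

theorem abs_intervalIntegral_sub_integral_Ioi_le {m : ℝ → ℝ} {C β : ℝ} (hC : 0 ≤ C) (hβ : β < 0)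
    (hm : IntegrableOn m (Ioi 0))
    (h : ∀ᵐ s ∂volume.restrict (Ioi (0 : ℝ)), |m s| ≤ C * (s + 1) ^ (β - 1)) {t : ℝ}
    (ht : 0 ≤ t) :
    |(∫ s in (0 : ℝ)..t, m s) - ∫ s in Ioi 0, m s| ≤ C * (-β)⁻¹ * (t + 1) ^ β := by
  have h1 : Tendsto (fun b => ∫ s in (0 : ℝ)..b, m s) atTop (𝓝 (∫ s in Ioi 0, m s)) :=
    intervalIntegral_tendsto_integral_Ioi 0 hm tendsto_id
  have h2 : Tendsto (fun b => |(∫ s in (0 : ℝ)..t, m s) - ∫ s in (0 : ℝ)..b, m s|) atTop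
      (𝓝 |(∫ s in (0 : ℝ)..t, m s) - ∫ s in Ioi 0, m s|) := (h1.const_sub _).abs
  refine le_of_tendsto h2 ?_
  filter_upwards [eventually_ge_atTop t] with b hb
  have hint : ∀ c : ℝ, 0 ≤ c → IntervalIntegrable m volume 0 c := fun c hc =>
    (intervalIntegrable_iff_integrableOn_Ioc_of_le hc).2 (hm.mono_set Ioc_subset_Ioi_self)
  rw [abs_sub_comm, intervalIntegral.integral_interval_sub_left (hint b (ht.trans hb)) (hint t ht)]
  refine (abs_intervalIntegral_le h ht hb).trans ?_
  rw [intervalIntegral_add_one_rpow ht hb hβ.ne, mul_assoc]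
  gcongr
  rw [← neg_div_neg_eq, neg_sub, div_eq_inv_mul]
  have : 0 < (b + 1) ^ β := Real.rpow_pos_of_pos (by linarith) _
  exact mul_le_mul_of_nonneg_left (by linarith) (inv_nonneg.2 (by linarith))

theorem add_one_rpow_le {t a : ℝ} (ht : 0 < t) (ha : 0 ≤ a) : (t + 1) ^ (-a) ≤ t ^ (-a) :=
  Real.rpow_le_rpow_of_nonpos ht (by linarith) (by linarith)

theorem log_add_one_le {t : ℝ} (ht : 2 ≤ t) : Real.log (t + 1) ≤ 2 * Real.log t := by
  rw [← Real.log_rpow (by linarith)]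
  refine Real.log_le_log (by linarith) ?_
  norm_cast
  nlinarith

/-! ### Decay of the Duhamel integral -/

theorem aestronglyMeasurable_heatFlow (t : ℝ) {f : Space N → ℝ} (hf : AEStronglyMeasurable f) :
    AEStronglyMeasurable (heatFlow t f) volume := by
  have h : AEStronglyMeasurable (fun z : Space N × Space N => heatKernel t (z.1 - z.2) * f z.2)
      (volume.prod volume) :=
    ((continuous_heatKernel t).comp (by fun_prop)).aestronglyMeasurable.mul hf.comp_snd
  exact h.integral_prod_right'

/-- The uniform decay `O((1 + t) ^ (-σ))` of `w(t)` in the scale-invariant norm. -/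
def Decay (K σ : ℝ) (w : ℝ → Space N → ℝ) : Prop :=
  ∃ C : ℝ, 0 ≤ C ∧ ∀ t : ℝ, 0 < t → xnorm K (t + 1) (w t) ≤ ENNReal.ofReal (C * (t + 1) ^ (-σ))

theorem Decay.big {K σ : ℝ} (hσ : 0 ≤ σ) {w : ℝ → Space N → ℝ} (h : Decay K σ w) :
    Big (fun t => xnorm K (t + 1) (w t)) fun t => t ^ (-σ) := by
  obtain ⟨C, hC, h⟩ := h
  refine ⟨C, hC, ?_⟩
  filter_upwards [eventually_gt_atTop 0] with t ht
  refine (h t ht).trans (ENNReal.ofReal_le_ofReal ?_)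
  exact mul_le_mul_of_nonneg_left (add_one_rpow_le ht hσ) hC

theorem Decay.mono {K σ σ' : ℝ} (hσ : σ' ≤ σ) {w : ℝ → Space N → ℝ} (h : Decay K σ w) :
    Decay K σ' w := by
  obtain ⟨C, hC, h⟩ := h
  refine ⟨C, hC, fun t ht => (h t ht).trans (ENNReal.ofReal_le_ofReal ?_)⟩
  gcongr
  linarith

theorem Decay.add {K σ : ℝ} {w₁ w₂ : ℝ → Space N → ℝ} (h₁ : Decay K σ w₁) (h₂ : Decay K σ w₂)
    (hm₁ : ∀ t > 0, AEStronglyMeasurable (w₁ t)) (hm₂ : ∀ t > 0, AEStronglyMeasurable (w₂ t)) :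
    Decay K σ fun t x => w₁ t x + w₂ t x := by
  obtain ⟨C₁, hC₁, h₁⟩ := h₁
  obtain ⟨C₂, hC₂, h₂⟩ := h₂
  refine ⟨C₁ + C₂, by positivity, fun t ht => ?_⟩
  refine (xnorm_add_le (hm₁ t ht) (hm₂ t ht)).trans ((add_le_add (h₁ t ht) (h₂ t ht)).trans ?_)
  rw [← ENNReal.ofReal_add (by positivity) (by positivity), ← add_mul]

theorem Decay.congr {K σ : ℝ} {w₁ w₂ : ℝ → Space N → ℝ} (h₁ : Decay K σ w₁)
    (h : ∀ t > 0, ∀ x, w₁ t x = w₂ t x) : Decay K σ w₂ := by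
  obtain ⟨C, hC, h₁⟩ := h₁
  refine ⟨C, hC, fun t ht => ?_⟩
  rw [← show w₁ t = w₂ t from funext (h t ht)]
  exact h₁ t ht

/-- The time integral grows like `(t+1)^β` for `β > 0` and stays bounded for `β < 0`. The case `β =
0`, with its logarithm, is excluded from `Decay` and treated where it occurs. -/
theorem Decay.of_powInt {K a β : ℝ} {w : ℝ → Space N → ℝ}
    (h : ∃ C : ℝ, 0 ≤ C ∧ ∀ t : ℝ, 0 < t →
      xnorm K (t + 1) (w t) ≤ ENNReal.ofReal (C * ((t + 1) ^ (-a) * powInt β t))) :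
    (0 < β → Decay K (a - β) w) ∧ (β < 0 → Decay K a w) := by
  obtain ⟨C, hC, h⟩ := h
  refine ⟨fun hβ => ⟨C * β⁻¹, by positivity, fun t ht => (h t ht).trans
    (ENNReal.ofReal_le_ofReal ?_)⟩, fun hβ => ⟨C * (-β)⁻¹,
    mul_nonneg hC (inv_nonneg.2 (by linarith)), fun t ht => (h t ht).trans
    (ENNReal.ofReal_le_ofReal ?_)⟩⟩
  · calc C * ((t + 1) ^ (-a) * powInt β t)
        ≤ C * ((t + 1) ^ (-a) * (β⁻¹ * (t + 1) ^ β)) := by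
          gcongr
          exact powInt_le_of_pos hβ ht.le
      _ = C * β⁻¹ * ((t + 1) ^ (-a) * (t + 1) ^ β) := by ring
      _ = _ := by
        rw [← Real.rpow_add (by linarith)]
        congr 2
        ring
  · calc C * ((t + 1) ^ (-a) * powInt β t) ≤ C * ((t + 1) ^ (-a) * (-β)⁻¹) := by
          gcongr
          exact powInt_le_of_neg hβ ht.le
      _ = _ := by ring

theorem two_mul_ofReal (z : ℝ) : 2 * ENNReal.ofReal z = ENNReal.ofReal (2 * z) := by
  rw [ENNReal.ofReal_mul (by norm_num)]
  simp

theorem IsSource.decay_duhamel {K γ : ℝ} (hK : 0 ≤ K) (hγ : 0 < γ) {h : ℝ → Space N → ℝ}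
    (hh : IsSource K γ h) : Decay K 0 (duhamel h) := by
  obtain ⟨C, hC0, hC⟩ := hh.bound
  obtain ⟨D, hD, hb⟩ := exists_boundedBy_heatFlow N hK
  have : ∃ C : ℝ, 0 ≤ C ∧ ∀ t : ℝ, 0 < t →
      xnorm K (t + 1) (duhamel h t) ≤
        ENNReal.ofReal (C * ((t + 1) ^ (-(0 : ℝ)) * powInt (-γ) t)) := by
    refine ⟨2 * (D * C), by positivity, fun t ht => ?_⟩
    have hB : ∀ᵐ s ∂volume.restrict (Ioc 0 t), BoundedBy K (t + 1) (heatFlow (t - s) (h s))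
        (ENNReal.ofReal (D * C * (s + 1) ^ (-γ - 1))) := by
      filter_upwards [ae_Ioc_of_ae_Ioi hC, ae_Ioc_of_ae_Ioi hh.meas.ae, ae_Ioc_lt t]
        with s hs hm hst
      have := hb (s + 1) (t + 1) (by linarith [hst.1]) (by linarith [hst.2]) (h s) hm
      rw [show t + 1 - (s + 1) = t - s by ring] at this
      refine this.mono ((mul_le_mul_right hs _).trans_eq ?_)
      rw [← ENNReal.ofReal_mul hD.le, mul_assoc]
    have h1 := (hh.meas.boundedBy_duhamel ht.le hB).xnorm_le
    rw [lintegral_Ioc_add_one_rpow (by positivity) _ ht.le] at h1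
    refine h1.trans_eq ?_
    rw [two_mul_ofReal, neg_zero, Real.rpow_zero]
    congr 1
    ring
  exact (Decay.of_powInt this).2 (by linarith)

/-- The cancellation factor `((s+1)/(t+1))^(K/2)` against the size `(s+1)^(-γ-1)` of the source: all
three regimes of the theorem are contained in this one time integral. -/
theorem IsSource.exists_xnorm_duhamel_momentProj_le {K γ : ℝ} (hK : 0 ≤ K)
    {h : ℝ → Space N → ℝ} (hh : IsSource K γ h) :
    ∃ C : ℝ, 0 ≤ C ∧ ∀ t : ℝ, 0 < t →
      xnorm K (t + 1) (duhamel (fun s => HeatExpansion.momentProj K s (h s)) t) ≤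
        ENNReal.ofReal (C * ((t + 1) ^ (-(K / 2)) * powInt (K / 2 - γ) t)) := by
  obtain ⟨C, hC0, hC⟩ := (hh.momentProj hK).bound
  obtain ⟨D, hD, hb⟩ := exists_boundedBy_heatFlow_of_vanishingMoments N hK
  refine ⟨2 * (D * C), by positivity, fun t ht => ?_⟩
  have ht1 : 0 < t + 1 := by linarith
  have hB : ∀ᵐ s ∂volume.restrict (Ioc 0 t),
      BoundedBy K (t + 1) (heatFlow (t - s) (HeatExpansion.momentProj K s (h s)))
      (ENNReal.ofReal (D * C * (t + 1) ^ (-(K / 2)) * (s + 1) ^ (K / 2 - γ - 1))) := by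
    filter_upwards [ae_Ioc_of_ae_Ioi hC, ae_Ioc_of_ae_Ioi (hh.momentProj hK).meas.ae,
      ae_Ioc_of_ae_Ioi (hh.momentProj hK).ae_wnorm_lt_top,
      ae_Ioc_of_ae_Ioi (hh.ae_vanishingMoments hK), ae_Ioc_lt t] with s hs hm hfin hv hst
    have hs1 : 0 < s + 1 := by linarith [hst.1]
    have := hb (s + 1) (t + 1) hs1 (by linarith [hst.2]) _ hm hfin hv
    rw [show t + 1 - (s + 1) = t - s by ring] at this
    refine this.mono ((mul_le_mul_right hs _).trans_eq ?_)
    rw [← ENNReal.ofReal_mul (by positivity)]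
    congr 1
    rw [Real.div_rpow hs1.le ht1.le, Real.rpow_neg ht1.le,
      show K / 2 - γ - 1 = K / 2 + (-γ - 1) by ring, Real.rpow_add hs1]
    ring
  have h1 := ((hh.momentProj hK).meas.boundedBy_duhamel ht.le hB).xnorm_le
  rw [lintegral_Ioc_add_one_rpow (by positivity) _ ht.le] at h1
  refine h1.trans_eq ?_
  rw [two_mul_ofReal]
  congr 1
  ring

/-- Dominated convergence: `√(t+1)^K` times the gain at `n/√(t+1)` is at most `n^K`, and it tends to
zero pointwise because the gain is also at most the power `⌊K⌋ + 1 > K`. The abstract measure serves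
both the initial data (on space) and sources (on space-time). -/
theorem small_lintegral_gain {Z : Type*} [MeasurableSpace Z] {ρ : Measure Z} {K : ℝ} (hK : 0 ≤ K)
    {F : Z → ℝ≥0∞} (hF : AEMeasurable F ρ) (hFt : ∀ z, F z ≠ ⊤) {n : Z → ℝ} (hn : Measurable n)
    (hn0 : ∀ z, 0 ≤ n z) (hfin : ∫⁻ z, ENNReal.ofReal (n z ^ K) * F z ∂ρ ≠ ⊤) :
    Small (fun t => ∫⁻ z, ENNReal.ofReal (gain K (n z / √(t + 1))) * F z ∂ρ)
      fun t => t ^ (-K / 2) := by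
  have hsq : Tendsto (fun t : ℝ => √(t + 1)) atTop atTop :=
    Real.tendsto_sqrt_atTop.comp (tendsto_atTop_add_const_right _ 1 tendsto_id)
  have hlim : Tendsto (fun t : ℝ =>
      ∫⁻ z, ENNReal.ofReal (√(t + 1) ^ K * gain K (n z / √(t + 1))) * F z ∂ρ) atTop
      (𝓝 (∫⁻ _, 0 ∂ρ)) := by
    refine tendsto_lintegral_filter_of_dominated_convergence'
      (fun z => ENNReal.ofReal (n z ^ K) * F z) ?_ ?_ hfin ?_
    · refine Eventually.of_forall fun t => ?_
      have := (measurable_gain K).comp (hn.div_const √(t + 1))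
      exact (ENNReal.measurable_ofReal.comp (this.const_mul _)).aemeasurable.mul hF
    · filter_upwards [eventually_gt_atTop 0] with t ht
      refine Eventually.of_forall fun z => ?_
      gcongr
      have hs : 0 < √(t + 1) := Real.sqrt_pos.2 (by linarith)
      calc √(t + 1) ^ K * gain K (n z / √(t + 1)) ≤ √(t + 1) ^ K * (n z / √(t + 1)) ^ K := by
            gcongr
            exact gain_le _ _
        _ = n z ^ K := by
            rw [Real.div_rpow (hn0 z) hs.le]
            field_simp
    · refine Eventually.of_forall fun z => ?_
      have h1 : Tendsto (fun t : ℝ => n z ^ (⌊K⌋₊ + 1) * √(t + 1) ^ (-((⌊K⌋₊ : ℝ) + 1 - K))) atTop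
          (𝓝 (n z ^ (⌊K⌋₊ + 1) * 0)) :=
        ((tendsto_rpow_neg_atTop (by linarith [Nat.lt_floor_add_one K])).comp hsq).const_mul _
      rw [mul_zero] at h1
      have h2 : Tendsto (fun t : ℝ => √(t + 1) ^ K * gain K (n z / √(t + 1))) atTop (𝓝 0) := by
        refine squeeze_zero' (Eventually.of_forall fun t => mul_nonneg (by positivity)
          (gain_nonneg K (div_nonneg (hn0 z) (Real.sqrt_nonneg _)))) ?_ h1
        filter_upwards [eventually_gt_atTop 0] with t ht
        have hs : 0 < √(t + 1) := Real.sqrt_pos.2 (by linarith)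
        calc √(t + 1) ^ K * gain K (n z / √(t + 1))
            ≤ √(t + 1) ^ K * (n z / √(t + 1)) ^ (⌊K⌋₊ + 1) := by
              gcongr
              exact min_le_right _ _
          _ = n z ^ (⌊K⌋₊ + 1) * (√(t + 1) ^ K / √(t + 1) ^ (⌊K⌋₊ + 1)) := by
              rw [div_pow]; ring
          _ = _ := by
              rw [← Real.rpow_natCast √(t + 1), ← Real.rpow_sub hs]
              push_cast
              congr 2
              ring
      have h3 := ENNReal.Tendsto.mul_const (b := F z) (ENNReal.tendsto_ofReal h2)
        (Or.inr (hFt z))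
      simpa using h3
  rw [lintegral_zero] at hlim
  intro ε hε
  filter_upwards [hlim.eventually_le_const (ENNReal.ofReal_pos.2 hε), eventually_gt_atTop 0]
    with t h1 ht
  have hs : 0 < √(t + 1) := Real.sqrt_pos.2 (by linarith)
  have h2 : ∫⁻ z, ENNReal.ofReal (gain K (n z / √(t + 1))) * F z ∂ρ =
      ENNReal.ofReal (√(t + 1) ^ (-K)) *
        ∫⁻ z, ENNReal.ofReal (√(t + 1) ^ K * gain K (n z / √(t + 1))) * F z ∂ρ := by
    rw [← lintegral_const_mul' _ _ ENNReal.ofReal_ne_top]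
    refine lintegral_congr fun z => ?_
    rw [← mul_assoc, ← ENNReal.ofReal_mul (by positivity), ← mul_assoc, ← Real.rpow_add hs]
    simp
  rw [h2]
  refine (mul_le_mul_right h1 _).trans ?_
  rw [← ENNReal.ofReal_mul (by positivity), mul_comm]
  refine ENNReal.ofReal_le_ofReal ?_
  refine mul_le_mul_of_nonneg_left ?_ hε.le
  rw [Real.sqrt_eq_rpow, ← Real.rpow_mul (by linarith), one_div_mul_eq_div, neg_div]
  exact add_one_rpow_le ht (by positivity)


/-! ### Flows of functions with vanishing moments -/

theorem lintegral_norm_rpow_mul_le {K S : ℝ} (hS : 0 < S) (h : Space N → ℝ) :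
    ∫⁻ y, ENNReal.ofReal (‖y‖ ^ K) * ‖h y‖ₑ ≤ ENNReal.ofReal (S ^ (K / 2)) * wnorm K S h := by
  unfold wnorm
  rw [← lintegral_const_mul' _ _ ENNReal.ofReal_ne_top]
  refine lintegral_mono fun y => ?_
  rw [mul_left_comm, mul_comm (ENNReal.ofReal _)]
  gcongr
  rw [← ENNReal.ofReal_mul (by positivity)]
  refine ENNReal.ofReal_le_ofReal ?_
  have hs : 0 < √S := Real.sqrt_pos.2 hS
  have e : S ^ (K / 2) = √S ^ K := by
    rw [Real.sqrt_eq_rpow, ← Real.rpow_mul hS.le]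
    congr 1
    ring
  rw [e, weight, mul_add, Real.div_rpow (norm_nonneg _) hs.le, mul_div_cancel₀ _ (by positivity)]
  have : 0 ≤ √S ^ K * 1 := by positivity
  linarith

theorem decay_heatFlow_of_vanishingMoments {K : ℝ} (hK : 0 ≤ K) {ψ : Space N → ℝ}
    (hψ : AEStronglyMeasurable ψ) (hfin : xnorm K 1 ψ < ⊤) (hv : VanishingMoments K ψ) :
    Decay K (K / 2) fun t => heatFlow t ψ := by
  obtain ⟨C, hC, hb⟩ := exists_boundedBy_heatFlow_of_vanishingMoments N hK
  refine ⟨2 * C * (xnorm K 1 ψ).toReal, by positivity, fun t ht => ?_⟩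
  have := (hb 1 (t + 1) one_pos (by linarith) ψ hψ
    ((wnorm_le_xnorm _ _ _).trans_lt hfin) hv).xnorm_le
  rw [add_sub_cancel_right] at this
  refine this.trans_eq ?_
  rw [← ENNReal.ofReal_toReal hfin.ne, ← ENNReal.ofReal_mul (by positivity), two_mul_ofReal]
  congr 1
  rw [ENNReal.ofReal_toReal hfin.ne, one_div, Real.inv_rpow (by linarith),
    Real.rpow_neg (by linarith)]
  ring

theorem small_heatFlow_of_vanishingMoments {K : ℝ} (hK : 0 ≤ K) {ψ : Space N → ℝ}
    (hψ : AEStronglyMeasurable ψ) (hfin : xnorm K 1 ψ < ⊤) (hv : VanishingMoments K ψ) :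
    Small (fun t => xnorm K (t + 1) (heatFlow t ψ)) fun t => t ^ (-K / 2) := by
  obtain ⟨C, hC, hb⟩ := exists_boundedBy_heatFlow_gain N hK
  have hw : wnorm K 1 ψ < ⊤ := (wnorm_le_xnorm _ _ _).trans_lt hfin
  refine (small_lintegral_gain hK hψ.enorm (fun _ => enorm_ne_top) measurable_norm
    (fun _ => norm_nonneg _) ?_).mono (c := 2 * C) (by positivity) ?_
  · exact ((lintegral_norm_rpow_mul_le one_pos ψ).trans_lt
      (ENNReal.mul_lt_top ENNReal.ofReal_lt_top hw)).ne
  · filter_upwards [eventually_ge_atTop 1] with t ht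
    have := (hb 1 (t + 1) one_pos (by linarith) (by linarith) ψ hψ hw hv).xnorm_le
    rw [add_sub_cancel_right, ← mul_assoc, two_mul_ofReal] at this
    exact this

/-- The time integral is split at `t/2`. On the early part the cancellation gives `o(t^(-K/2))`, and
`K/2 < γ` makes the dominating function integrable in space-time. On the late part plain boundedness
gives a time interval of length at most `t` times `(t+1)^(-γ-1)`. -/
theorem IsSource.smallAddBig_duhamel {K γ : ℝ} (hK : 0 ≤ K) (hγ : K / 2 < γ)
    {H : ℝ → Space N → ℝ} (hH : IsSource K γ H)
    (hv : ∀ᵐ s ∂volume.restrict (Ioi (0 : ℝ)), VanishingMoments K (H s)) :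
    SmallAddBig (fun t => xnorm K (t + 1) (duhamel H t)) (fun t => t ^ (-K / 2))
      fun t => t ^ (-γ) := by
  obtain ⟨C, hC0, hC⟩ := hH.bound
  obtain ⟨C₁, hC₁, h₁⟩ := exists_boundedBy_heatFlow_gain N hK
  obtain ⟨C₂, hC₂, h₂⟩ := exists_boundedBy_heatFlow N hK
  set ρ : Measure (ℝ × Space N) := (volume.restrict (Ioi (0 : ℝ))).prod volume
  have hsmall : Small (fun t => ∫⁻ z, ENNReal.ofReal (gain K (‖z.2‖ / √(t + 1))) *
      ‖H z.1 z.2‖ₑ ∂ρ) fun t => t ^ (-K / 2) := by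
    refine small_lintegral_gain hK hH.meas.enorm (fun _ => enorm_ne_top)
      (measurable_norm.comp measurable_snd) (fun _ => norm_nonneg _) (ne_of_lt ?_)
    have hm : AEMeasurable (fun z : ℝ × Space N => ENNReal.ofReal (‖z.2‖ ^ K) * ‖H z.1 z.2‖ₑ) ρ :=
      AEMeasurable.mul (by fun_prop) hH.meas.enorm
    rw [lintegral_prod _ hm]
    refine lt_of_le_of_lt (lintegral_mono_ae
      (g := fun s => ENNReal.ofReal (C * (s + 1) ^ (K / 2 - γ - 1))) ?_) ?_
    · filter_upwards [hC, ae_Ioi_pos] with s hs h0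
      have h1 : 0 < s + 1 := by linarith
      refine (lintegral_norm_rpow_mul_le h1 _).trans
        ((mul_le_mul_right ((wnorm_le_xnorm _ _ _).trans hs) _).trans_eq ?_)
      rw [← ENNReal.ofReal_mul (by positivity), mul_left_comm, ← Real.rpow_add h1]
      congr 3
      ring
    · exact ((integrableOn_add_rpow_Ioi_of_lt (a := K / 2 - γ - 1) (m := 1) (c := 0)
        (by linarith) (by norm_num)).const_mul C).lintegral_lt_top
  refine ⟨_, fun t => ENNReal.ofReal (2 * (C₂ * C * 2 ^ (γ + 1)) * t ^ (-γ)), ?_,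
    hsmall.mono (c := 2 * C₁) (by positivity) (Eventually.of_forall fun t => le_rfl),
    2 * (C₂ * C * 2 ^ (γ + 1)), by positivity, Eventually.of_forall fun t => le_rfl⟩
  filter_upwards [eventually_ge_atTop 1] with t ht
  have ht1 : 0 < t + 1 := by linarith
  have hB : ∀ᵐ s ∂volume.restrict (Ioc 0 t), BoundedBy K (t + 1) (heatFlow (t - s) (H s))
      ((ENNReal.ofReal C₁ * ∫⁻ y, ENNReal.ofReal (gain K (‖y‖ / √(t + 1))) * ‖H s y‖ₑ) +
        ENNReal.ofReal (C₂ * C * 2 ^ (γ + 1) * (t + 1) ^ (-γ - 1))) := by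
    filter_upwards [ae_Ioc_of_ae_Ioi hC, ae_Ioc_of_ae_Ioi hH.meas.ae,
      ae_Ioc_of_ae_Ioi hH.ae_wnorm_lt_top, ae_Ioc_of_ae_Ioi hv, ae_Ioc_lt t]
      with s hs hm hfin hv hst
    have hs1 : 0 < s + 1 := by linarith [hst.1]
    rcases le_total s (t / 2) with hcase | hcase
    -- For `t ≥ 1`, `s ≤ t/2` implies `s + 1 ≤ 3/4 * (t + 1)`, the range in which the gain estimate
    -- holds.
    · have := h₁ (s + 1) (t + 1) hs1 ht1 (by linarith) _ hm hfin hv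
      rw [show t + 1 - (s + 1) = t - s by ring] at this
      exact this.mono le_self_add
    · have := h₂ (s + 1) (t + 1) hs1 (by linarith [hst.2]) _ hm
      rw [show t + 1 - (s + 1) = t - s by ring] at this
      refine this.mono (le_trans ?_ le_add_self)
      refine (mul_le_mul_right hs _).trans ?_
      rw [← ENNReal.ofReal_mul hC₂.le]
      refine ENNReal.ofReal_le_ofReal ?_
      rw [mul_assoc, mul_assoc]
      refine mul_le_mul_of_nonneg_left (mul_le_mul_of_nonneg_left ?_ hC0) hC₂.le
      calc (s + 1) ^ (-γ - 1) ≤ ((t + 1) / 2) ^ (-γ - 1) :=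
            Real.rpow_le_rpow_of_nonpos (by positivity) (by linarith) (by linarith)
        _ = _ := by
            rw [Real.div_rpow ht1.le (by norm_num), show -γ - 1 = -(γ + 1) by ring,
              Real.rpow_neg zero_le_two, div_inv_eq_mul, mul_comm]
  have h3 := (hH.meas.boundedBy_duhamel (by linarith) hB).xnorm_le
  refine h3.trans ?_
  rw [lintegral_add_right _ measurable_const, lintegral_const_mul' _ _ ENNReal.ofReal_ne_top,
    mul_add, ← mul_assoc, two_mul_ofReal]
  gcongr
  · have hm : AEMeasurable (fun z : ℝ × Space N =>
        ENNReal.ofReal (gain K (‖z.2‖ / √(t + 1))) * ‖H z.1 z.2‖ₑ) ρ :=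
      AEMeasurable.mul (((measurable_gain K).comp (by fun_prop)).ennreal_ofReal.aemeasurable)
        hH.meas.enorm
    rw [lintegral_prod _ hm]
    exact lintegral_mono_set Ioc_subset_Ioi_self
  · rw [lintegral_const, Measure.restrict_apply MeasurableSet.univ, univ_inter, Real.volume_Ioc,
      ← ENNReal.ofReal_mul (by positivity), two_mul_ofReal]
    refine ENNReal.ofReal_le_ofReal ?_
    rw [mul_assoc (C₂ * C * 2 ^ (γ + 1)), mul_assoc 2]
    refine mul_le_mul_of_nonneg_left (mul_le_mul_of_nonneg_left ?_ (by positivity)) zero_le_two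
    calc (t + 1) ^ (-γ - 1) * (t - 0) ≤ (t + 1) ^ (-γ - 1) * (t + 1) := by gcongr; linarith
      _ = (t + 1) ^ (-γ) := by
          rw [← Real.rpow_add_one ht1.ne', sub_add_cancel]
      _ ≤ _ := add_one_rpow_le (by linarith) (by linarith)

/-- The remainder of a moment expansion: the flow of initial data and of a source, both corrected
to have vanishing moments. -/
noncomputable def remainder (K : ℝ) (φ : Space N → ℝ) (h : ℝ → Space N → ℝ) (t : ℝ)
    (x : Space N) : ℝ :=
  heatFlow t (momentProj K 0 φ) x + duhamel (fun s => momentProj K s (h s)) t x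

section Remainder

variable {K γ : ℝ} {φ : Space N → ℝ} {h : ℝ → Space N → ℝ}

theorem xnorm_one_momentProj_lt_top (hK : 0 ≤ K) (hφ : AEStronglyMeasurable φ)
    (hfin : xnorm K 1 φ < ⊤) : xnorm K 1 (momentProj K 0 φ) < ⊤ := by
  obtain ⟨D, hD, hP⟩ := exists_xnorm_momentProj_le N hK
  have := hP 0 (by norm_num) φ hφ
  rw [zero_add] at this
  exact this.trans_lt (ENNReal.mul_lt_top ENNReal.ofReal_lt_top hfin)

theorem vanishingMoments_momentProj (hK : 0 ≤ K) (hφ : AEStronglyMeasurable φ)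
    (hfin : xnorm K 1 φ < ⊤) : VanishingMoments K (momentProj K 0 φ) := fun _ hα =>
  integral_monomial_mul_momentProj hK (by norm_num) hα <|
    integrable_monomial_mul one_pos hα hφ ((wnorm_le_xnorm _ _ _).trans_lt hfin)

theorem IsSource.aestronglyMeasurable_duhamel_momentProj (hh : IsSource K γ h) {t : ℝ}
    (ht : 0 < t) :
    AEStronglyMeasurable (duhamel (fun s => HeatExpansion.momentProj K s (h s)) t) :=
  (hh.meas.momentProj K).duhamel_at ht.le

theorem IsSource.decay_remainder (hK : 0 ≤ K) (hφ : AEStronglyMeasurable φ)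
    (hfin : xnorm K 1 φ < ⊤) (hh : IsSource K γ h) :
    (γ < K / 2 → Decay K γ (remainder K φ h)) ∧
      (K / 2 < γ → Decay K (K / 2) (remainder K φ h)) := by
  have h1 := decay_heatFlow_of_vanishingMoments hK
    (aestronglyMeasurable_momentProj (by norm_num) hφ) (xnorm_one_momentProj_lt_top hK hφ hfin)
    (vanishingMoments_momentProj hK hφ hfin)
  have h2 := Decay.of_powInt (hh.exists_xnorm_duhamel_momentProj_le hK)
  have hm1 : ∀ t > 0, AEStronglyMeasurable (heatFlow t (HeatExpansion.momentProj K 0 φ)) :=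
    fun t _ => aestronglyMeasurable_heatFlow t (aestronglyMeasurable_momentProj (by norm_num) hφ)
  have hm2 : ∀ t > 0, AEStronglyMeasurable
      (duhamel (fun s => HeatExpansion.momentProj K s (h s)) t) :=
    fun t ht => hh.aestronglyMeasurable_duhamel_momentProj ht
  refine ⟨fun hγ => (h1.mono hγ.le).add ?_ hm1 hm2, fun hγ => h1.add (h2.2 (by linarith)) hm1 hm2⟩
  simpa using h2.1 (by linarith)

theorem IsSource.smallAddBig_remainder (hK : 0 ≤ K) (hφ : AEStronglyMeasurable φ)
    (hfin : xnorm K 1 φ < ⊤) (hγ0 : 0 ≤ γ) (hγ : γ ≠ K / 2) (hh : IsSource K γ h) :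
    SmallAddBig (fun t => xnorm K (t + 1) (remainder K φ h t)) (fun t => t ^ (-K / 2))
      fun t => t ^ (-γ) := by
  have h1 := small_heatFlow_of_vanishingMoments hK
    (aestronglyMeasurable_momentProj (by norm_num) hφ) (xnorm_one_momentProj_lt_top hK hφ hfin)
    (vanishingMoments_momentProj hK hφ hfin)
  have h2 : SmallAddBig (fun t => xnorm K (t + 1)
      (duhamel (fun s => HeatExpansion.momentProj K s (h s)) t)) (fun t => t ^ (-K / 2))
      fun t => t ^ (-γ) := by
    rcases hγ.lt_or_gt with hlt | hgt
    · have h3 := (Decay.of_powInt (hh.exists_xnorm_duhamel_momentProj_le hK)).1 (by linarith)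
      rw [sub_sub_cancel] at h3
      exact ⟨fun _ => 0, _, Eventually.of_forall fun t => (zero_add _).ge, fun ε hε => by simp,
        h3.big hγ0⟩
    · exact (hh.momentProj hK).smallAddBig_duhamel hK hgt (hh.ae_vanishingMoments hK)
  obtain ⟨Y₁, Y₂, hle, hs, hb⟩ := h2
  refine ⟨_, _, ?_, h1.add hs, hb⟩
  filter_upwards [hle, eventually_gt_atTop 0] with t hle ht
  refine (xnorm_add_le (aestronglyMeasurable_heatFlow t
    (aestronglyMeasurable_momentProj (by norm_num) hφ))
    (hh.aestronglyMeasurable_duhamel_momentProj ht)).trans ?_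
  rw [add_assoc]
  gcongr

theorem IsSource.big_remainder (hK : 0 ≤ K) (hφ : AEStronglyMeasurable φ)
    (hfin : xnorm K 1 φ < ⊤) (hγ : γ = K / 2) (hh : IsSource K γ h) :
    Big (fun t => xnorm K (t + 1) (remainder K φ h t)) fun t => t ^ (-K / 2) * Real.log t := by
  have h1 := ((small_heatFlow_of_vanishingMoments hK
    (aestronglyMeasurable_momentProj (by norm_num) hφ) (xnorm_one_momentProj_lt_top hK hφ hfin)
    (vanishingMoments_momentProj hK hφ hfin)).big).rate (rpow_rate_log le_rfl)
  obtain ⟨C, hC, h2⟩ := hh.exists_xnorm_duhamel_momentProj_le hK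
  have h3 : Big (fun t => xnorm K (t + 1)
      (duhamel (fun s => HeatExpansion.momentProj K s (h s)) t))
      fun t => t ^ (-K / 2) * Real.log t := by
    refine ⟨C * 2, by positivity, ?_⟩
    filter_upwards [eventually_ge_atTop 2] with t ht
    refine (h2 t (by linarith)).trans (ENNReal.ofReal_le_ofReal ?_)
    rw [hγ, sub_self, powInt_zero (by linarith), mul_assoc C 2]
    refine mul_le_mul_of_nonneg_left ?_ hC
    calc (t + 1) ^ (-(K / 2)) * Real.log (t + 1)
        ≤ t ^ (-(K / 2)) * (2 * Real.log t) := by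
          refine mul_le_mul (add_one_rpow_le (by linarith) (by positivity)) (log_add_one_le ht)
            (Real.log_nonneg (by linarith)) (Real.rpow_nonneg (by linarith) _)
      _ = _ := by rw [neg_div]; ring
  refine (h1.add h3).mono (c := 1) zero_le_one ?_
  filter_upwards [eventually_gt_atTop 0] with t ht
  rw [ENNReal.ofReal_one, one_mul]
  exact xnorm_add_le (aestronglyMeasurable_heatFlow t
    (aestronglyMeasurable_momentProj (by norm_num) hφ))
    (hh.aestronglyMeasurable_duhamel_momentProj ht)

end Remainder


/-! ### The nonlinear term -/

/-- Bernoulli's inequality applied to `y / x`. -/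
theorem rpow_sub_rpow_le {p x y : ℝ} (hp : 1 ≤ p) (hy : 0 ≤ y) (hyx : y ≤ x) :
    x ^ p - y ^ p ≤ p * x ^ (p - 1) * (x - y) := by
  rcases (hy.trans hyx).eq_or_lt with rfl | hx
  · rw [show y = 0 by linarith]
    simp
  have h := one_add_mul_self_le_rpow_one_add (s := (y - x) / x)
    (by rw [le_div_iff₀ hx]; linarith) hp
  have e : 1 + (y - x) / x = y / x := by field_simp; ring
  rw [e, Real.div_rpow hy hx.le, le_div_iff₀ (by positivity)] at h
  have e2 : (1 + p * ((y - x) / x)) * x ^ p = x ^ p + p * x ^ (p - 1) * (y - x) := by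
    rw [Real.rpow_sub_one hx.ne']
    field_simp
  rw [e2] at h
  linarith

/-- For equal signs this is the preceding convexity bound. For opposite signs the difference is a
sum of absolute values and each factor `|·|^(p-1)` is bounded by `m^(p-1)` directly. -/
theorem abs_signedPow_sub_le {p : ℝ} (hp : 1 ≤ p) {x y m : ℝ} (hx : |x| ≤ m) (hy : |y| ≤ m) :
    |(|x| ^ (p - 1) * x - |y| ^ (p - 1) * y)| ≤ p * m ^ (p - 1) * |x - y| := by
  have hm : 0 ≤ m := (abs_nonneg x).trans hx
  have key : ∀ {x y : ℝ}, 0 ≤ y → y ≤ x → x ≤ m →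
      |x ^ (p - 1) * x - y ^ (p - 1) * y| ≤ p * m ^ (p - 1) * |x - y| := by
    intro x y hy hyx hxm
    have hx : 0 ≤ x := hy.trans hyx
    have hpow : ∀ {z : ℝ}, 0 ≤ z → z ^ (p - 1) * z = z ^ p := by
      intro z hz
      rcases hz.eq_or_lt with rfl | hz
      · rw [mul_zero, Real.zero_rpow (by linarith)]
      · rw [← Real.rpow_add_one hz.ne', sub_add_cancel]
    rw [hpow hx, hpow hy, abs_of_nonneg (sub_nonneg.2 hyx), abs_of_nonneg
      (sub_nonneg.2 (Real.rpow_le_rpow hy hyx (by linarith)))]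
    refine (rpow_sub_rpow_le hp hy hyx).trans ?_
    gcongr
  have key' : ∀ {x y : ℝ}, 0 ≤ x → 0 ≤ y → x ≤ m → y ≤ m →
      |x ^ (p - 1) * x - y ^ (p - 1) * y| ≤ p * m ^ (p - 1) * |x - y| := by
    intro x y hx hy hxm hym
    rcases le_total y x with h | h
    · exact key hy h hxm
    · rw [abs_sub_comm, abs_sub_comm x]
      exact key hx h hym
  have opp : ∀ {x y : ℝ}, 0 ≤ x → 0 ≤ y → x ≤ m → y ≤ m →
      |x ^ (p - 1) * x + y ^ (p - 1) * y| ≤ p * m ^ (p - 1) * |x + y| := by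
    intro x y hx hy hxm hym
    rw [abs_of_nonneg (by positivity), abs_of_nonneg (by positivity)]
    have h1 : x ^ (p - 1) ≤ m ^ (p - 1) := Real.rpow_le_rpow hx hxm (by linarith)
    have h2 : y ^ (p - 1) ≤ m ^ (p - 1) := Real.rpow_le_rpow hy hym (by linarith)
    have h3 : 0 ≤ m ^ (p - 1) := by positivity
    calc x ^ (p - 1) * x + y ^ (p - 1) * y ≤ m ^ (p - 1) * x + m ^ (p - 1) * y := by gcongr
      _ = 1 * m ^ (p - 1) * (x + y) := by ring
      _ ≤ _ := by gcongr
  rcases le_total 0 x with h0x | h0x <;> rcases le_total 0 y with h0y | h0y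
  · rw [abs_of_nonneg h0x, abs_of_nonneg h0y] at *
    exact key' h0x h0y hx hy
  · rw [abs_of_nonneg h0x] at *
    rw [abs_of_nonpos h0y] at *
    have := opp h0x (neg_nonneg.2 h0y) hx hy
    rwa [mul_neg, ← sub_eq_add_neg, ← sub_eq_add_neg] at this
  · rw [abs_of_nonpos h0x] at *
    rw [abs_of_nonneg h0y] at *
    have := opp (neg_nonneg.2 h0x) h0y hx hy
    rw [← abs_neg] at this
    convert this using 2
    · ring
    · rw [← abs_neg]
      congr 1
      ring
  · rw [abs_of_nonpos h0x, abs_of_nonpos h0y] at *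
    have := key' (neg_nonneg.2 h0x) (neg_nonneg.2 h0y) hx hy
    rw [← abs_neg] at this
    convert this using 2
    · ring
    · rw [← abs_neg]
      congr 1
      ring

/-- A measurable coefficient of growth `O((1 + t) ^ A)`. -/
structure IsCoefficient (A : ℝ) (a : ℝ → Space N → ℝ) : Prop where
  meas : JointlyMeasurable a
  bound : ∃ C : ℝ, 0 ≤ C ∧ ∀ᵐ s ∂volume.restrict (Ioi (0 : ℝ)),
    eLpNorm (a s) ⊤ volume ≤ ENNReal.ofReal (C * (s + 1) ^ A)

theorem IsCoefficient.of_essSup {A : ℝ} {a : ℝ → Space N → ℝ} (hm : JointlyMeasurable a)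
    (ha : essSup (fun t => ENNReal.ofReal ((1 + t) ^ (-A)) * eLpNorm (a t) ⊤ volume)
      (volume.restrict (Ioi 0)) < ⊤) : IsCoefficient A a := by
  refine ⟨hm, (essSup (fun t => ENNReal.ofReal ((1 + t) ^ (-A)) * eLpNorm (a t) ⊤ volume)
    (volume.restrict (Ioi 0))).toReal, ENNReal.toReal_nonneg, ?_⟩
  filter_upwards [ENNReal.ae_le_essSup (μ := volume.restrict (Ioi (0 : ℝ)))
    (fun t => ENNReal.ofReal ((1 + t) ^ (-A)) * eLpNorm (a t) ⊤ volume), ae_Ioi_pos] with s hs h0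
  have h1 : 0 < s + 1 := by linarith
  rw [ENNReal.ofReal_mul ENNReal.toReal_nonneg, ENNReal.ofReal_toReal ha.ne]
  calc eLpNorm (a s) ⊤ volume
      = ENNReal.ofReal ((1 + s) ^ (-A)) * eLpNorm (a s) ⊤ volume *
          ENNReal.ofReal ((s + 1) ^ A) := by
        rw [mul_right_comm, ← ENNReal.ofReal_mul (by positivity), add_comm 1 s,
          ← Real.rpow_add h1]
        simp
    _ ≤ _ := by gcongr

/-- The decay rate of the heat kernel in `L^∞`. -/
def SupDecay (w : ℝ → Space N → ℝ) : Prop :=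
  ∃ C : ℝ, 0 ≤ C ∧ ∀ t : ℝ, 0 < t →
    eLpNorm (w t) ⊤ volume ≤ ENNReal.ofReal (C * (t + 1) ^ (-(N : ℝ) / 2))

theorem sqrt_pow_mul_rpow {T : ℝ} (hT : 0 < T) (n : ℕ) : √T ^ n * T ^ (-(n : ℝ) / 2) = 1 := by
  rw [Real.sqrt_eq_rpow, ← Real.rpow_natCast, ← Real.rpow_mul hT.le, ← Real.rpow_add hT]
  convert Real.rpow_zero T using 2
  ring

theorem Decay.supDecay {K : ℝ} {w : ℝ → Space N → ℝ} (h : Decay K 0 w) : SupDecay w := by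
  obtain ⟨C, hC, h⟩ := h
  refine ⟨C, hC, fun t ht => ?_⟩
  have h1 : 0 < t + 1 := by linarith
  have h2 := (le_add_self (a := ENNReal.ofReal (√(t + 1) ^ N) * eLpNorm (w t) ⊤ volume)
    (b := wnorm K (t + 1) (w t))).trans (h t ht)
  rw [neg_zero, Real.rpow_zero, mul_one] at h2
  calc eLpNorm (w t) ⊤ volume
      = ENNReal.ofReal (√(t + 1) ^ N) * eLpNorm (w t) ⊤ volume *
          ENNReal.ofReal ((t + 1) ^ (-(N : ℝ) / 2)) := by
        rw [mul_right_comm, ← ENNReal.ofReal_mul (by positivity), sqrt_pow_mul_rpow h1]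
        simp
    _ ≤ ENNReal.ofReal C * ENNReal.ofReal ((t + 1) ^ (-(N : ℝ) / 2)) := by gcongr
    _ = _ := (ENNReal.ofReal_mul hC).symm

theorem SupDecay.zero : SupDecay fun _ (_ : Space N) => (0 : ℝ) :=
  ⟨0, le_rfl, fun _ _ => eLpNorm_zero.trans_le zero_le⟩

theorem Decay.zero (K σ : ℝ) : Decay K σ fun _ (_ : Space N) => (0 : ℝ) :=
  ⟨0, le_rfl, fun t _ => by simp [xnorm_zero]⟩

theorem jointlyMeasurable_zero : JointlyMeasurable fun _ (_ : Space N) => (0 : ℝ) :=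
  aestronglyMeasurable_const

section PowerTerm

variable {A Ap p K : ℝ} {a w w₁ w₂ : ℝ → Space N → ℝ}

theorem powerTerm_zero (a : ℝ → Space N → ℝ) (p : ℝ) :
    powerTerm a p (fun _ _ => 0) = fun _ _ => 0 := by
  ext t x
  simp [powerTerm]

/-- With `w₁, w₂` of size `(s+1)^(-N/2)`, the Lipschitz constant of the nonlinear term is of order
`(s+1)^(A - N(p-1)/2)`. This exponent is `-Ap - 1`, which is where `A_p` comes from. -/
theorem IsCoefficient.exists_powerTerm_sub_le (ha : IsCoefficient A a) (hp : 1 ≤ p)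
    (hAp : Ap = -A + (N : ℝ) * (p - 1) / 2 - 1) (h₁ : SupDecay w₁) (h₂ : SupDecay w₂) :
    ∃ C : ℝ, 0 ≤ C ∧ ∀ᵐ s ∂volume.restrict (Ioi (0 : ℝ)), ∀ᵐ y,
      ‖powerTerm a p w₁ s y - powerTerm a p w₂ s y‖ₑ ≤
        ENNReal.ofReal (C * (s + 1) ^ (-Ap - 1)) * ‖w₁ s y - w₂ s y‖ₑ := by
  obtain ⟨C₀, hC₀, h₀⟩ := ha.bound
  obtain ⟨C₁, hC₁, h₁⟩ := h₁
  obtain ⟨C₂, hC₂, h₂⟩ := h₂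
  have hbd : ∀ {f : Space N → ℝ} {c : ℝ}, 0 ≤ c → eLpNorm f ⊤ volume ≤ ENNReal.ofReal c →
      ∀ᵐ y, |f y| ≤ c := by
    intro f c hc hf
    rw [eLpNorm_exponent_top] at hf
    filter_upwards [enorm_ae_le_eLpNormEssSup f volume] with y hy
    have := hy.trans hf
    rwa [Real.enorm_eq_ofReal_abs, ENNReal.ofReal_le_ofReal_iff hc] at this
  refine ⟨C₀ * (p * (max C₁ C₂) ^ (p - 1)), by positivity, ?_⟩
  filter_upwards [h₀, ae_Ioi_pos] with s hs h0
  have hs1 : 0 < s + 1 := by linarith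
  filter_upwards [hbd (by positivity) hs, hbd (by positivity) (h₁ s h0),
    hbd (by positivity) (h₂ s h0)] with y hy hy₁ hy₂
  set r := (s + 1) ^ (-(N : ℝ) / 2) with hr
  have hr0 : 0 ≤ r := by positivity
  have h3 := abs_signedPow_sub_le hp (m := max C₁ C₂ * r)
    (hy₁.trans (by gcongr; exact le_max_left _ _)) (hy₂.trans (by gcongr; exact le_max_right _ _))
  rw [Real.enorm_eq_ofReal_abs, Real.enorm_eq_ofReal_abs, ← ENNReal.ofReal_mul (by positivity)]
  refine ENNReal.ofReal_le_ofReal ?_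
  have e : powerTerm a p w₁ s y - powerTerm a p w₂ s y =
      a s y * (|w₁ s y| ^ (p - 1) * w₁ s y - |w₂ s y| ^ (p - 1) * w₂ s y) := by
    unfold powerTerm
    ring
  rw [e, abs_mul]
  refine (mul_le_mul hy h3 (abs_nonneg _) (by positivity)).trans_eq ?_
  have e2 : (s + 1) ^ (-Ap - 1) = (s + 1) ^ A * r ^ (p - 1) := by
    rw [hr, ← Real.rpow_mul hs1.le, ← Real.rpow_add hs1, hAp]
    congr 1
    ring
  rw [Real.mul_rpow (by positivity) hr0, e2]
  ring

theorem IsCoefficient.jointlyMeasurable_powerTerm (ha : IsCoefficient A a) (p : ℝ)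
    (hw : JointlyMeasurable w) : JointlyMeasurable (powerTerm a p w) :=
  (ha.meas.mul (hw.aemeasurable.abs.pow_const (p - 1)).aestronglyMeasurable).mul hw

theorem IsCoefficient.isSource_powerTerm_sub (ha : IsCoefficient A a) (hp : 1 ≤ p)
    (hAp : Ap = -A + (N : ℝ) * (p - 1) / 2 - 1) (hm₁ : JointlyMeasurable w₁)
    (hm₂ : JointlyMeasurable w₂) (h₁ : Decay K 0 w₁) (h₂ : Decay K 0 w₂) {σ : ℝ}
    (h : Decay K σ fun t x => w₁ t x - w₂ t x) :
    IsSource K (Ap + σ) fun t x => powerTerm a p w₁ t x - powerTerm a p w₂ t x := by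
  obtain ⟨C, hC, hle⟩ := ha.exists_powerTerm_sub_le hp hAp h₁.supDecay h₂.supDecay
  obtain ⟨D, hD, h⟩ := h
  refine ⟨(ha.jointlyMeasurable_powerTerm p hm₁).sub (ha.jointlyMeasurable_powerTerm p hm₂),
    C * D, by positivity, ?_⟩
  filter_upwards [hle, ae_Ioi_pos, hm₁.ae, hm₂.ae] with s hs h0 hms₁ hms₂
  have hs1 : 0 < s + 1 := by linarith
  refine (xnorm_mono hs (hms₁.sub hms₂)).trans ((mul_le_mul_right (h s h0) _).trans_eq ?_)
  rw [← ENNReal.ofReal_mul (by positivity), mul_mul_mul_comm, ← Real.rpow_add hs1]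
  congr 3
  ring

theorem IsCoefficient.isSource_powerTerm (ha : IsCoefficient A a) (hp : 1 ≤ p)
    (hAp : Ap = -A + (N : ℝ) * (p - 1) / 2 - 1) (hm : JointlyMeasurable w) (h : Decay K 0 w) :
    IsSource K Ap (powerTerm a p w) := by
  have := ha.isSource_powerTerm_sub hp hAp hm jointlyMeasurable_zero h (Decay.zero K 0) (σ := 0)
    (by simpa using h)
  simpa [powerTerm_zero] using this

end PowerTerm

/-! ### Domination of solutions by the linear flow -/

theorem lintegral_heatKernel_mul_heatKernel {s τ : ℝ} (hs : 0 < s) (hτ : 0 < τ)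
    (x z : Space N) :
    ∫⁻ y, ENNReal.ofReal (heatKernel τ (x - y)) * ENNReal.ofReal (heatKernel s (y - z)) =
      ENNReal.ofReal (heatKernel (s + τ) (x - z)) := by
  rw [← integral_heatKernel_mul_heatKernel hs hτ, ofReal_integral_eq_lintegral_ofReal
    (integrable_heatKernel_mul hτ (integrable_heatKernel hs) _)
    (Eventually.of_forall fun y => mul_nonneg (heatKernel_nonneg hτ.le _)
      (heatKernel_nonneg hs.le _)),
    ← lintegral_add_right_eq_self _ z]
  refine lintegral_congr fun y => ?_
  rw [add_sub_cancel_right, ← ENNReal.ofReal_mul (heatKernel_nonneg hτ.le _), sub_sub, add_comm y]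

/-- The linear flow of `|φ|`, with values in `[0,∞]`. -/
noncomputable def absFlow (φ : Space N → ℝ) (t : ℝ) (x : Space N) : ℝ≥0∞ :=
  ∫⁻ y, ENNReal.ofReal (heatKernel t (x - y)) * ‖φ y‖ₑ

theorem lintegral_heatKernel_mul_absFlow {φ : Space N → ℝ} (hφ : AEStronglyMeasurable φ)
    {s τ : ℝ} (hs : 0 < s) (hτ : 0 < τ) (x : Space N) :
    ∫⁻ y, ENNReal.ofReal (heatKernel τ (x - y)) * absFlow φ s y = absFlow φ (s + τ) x := by
  unfold absFlow
  simp_rw [← lintegral_const_mul' _ _ ENNReal.ofReal_ne_top]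
  rw [lintegral_lintegral_swap]
  · refine lintegral_congr fun z => ?_
    simp_rw [← mul_assoc]
    rw [lintegral_mul_const' _ _ enorm_ne_top, lintegral_heatKernel_mul_heatKernel hs hτ]
  · have h1 : Measurable fun z : Space N × Space N => ENNReal.ofReal (heatKernel τ (x - z.1)) :=
      ((continuous_heatKernel τ).comp (by fun_prop)).measurable.ennreal_ofReal
    have h2 : Measurable fun z : Space N × Space N => ENNReal.ofReal (heatKernel s (z.1 - z.2)) :=
      ((continuous_heatKernel s).comp (by fun_prop)).measurable.ennreal_ofReal
    have h3 : AEMeasurable (fun z : Space N × Space N => ‖φ z.2‖ₑ) (volume.prod volume) :=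
      hφ.comp_snd.enorm
    exact h1.aemeasurable.mul (h2.aemeasurable.mul h3)

theorem enorm_duhamel_le (h : ℝ → Space N → ℝ) {t : ℝ} (ht : 0 ≤ t) (x : Space N) :
    ‖duhamel h t x‖ₑ ≤
      ∫⁻ s in Ioc 0 t, ∫⁻ y, ENNReal.ofReal (heatKernel (t - s) (x - y)) * ‖h s y‖ₑ := by
  unfold duhamel
  rw [intervalIntegral.integral_of_le ht]
  refine (enorm_integral_le_lintegral_enorm _).trans (lintegral_mono_ae ?_)
  filter_upwards [ae_Ioc_lt t] with s hs
  exact enorm_heatFlow_le (by linarith [hs.2]) _ _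

/-- With `k(s) = c (s+1)^(-b-1)`, the exponential is `L(t) = exp(2 ∫_0^t k)`, so `k L = L'/2`. The
extra factor `2` in the exponent is what halves the error at each step of the domination argument.
-/
theorem lintegral_gronwall_weight {c b : ℝ} (hc : 0 < c) (hb : 0 < b) {t : ℝ} (ht : 0 ≤ t) :
    ∫⁻ s in Ioc 0 t, ENNReal.ofReal (c * (s + 1) ^ (-b - 1)) *
      ENNReal.ofReal (Real.exp (2 * c / b * (1 - (s + 1) ^ (-b)))) =
      ENNReal.ofReal ((Real.exp (2 * c / b * (1 - (t + 1) ^ (-b))) - 1) / 2) := by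
  have hd : ∀ s ∈ uIcc 0 t, HasDerivAt
      (fun s : ℝ => Real.exp (2 * c / b * (1 - (s + 1) ^ (-b))) / 2)
      (c * (s + 1) ^ (-b - 1) * Real.exp (2 * c / b * (1 - (s + 1) ^ (-b)))) s := by
    intro s hs
    rw [uIcc_of_le ht] at hs
    have h1 : HasDerivAt (fun s : ℝ => (s + 1) ^ (-b)) (1 * (-b) * (s + 1) ^ (-b - 1)) s :=
      ((hasDerivAt_id s).add_const 1).rpow_const (Or.inl (by simp only [id]; linarith [hs.1]))
    refine (((h1.const_sub 1).const_mul (2 * c / b)).exp.div_const 2).congr_deriv ?_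
    field_simp
  have hcont : ContinuousOn (fun s : ℝ => c * (s + 1) ^ (-b - 1) *
      Real.exp (2 * c / b * (1 - (s + 1) ^ (-b)))) (uIcc 0 t) := by
    rw [uIcc_of_le ht]
    have h : ∀ e : ℝ, ContinuousOn (fun s : ℝ => (s + 1) ^ e) (Icc 0 t) := fun e =>
      ContinuousOn.rpow_const (by fun_prop) fun s hs => Or.inl (by linarith [hs.1])
    exact (continuousOn_const.mul (h _)).mul
      (Real.continuous_exp.comp_continuousOn (continuousOn_const.mul (continuousOn_const.sub (h _))))
  have hint := intervalIntegral.integral_eq_sub_of_hasDerivAt hd hcont.intervalIntegrable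
  have e : (Real.exp (2 * c / b * (1 - (t + 1) ^ (-b))) - 1) / 2 =
      ∫ s in (0 : ℝ)..t, c * (s + 1) ^ (-b - 1) *
        Real.exp (2 * c / b * (1 - (s + 1) ^ (-b))) := by
    rw [hint]
    simp only [zero_add, Real.one_rpow, sub_self, mul_zero, Real.exp_zero]
    ring
  rw [e, intervalIntegral.integral_of_le ht, ofReal_integral_eq_lintegral_ofReal]
  · refine setLIntegral_congr_fun measurableSet_Ioc fun s hs => ?_
    have : 0 < s + 1 := by linarith [hs.1]
    exact (ENNReal.ofReal_mul (by positivity)).symm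
  · exact (intervalIntegrable_iff_integrableOn_Ioc_of_le ht).1 hcont.intervalIntegrable
  · filter_upwards [ae_restrict_mem measurableSet_Ioc] with s hs
    have : 0 < s + 1 := by linarith [hs.1]
    positivity

/-- The bound `|u| ≤ L (e^{tΔ}|φ| + 2^(-n) B)` improves itself. Inserted into Duhamel's formula it
gives the integral term `(L-1)/2` times the same bracket, because the flow reproduces `e^{sΔ}|φ|` as
`e^{tΔ}|φ|` and leaves constants unchanged. The induction starts from the sup bound `B`, and no
weighted norm of `u` need be known to be finite. -/
theorem enorm_le_absFlow {c b : ℝ} (hc : 0 < c) (hb : 0 < b) {φ : Space N → ℝ}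
    (hφ : AEStronglyMeasurable φ) {u f : ℝ → Space N → ℝ}
    (hf : ∀ᵐ s ∂volume.restrict (Ioi (0 : ℝ)), ∀ᵐ y,
      ‖f s y‖ₑ ≤ ENNReal.ofReal (c * (s + 1) ^ (-b - 1)) * ‖u s y‖ₑ)
    (hu : ∀ t > 0, ∀ x, u t x = heatFlow t φ x + duhamel f t x) {B : ℝ≥0∞} (hB : B ≠ ⊤)
    (hbdd : ∀ t > 0, ∀ᵐ x, ‖u t x‖ₑ ≤ B) {t : ℝ} (ht : 0 < t) :
    ∀ᵐ x, ‖u t x‖ₑ ≤ ENNReal.ofReal (Real.exp (2 * c / b)) * absFlow φ t x := by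
  set L : ℝ → ℝ := fun t => Real.exp (2 * c / b * (1 - (t + 1) ^ (-b))) with hL
  have hL1 : ∀ t > 0, 1 ≤ L t := by
    intro t ht
    refine Real.one_le_exp (mul_nonneg (by positivity) (sub_nonneg.2 ?_))
    exact Real.rpow_le_one_of_one_le_of_nonpos (by linarith) (by linarith)
  have key : ∀ n : ℕ, ∀ t > 0, ∀ᵐ x,
      ‖u t x‖ₑ ≤ ENNReal.ofReal (L t) * (absFlow φ t x + (2⁻¹) ^ n * B) := by
    intro n
    induction n with
    | zero =>
      intro t ht
      filter_upwards [hbdd t ht] with x hx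
      rw [pow_zero, one_mul]
      calc ‖u t x‖ₑ ≤ 1 * B := by rwa [one_mul]
        _ ≤ _ := by
          gcongr
          · exact ENNReal.one_le_ofReal.2 (hL1 t ht)
          · exact le_add_self
    | succ n ih =>
      intro t ht
      refine Eventually.of_forall fun x => ?_
      set Q := absFlow φ t x + (2⁻¹) ^ n * B with hQ
      have hD : ‖duhamel f t x‖ₑ ≤ ENNReal.ofReal ((L t - 1) / 2) * Q := by
        refine (enorm_duhamel_le f ht.le x).trans ?_
        rw [hL, ← lintegral_gronwall_weight hc hb ht.le,
          ← lintegral_mul_const'' _ (by fun_prop)]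
        refine lintegral_mono_ae ?_
        filter_upwards [ae_Ioc_of_ae_Ioi hf, ae_Ioc_lt t] with s hs hst
        have hτ : 0 < t - s := by linarith [hst.2]
        have hk : Measurable fun y => ENNReal.ofReal (heatKernel (t - s) (x - y)) :=
          ENNReal.measurable_ofReal.comp ((continuous_heatKernel _).measurable.comp (by fun_prop))
        calc ∫⁻ y, ENNReal.ofReal (heatKernel (t - s) (x - y)) * ‖f s y‖ₑ
            ≤ ∫⁻ y, ENNReal.ofReal (c * (s + 1) ^ (-b - 1)) * ENNReal.ofReal (L s) *
                (ENNReal.ofReal (heatKernel (t - s) (x - y)) * absFlow φ s y +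
                ENNReal.ofReal (heatKernel (t - s) (x - y)) * ((2⁻¹) ^ n * B)) := by
              refine lintegral_mono_ae ?_
              filter_upwards [hs, ih s hst.1] with y hy hy'
              calc ENNReal.ofReal (heatKernel (t - s) (x - y)) * ‖f s y‖ₑ
                  ≤ ENNReal.ofReal (heatKernel (t - s) (x - y)) *
                    (ENNReal.ofReal (c * (s + 1) ^ (-b - 1)) *
                      (ENNReal.ofReal (L s) * (absFlow φ s y + (2⁻¹) ^ n * B))) := by
                    gcongr
                    exact hy.trans (by gcongr)
                _ = _ := by ring
          _ = _ := by
              rw [lintegral_const_mul' _ _ (ENNReal.mul_ne_top ENNReal.ofReal_ne_top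
                ENNReal.ofReal_ne_top), lintegral_add_right _ (hk.mul_const _),
                lintegral_mul_const _ hk, lintegral_heatKernel hτ, one_mul,
                lintegral_heatKernel_mul_absFlow hφ hst.1 hτ, add_sub_cancel]
      have h1 : ‖u t x‖ₑ ≤ absFlow φ t x + ENNReal.ofReal ((L t - 1) / 2) * Q := by
        rw [hu t ht x]
        exact (enorm_add_le _ _).trans (add_le_add (enorm_heatFlow_le ht.le _ _) hD)
      refine h1.trans ?_
      have hl := hL1 t ht
      have e1 : 1 + ENNReal.ofReal ((L t - 1) / 2) ≤ ENNReal.ofReal (L t) := by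
        rw [← ENNReal.ofReal_one, ← ENNReal.ofReal_add zero_le_one (by linarith)]
        exact ENNReal.ofReal_le_ofReal (by linarith)
      have e2 : ENNReal.ofReal ((L t - 1) / 2) ≤ ENNReal.ofReal (L t) * 2⁻¹ := by
        rw [← ENNReal.ofReal_ofNat 2, ← ENNReal.ofReal_inv_of_pos two_pos,
          ← ENNReal.ofReal_mul (by linarith)]
        exact ENNReal.ofReal_le_ofReal (by linarith)
      calc absFlow φ t x + ENNReal.ofReal ((L t - 1) / 2) * Q
          = (1 + ENNReal.ofReal ((L t - 1) / 2)) * absFlow φ t x +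
            ENNReal.ofReal ((L t - 1) / 2) * ((2⁻¹) ^ n * B) := by rw [hQ]; ring
        _ ≤ ENNReal.ofReal (L t) * absFlow φ t x +
            ENNReal.ofReal (L t) * 2⁻¹ * ((2⁻¹) ^ n * B) := by gcongr
        _ = _ := by ring
  have hall := ae_all_iff.2 fun n => key n t ht
  filter_upwards [hall] with x hx
  have hlim : Tendsto (fun n : ℕ => ENNReal.ofReal (L t) * (absFlow φ t x + (2⁻¹) ^ n * B)) atTop
      (𝓝 (ENNReal.ofReal (L t) * (absFlow φ t x + 0 * B))) := by
    refine ENNReal.Tendsto.const_mul (tendsto_const_nhds.add (ENNReal.Tendsto.mul_const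
      (ENNReal.tendsto_pow_atTop_nhds_zero_of_lt_one (by simp)) (Or.inr hB)))
      (Or.inr ENNReal.ofReal_ne_top)
  refine (ge_of_tendsto' hlim hx).trans ?_
  rw [zero_mul, add_zero]
  gcongr
  refine Real.exp_le_exp.2 (mul_le_of_le_one_right (by positivity) ?_)
  have : 0 ≤ (t + 1) ^ (-b) := by positivity
  linarith

theorem absFlow_eq {φ : Space N → ℝ} (hφ : Integrable φ) {t : ℝ} (ht : 0 < t) (x : Space N) :
    absFlow φ t x = ‖heatFlow t (fun y => |φ y|) x‖ₑ := by
  have h0 : ∀ y, 0 ≤ heatKernel t (x - y) * |φ y| := fun y =>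
    mul_nonneg (heatKernel_nonneg ht.le _) (abs_nonneg _)
  unfold heatFlow absFlow
  rw [Real.enorm_eq_ofReal (integral_nonneg h0), ofReal_integral_eq_lintegral_ofReal
    (integrable_heatKernel_mul ht hφ.abs x) (Eventually.of_forall h0)]
  refine lintegral_congr fun y => ?_
  rw [ENNReal.ofReal_mul (heatKernel_nonneg ht.le _), Real.enorm_eq_ofReal_abs]


/-! ### Rates of convergence -/

/-- The rate `o(t ^ (-K/2)) + O(t ^ (-γ))`, with a logarithm in the critical case `γ = K/2`. -/
def Rate (K γ : ℝ) (Y : ℝ → ℝ≥0∞) : Prop :=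
  (γ ≠ K / 2 → SmallAddBig Y (fun t => t ^ (-K / 2)) fun t => t ^ (-γ)) ∧
    (γ = K / 2 → Big Y fun t => t ^ (-K / 2) * Real.log t)

theorem Rate.mono {K γ : ℝ} {Y Y' : ℝ → ℝ≥0∞} (h : Rate K γ Y) {c : ℝ} (hc : 0 < c)
    (hY : ∀ᶠ t in atTop, Y' t ≤ ENNReal.ofReal c * Y t) : Rate K γ Y' :=
  ⟨fun hγ => (h.1 hγ).mono hc hY, fun hγ => (h.2 hγ).mono hc.le hY⟩

theorem Rate.add_big {K γ : ℝ} {Y Y' : ℝ → ℝ≥0∞} (h : Rate K γ Y)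
    (h' : Big Y' fun t => t ^ (-γ)) : Rate K γ fun t => Y t + Y' t := by
  refine ⟨fun hγ => (h.1 hγ).add_big h', fun hγ => (h.2 hγ).add (h'.rate (rpow_rate_log ?_))⟩
  linarith

theorem SmallAddBig.small {Y : ℝ → ℝ≥0∞} {a b : ℝ} (hab : a < b)
    (h : SmallAddBig Y (fun t => t ^ b) fun t => t ^ a) : Small Y fun t => t ^ b := by
  obtain ⟨Y₁, Y₂, hle, h₁, h₂⟩ := h
  exact (h₁.add (h₂.small hab)).mono one_pos (by simpa using hle)

/-- Once the exponent exceeds `K/2`, the `O` term is itself `o(t^(-K/2))`, which satisfies the rate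
for every exponent `b`, the logarithmic case included. -/
theorem Rate.of_lt {K γ b : ℝ} {Y : ℝ → ℝ≥0∞} (h : Rate K γ Y) (hγ : γ = b ∨ K / 2 < γ) :
    Rate K b Y := by
  rcases hγ with rfl | hγ
  · exact h
  · have hs := (h.1 hγ.ne').small (by linarith)
    exact ⟨fun _ => hs.smallAddBig _, fun _ => hs.big.rate (rpow_rate_log le_rfl)⟩

theorem IsSource.rate_remainder {K γ : ℝ} {φ : Space N → ℝ} {h : ℝ → Space N → ℝ} (hK : 0 ≤ K)
    (hφ : AEStronglyMeasurable φ) (hfin : xnorm K 1 φ < ⊤) (hγ : 0 ≤ γ) (hh : IsSource K γ h) :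
    Rate K γ fun t => xnorm K (t + 1) (remainder K φ h t) :=
  ⟨fun hne => hh.smallAddBig_remainder hK hφ hfin hγ hne, fun he => hh.big_remainder hK hφ hfin he⟩

theorem IsSource.decay_remainder_of_le {K γ σ : ℝ} {φ : Space N → ℝ} {h : ℝ → Space N → ℝ}
    (hK : 0 ≤ K) (hφ : AEStronglyMeasurable φ) (hfin : xnorm K 1 φ < ⊤) (hh : IsSource K γ h)
    (hσγ : σ ≤ γ) (hσK : σ ≤ K / 2) (hlt : σ < γ ∨ σ < K / 2) :
    Decay K σ (remainder K φ h) := by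
  rcases hσK.lt_or_eq with h1 | h1
  · exact ((hh.mono hσγ).decay_remainder hK hφ hfin).1 h1
  · rw [h1] at hlt ⊢
    exact (hh.decay_remainder hK hφ hfin).2 (hlt.resolve_right (lt_irrefl _))

/-- The pure power decay that a source of decay `γ` yields: `min(γ, K/2)`, lowered by `ε/2` at
equality to avoid the logarithm. With `ε = A_p`, the last alternative says that nothing was lost or
that the next source already decays faster than `K/2`. -/
theorem exists_decay_exponent (K γ : ℝ) {ε : ℝ} (hε : 0 < ε) :
    ∃ σ : ℝ, σ ≤ γ ∧ σ ≤ K / 2 ∧ (σ < γ ∨ σ < K / 2) ∧ (σ = γ ∨ K / 2 < ε + σ) := by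
  rcases lt_trichotomy γ (K / 2) with h | h | h
  · exact ⟨γ, le_rfl, h.le, Or.inr h, Or.inl rfl⟩
  · exact ⟨K / 2 - ε / 2, by linarith, by linarith, Or.inr (by linarith), Or.inr (by linarith)⟩
  · exact ⟨K / 2, h.le, le_rfl, Or.inl h, Or.inr (by linarith)⟩

/-! ### Coefficients times derivatives of the kernel -/

theorem powInt_add_le {a : ℝ} (ha : 0 ≤ a) (β : ℝ) {t : ℝ} (ht : 0 ≤ t) :
    powInt (a + β) t ≤ (t + 1) ^ a * powInt β t := by
  unfold powInt
  rw [← intervalIntegral.integral_const_mul]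
  refine intervalIntegral.integral_mono_on ht (intervalIntegrable_add_one_rpow le_rfl ht _)
    ((intervalIntegrable_add_one_rpow le_rfl ht _).const_mul _) fun s hs => ?_
  have hs1 : 0 < s + 1 := by linarith [hs.1]
  rw [show a + β - 1 = a + (β - 1) by ring, Real.rpow_add hs1]
  gcongr
  exact hs.2

theorem decay_mul_gDeriv {K σ : ℝ} (hK : 0 ≤ K) {α : MultiIndex N} {c : ℝ → ℝ}
    (hc : ∃ C : ℝ, 0 ≤ C ∧ ∀ t > 0, |c t| ≤ C * (t + 1) ^ ((order α : ℝ) / 2 - σ)) :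
    Decay K σ fun t x => c t * gDeriv α t x := by
  obtain ⟨C, hC, hc⟩ := hc
  obtain ⟨D, hD, hg⟩ := exists_xnorm_gDeriv_le hK α
  refine ⟨C * D, by positivity, fun t ht => ?_⟩
  have h1 : 0 < t + 1 := by linarith
  refine (xnorm_const_mul_le (c t) (continuous_gDeriv α h1).aestronglyMeasurable).trans ?_
  refine (mul_le_mul_right (hg t h1) _).trans ?_
  rw [Real.enorm_eq_ofReal_abs, ← ENNReal.ofReal_mul (abs_nonneg _)]
  refine ENNReal.ofReal_le_ofReal ?_
  calc |c t| * (D * (√(t + 1))⁻¹ ^ order α)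
      ≤ C * (t + 1) ^ ((order α : ℝ) / 2 - σ) * (D * (√(t + 1))⁻¹ ^ order α) := by
        gcongr
        exact hc t ht
    _ = C * D * ((t + 1) ^ ((order α : ℝ) / 2 - σ) * (√(t + 1))⁻¹ ^ order α) := by ring
    _ = C * D * (t + 1) ^ (-σ) := by
        congr 1
        rw [Real.sqrt_eq_rpow, ← Real.rpow_neg h1.le, ← Real.rpow_natCast, ← Real.rpow_mul h1.le,
          ← Real.rpow_add h1]
        congr 1
        ring

theorem Decay.sum {ι : Type*} {K σ : ℝ} (s : Finset ι) {w : ι → ℝ → Space N → ℝ}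
    (hm : ∀ i ∈ s, ∀ t > 0, AEStronglyMeasurable (w i t)) (h : ∀ i ∈ s, Decay K σ (w i)) :
    Decay K σ fun t x => ∑ i ∈ s, w i t x := by
  classical
  induction s using Finset.induction_on with
  | empty => simpa using Decay.zero K σ
  | insert i s hi ih =>
    simp_rw [Finset.sum_insert hi]
    exact (h i (Finset.mem_insert_self i s)).add
      (ih (fun j hj => hm j (Finset.mem_insert_of_mem hj))
        fun j hj => h j (Finset.mem_insert_of_mem hj))
      (hm i (Finset.mem_insert_self i s))
      fun t ht => Finset.aestronglyMeasurable_fun_sum _ fun j hj =>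
        hm j (Finset.mem_insert_of_mem hj) t ht

theorem aestronglyMeasurable_mul_gDeriv (c : ℝ) (α : MultiIndex N) {t : ℝ} (ht : 0 < t) :
    AEStronglyMeasurable (fun x => c * gDeriv α t x) volume :=
  ((continuous_gDeriv α (by linarith)).const_mul c).aestronglyMeasurable

theorem xnorm_le_two_mul {K K' T : ℝ} (hK : 0 ≤ K) (hKK : K ≤ K') (f : Space N → ℝ) :
    xnorm K T f ≤ 2 * xnorm K' T f := by
  unfold xnorm
  rw [mul_add]
  refine add_le_add ?_ (le_mul_of_one_le_left zero_le one_le_two)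
  unfold wnorm
  rw [← lintegral_const_mul' _ _ (by simp)]
  refine lintegral_mono fun x => ?_
  rw [mul_left_comm, two_mul_ofReal]
  gcongr
  unfold weight
  have h0 : 0 ≤ ‖x‖ / √T := by positivity
  have := pow_le_one_add_rpow hK hKK h0
  have h1 : 0 ≤ (‖x‖ / √T) ^ K' := by positivity
  linarith

theorem Decay.of_le {K K' σ : ℝ} (hK : 0 ≤ K) (hKK : K ≤ K') {w : ℝ → Space N → ℝ}
    (h : Decay K' σ w) : Decay K σ w := by
  obtain ⟨C, hC, h⟩ := h
  refine ⟨2 * C, by positivity, fun t ht => (xnorm_le_two_mul hK hKK _).trans ?_⟩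
  refine (mul_le_mul_right (h t ht) _).trans_eq ?_
  rw [two_mul_ofReal, mul_assoc]

theorem eq_zero_of_order_lt_one {α : MultiIndex N} {K : ℝ} (hK : K < 1)
    (hα : (order α : ℝ) ≤ K) : α = 0 := by
  have h : order α < 1 := by exact_mod_cast hα.trans_lt hK
  have h0 : ∑ i, α i = 0 := by
    have : order α = 0 := by omega
    exact this
  ext i
  simpa using (Finset.sum_eq_zero_iff.1 h0) i (Finset.mem_univ i)

theorem zero_mem_indicesUpTo {K : ℝ} (hK : 0 ≤ K) : (0 : MultiIndex N) ∈ indicesUpTo N K := by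
  rw [mem_indicesUpTo hK, order_zero]
  exact_mod_cast hK

theorem indicesUpTo_of_lt_one {K : ℝ} (hK : 0 ≤ K) (hK1 : K < 1) : indicesUpTo N K = {0} := by
  ext α
  rw [Finset.mem_singleton]
  refine ⟨fun h => eq_zero_of_order_lt_one hK1 ((mem_indicesUpTo hK α).1 h), ?_⟩
  rintro rfl
  exact zero_mem_indicesUpTo hK

/-! ### The moment expansion of a solution -/

/-- The data of the semilinear problem, with a solution that decays like the heat kernel. -/
structure DecayingSolution (p A K Ap : ℝ) (a : ℝ → Space N → ℝ) (φ : Space N → ℝ)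
    (u : ℝ → Space N → ℝ) : Prop where
  one_le : 1 ≤ p
  nonneg : 0 ≤ K
  exponent : Ap = -A + (N : ℝ) * (p - 1) / 2 - 1
  pos : 0 < Ap
  coefficient : IsCoefficient A a
  initial_meas : AEStronglyMeasurable φ volume
  initial_lt_top : xnorm K 1 φ < ⊤
  eq : ∀ t > 0, ∀ x, u t x = heatFlow t φ x + duhamel (powerTerm a p u) t x
  meas : JointlyMeasurable u
  meas_at : ∀ t > 0, AEStronglyMeasurable (u t) volume
  decay : Decay K 0 u

/-- Only a sup bound on `u` is assumed. Domination by the flow of `|φ|` transfers the weighted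
integrability of the initial data to all times. -/
theorem decay_of_isSolution {p A K Ap : ℝ} (hp : 1 ≤ p) (hK : 0 ≤ K)
    (hAp : Ap = -A + (N : ℝ) * (p - 1) / 2 - 1) (hpos : 0 < Ap) {a : ℝ → Space N → ℝ}
    (ha : IsCoefficient A a) {φ : Space N → ℝ} (hφ : AEStronglyMeasurable φ)
    (hfin : xnorm K 1 φ < ⊤) {u : ℝ → Space N → ℝ}
    (hu : ∀ t > 0, ∀ x, u t x = heatFlow t φ x + duhamel (powerTerm a p u) t x)
    (hu_decay : SupDecay u) : Decay K 0 u := by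
  obtain ⟨c, hc, hf⟩ := ha.exists_powerTerm_sub_le hp hAp hu_decay SupDecay.zero
  obtain ⟨B, hB, hbd⟩ := hu_decay
  -- The constant `c` may vanish, and `c + 1` provides the positive one needed for the exponential
  -- weight.
  have hf' : ∀ᵐ s ∂volume.restrict (Ioi (0 : ℝ)), ∀ᵐ y,
      ‖powerTerm a p u s y‖ₑ ≤ ENNReal.ofReal ((c + 1) * (s + 1) ^ (-Ap - 1)) * ‖u s y‖ₑ := by
    filter_upwards [hf, ae_Ioi_pos] with s hs h0
    filter_upwards [hs] with y hy
    simp only [powerTerm_zero, sub_zero] at hy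
    refine hy.trans ?_
    gcongr
    linarith
  have hφi : Integrable φ := integrable_of_wnorm_lt_top hφ ((wnorm_le_xnorm _ _ _).trans_lt hfin)
  have hle := fun t (ht : 0 < t) => enorm_le_absFlow (by positivity : 0 < c + 1) hpos hφ hf' hu
    (B := ENNReal.ofReal B) ENNReal.ofReal_ne_top (fun t ht => by
      have h1 : eLpNorm (u t) ⊤ volume ≤ ENNReal.ofReal B := by
        refine (hbd t ht).trans (ENNReal.ofReal_le_ofReal (mul_le_of_le_one_right hB ?_))
        refine Real.rpow_le_one_of_one_le_of_nonpos (by linarith) ?_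
        rw [neg_div]
        exact neg_nonpos.2 (by positivity)
      rw [eLpNorm_exponent_top] at h1
      filter_upwards [enorm_ae_le_eLpNormEssSup (u t) volume] with x hx
      exact hx.trans h1) ht
  obtain ⟨D, hD, hbb⟩ := exists_boundedBy_heatFlow N hK
  have habs : xnorm K 1 (fun y => |φ y|) = xnorm K 1 φ := by
    refine le_antisymm ?_ ?_
    · simpa using xnorm_mono (K := K) (T := 1) (f := fun y => |φ y|) (g := φ) (c := 1)
        (Eventually.of_forall fun y => by simp) hφ
    · simpa using xnorm_mono (K := K) (T := 1) (f := φ) (g := fun y => |φ y|) (c := 1)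
        (Eventually.of_forall fun y => by simp) hφ.norm
  have hφa : AEStronglyMeasurable (fun y => |φ y|) volume := hφ.norm
  refine ⟨Real.exp (2 * (c + 1) / Ap) * (2 * D * (xnorm K 1 φ).toReal), by positivity,
    fun t ht => ?_⟩
  have h1 := (hbb 1 (t + 1) one_pos (by linarith) _ hφa).xnorm_le
  rw [add_sub_cancel_right, habs] at h1
  have h2 := xnorm_mono (K := K) (T := t + 1) (f := u t) (g := heatFlow t fun y => |φ y|)
    ((hle t ht).mono fun x hx => hx.trans_eq (by rw [absFlow_eq hφi ht]))
    (aestronglyMeasurable_heatFlow t hφa)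
  refine h2.trans ((mul_le_mul_right h1 _).trans_eq ?_)
  rw [← mul_assoc 2, two_mul_ofReal, neg_zero, Real.rpow_zero, mul_one,
    ENNReal.ofReal_mul (Real.exp_nonneg _), ENNReal.ofReal_mul (p := 2 * D) (by positivity),
    ENNReal.ofReal_toReal hfin.ne]

theorem SupDecay.of_iSup {u : ℝ → Space N → ℝ} (h : (⨆ t ∈ Ioi (0 : ℝ),
      ENNReal.ofReal ((1 + t) ^ ((N : ℝ) / 2)) * eLpNorm (u t) ⊤ volume) < ⊤) : SupDecay u := by
  set S := ⨆ t ∈ Ioi (0 : ℝ),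
      ENNReal.ofReal ((1 + t) ^ ((N : ℝ) / 2)) * eLpNorm (u t) ⊤ volume with hS
  refine ⟨S.toReal, ENNReal.toReal_nonneg, fun t ht => ?_⟩
  have h1 : 0 < t + 1 := by linarith
  have h2 : ENNReal.ofReal ((1 + t) ^ ((N : ℝ) / 2)) * eLpNorm (u t) ⊤ volume ≤ S :=
    le_iSup₂ (f := fun t (_ : t ∈ Ioi (0 : ℝ)) =>
      ENNReal.ofReal ((1 + t) ^ ((N : ℝ) / 2)) * eLpNorm (u t) ⊤ volume) t ht
  rw [ENNReal.ofReal_mul ENNReal.toReal_nonneg, ENNReal.ofReal_toReal h.ne]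
  calc eLpNorm (u t) ⊤ volume
      = ENNReal.ofReal ((1 + t) ^ ((N : ℝ) / 2)) * eLpNorm (u t) ⊤ volume *
          ENNReal.ofReal ((t + 1) ^ (-(N : ℝ) / 2)) := by
        rw [mul_right_comm, ← ENNReal.ofReal_mul (by positivity), add_comm 1 t,
          ← Real.rpow_add h1, neg_div, add_neg_cancel]
        simp
    _ ≤ _ := by gcongr

theorem DecayingSolution.of_isSolution {p A K Ap : ℝ} (hp : 1 ≤ p) (hK : 0 ≤ K)
    (hAp : Ap = -A + (N : ℝ) * (p - 1) / 2 - 1) (hpos : 0 < Ap) {a : ℝ → Space N → ℝ}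
    (ha : IsCoefficient A a) {φ : Space N → ℝ} (hφ_top : MemLp φ ⊤ volume)
    (hφ_K : MemWeighted K φ) {u : ℝ → Space N → ℝ} (hu : IsSolution a p φ u)
    (hu_decay : SupDecay u) : DecayingSolution p A K Ap a φ u := by
  have hfin : xnorm K 1 φ < ⊤ := by
    unfold xnorm
    rw [wnorm_one]
    exact ENNReal.add_lt_top.2 ⟨hφ_K.2, ENNReal.mul_lt_top ENNReal.ofReal_lt_top hφ_top.2⟩
  refine ⟨hp, hK, hAp, hpos, ha, hφ_K.1, hfin, hu.integral_eq, ?_, fun t ht => ?_,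
    decay_of_isSolution hp hK hAp hpos ha hφ_K.1 hfin hu.integral_eq hu_decay⟩
  · have := hu.continuousOn.aestronglyMeasurable (μ := volume.prod volume)
      (measurableSet_Ioi.prod MeasurableSet.univ)
    rw [← Measure.prod_restrict, Measure.restrict_univ] at this
    exact this
  · have : Continuous fun x => u t x := by
      have h : Continuous fun x : Space N => ((t, x) : ℝ × Space N) := by fun_prop
      exact hu.continuousOn.comp_continuous h fun x => ⟨ht, mem_univ _⟩
    exact this.aestronglyMeasurable

/-- The convergence of the mass holds for all `K`; it is deduced from the case `K = 0`, where only
the moment of order zero is involved. -/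
theorem DecayingSolution.zero {p A K Ap : ℝ} {a : ℝ → Space N → ℝ} {φ : Space N → ℝ}
    {u : ℝ → Space N → ℝ} (h : DecayingSolution p A K Ap a φ u) :
    DecayingSolution p A 0 Ap a φ u where
  one_le := h.one_le
  nonneg := le_rfl
  exponent := h.exponent
  pos := h.pos
  coefficient := h.coefficient
  initial_meas := h.initial_meas
  initial_lt_top := (xnorm_le_two_mul le_rfl h.nonneg φ).trans_lt
    (ENNReal.mul_lt_top (by simp) h.initial_lt_top)
  eq := h.eq
  meas := h.meas
  meas_at := h.meas_at
  decay := h.decay.of_le le_rfl h.nonneg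


/-! ### Remainder identities and the induction on `n`. -/

theorem remainder_eq {K γ : ℝ} {φ : Space N → ℝ} {f : ℝ → Space N → ℝ} (hK : 0 ≤ K) (hγ : 0 ≤ γ)
    (hφ : Integrable φ) (hf : IsSource K γ f) {t : ℝ} (ht : 0 < t) (x : Space N) :
    remainder K φ f t x = heatFlow t φ x + duhamel f t x - ∑ α ∈ indicesUpTo N K,
      (moment α φ 0 + ∫ s in (0 : ℝ)..t, moment α (f s) s) * gDeriv α t x := by
  rw [remainder, heatFlow_momentProj (by norm_num) ht hφ, hf.duhamel_momentProj hK hγ ht]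
  simp_rw [add_mul]
  rw [Finset.sum_add_distrib, zero_add]
  ring

/-- Replacing the source `f` by `f - f'` leaves the data term alone and removes the corrected
Duhamel integral of `f'`. With `f' = F(U_n)` this is the passage from `u - U_0` to `u - U_{n+1}`. -/
theorem remainder_sub {K γ : ℝ} {φ : Space N → ℝ} {f f' : ℝ → Space N → ℝ} (hK : 0 ≤ K)
    (hγ : 0 ≤ γ) (hf : IsSource K γ f) (hf' : IsSource K γ f') {t : ℝ} (ht : 0 < t)
    (x : Space N) :
    remainder K φ (fun s x => f s x - f' s x) t x =
      remainder K φ f t x - duhamel (fun s => momentProj K s (f' s)) t x := by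
  rw [remainder, remainder, (hf.sub hf').duhamel_momentProj hK hγ ht,
    hf.duhamel_momentProj hK hγ ht, hf'.duhamel_momentProj hK hγ ht, hf.duhamel_sub hγ hf' ht,
    Finset.sum_congr rfl fun α hα => by
      rw [hf.integral_moment_sub hf' ((mem_indicesUpTo hK α).1 hα) ht.le, sub_mul],
    Finset.sum_sub_distrib]
  ring

namespace DecayingSolution

variable {p A K Ap : ℝ} {a : ℝ → Space N → ℝ} {φ : Space N → ℝ} {u : ℝ → Space N → ℝ}

theorem integrable_initial (h : DecayingSolution p A K Ap a φ u) : Integrable φ :=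
  integrable_of_wnorm_lt_top h.initial_meas ((wnorm_le_xnorm _ _ _).trans_lt h.initial_lt_top)

theorem isSource_of_decay (h : DecayingSolution p A K Ap a φ u) {w : ℝ → Space N → ℝ}
    (hm : JointlyMeasurable w) (hw : Decay K 0 w) : IsSource K Ap (powerTerm a p w) :=
  h.coefficient.isSource_powerTerm h.one_le h.exponent hm hw

theorem isSource (h : DecayingSolution p A K Ap a φ u) : IsSource K Ap (powerTerm a p u) :=
  h.isSource_of_decay h.meas h.decay

theorem isSource_sub (h : DecayingSolution p A K Ap a φ u) {w : ℝ → Space N → ℝ} {σ : ℝ}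
    (hm : JointlyMeasurable w) (hw : Decay K 0 w) (hσ : Decay K σ fun t x => u t x - w t x) :
    IsSource K (Ap + σ) fun t x => powerTerm a p u t x - powerTerm a p w t x :=
  h.coefficient.isSource_powerTerm_sub h.one_le h.exponent h.meas hm h.decay hw hσ

theorem exists_abs_coeff_le (h : DecayingSolution p A K Ap a φ u) {α : MultiIndex N}
    (hα : (order α : ℝ) ≤ K) :
    ∃ C : ℝ, 0 ≤ C ∧ ∀ t > 0,
      |coeff a p φ u α t| ≤ |moment α φ 0| + C * powInt ((order α : ℝ) / 2 - Ap) t := by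
  obtain ⟨C, hC, hb⟩ := h.isSource.exists_ae_abs_moment_le hα
  refine ⟨C, hC, fun t ht => (abs_add_le _ _).trans ?_⟩
  gcongr
  exact abs_intervalIntegral_le hb le_rfl ht.le

theorem exists_abs_coeff_le_rpow (h : DecayingSolution p A K Ap a φ u) {α : MultiIndex N}
    (hα : (order α : ℝ) ≤ K) :
    ∃ C : ℝ, 0 ≤ C ∧ ∀ t > 0,
      |coeff a p φ u α t| ≤ C * (t + 1) ^ ((order α : ℝ) / 2) := by
  obtain ⟨C, hC, hb⟩ := h.exists_abs_coeff_le hα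
  have hp := h.pos
  refine ⟨|moment α φ 0| + C * Ap⁻¹, by positivity, fun t ht => (hb t ht).trans ?_⟩
  rw [add_mul]
  have h1 : 1 ≤ (t + 1) ^ ((order α : ℝ) / 2) :=
    Real.one_le_rpow (by linarith) (by positivity)
  refine add_le_add (le_mul_of_one_le_right (abs_nonneg _) h1) ?_
  rw [mul_assoc, sub_eq_add_neg]
  gcongr
  refine (powInt_add_le (by positivity) _ ht.le).trans ?_
  rw [mul_comm]
  gcongr
  simpa using powInt_le_of_neg (β := -Ap) (by linarith) ht.le

theorem aestronglyMeasurable_coeff (h : DecayingSolution p A K Ap a φ u) (α : MultiIndex N) :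
    AEStronglyMeasurable (coeff a p φ u α) (volume.restrict (Ioi (0 : ℝ))) :=
  aestronglyMeasurable_const.add (aestronglyMeasurable_primitive (h.isSource.meas.moment α))

theorem approx_succ (n : ℕ) (t : ℝ) (x : Space N) :
    approx a p φ K u (n + 1) t x = approx a p φ K u 0 t x +
      duhamel (fun s => momentProj K s (powerTerm a p (approx a p φ K u n) s)) t x := rfl

theorem approx_zero_props (h : DecayingSolution p A K Ap a φ u) :
    JointlyMeasurable (approx a p φ K u 0) ∧
      (∀ t > 0, AEStronglyMeasurable (approx a p φ K u 0 t)) ∧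
      Decay K 0 (approx a p φ K u 0) := by
  have hm : ∀ α ∈ indicesUpTo N K, ∀ t > 0,
      AEStronglyMeasurable (fun x => coeff a p φ u α t * gDeriv α t x) :=
    fun α _ t ht => aestronglyMeasurable_mul_gDeriv _ α ht
  refine ⟨JointlyMeasurable.sum _ fun α _ =>
    JointlyMeasurable.coeff_mul_gDeriv (h.aestronglyMeasurable_coeff α) α,
    fun t ht => Finset.aestronglyMeasurable_fun_sum _ fun α hα => hm α hα t ht,
    Decay.sum _ hm fun α hα => decay_mul_gDeriv h.nonneg ?_⟩
  simpa using h.exists_abs_coeff_le_rpow ((mem_indicesUpTo h.nonneg α).1 hα)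

theorem approx_props (h : DecayingSolution p A K Ap a φ u) (n : ℕ) :
    JointlyMeasurable (approx a p φ K u n) ∧
      (∀ t > 0, AEStronglyMeasurable (approx a p φ K u n t)) ∧
      Decay K 0 (approx a p φ K u n) := by
  obtain ⟨h0, h1, h2⟩ := h.approx_zero_props
  induction n with
  | zero => exact ⟨h0, h1, h2⟩
  | succ n ih =>
    have hF := (h.isSource_of_decay ih.1 ih.2.2).momentProj h.nonneg
    have hd : ∀ t > 0, AEStronglyMeasurable
        (duhamel (fun s => momentProj K s (powerTerm a p (approx a p φ K u n) s)) t) :=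
      fun t ht => hF.meas.duhamel_at ht.le
    exact ⟨h0.add hF.meas.jointlyMeasurable_duhamel, fun t ht => (h1 t ht).add (hd t ht),
      h2.add (hF.decay_duhamel h.nonneg h.pos) h1 hd⟩

theorem isSource_approx (h : DecayingSolution p A K Ap a φ u) (n : ℕ) :
    IsSource K Ap (powerTerm a p (approx a p φ K u n)) :=
  h.isSource_of_decay (h.approx_props n).1 (h.approx_props n).2.2

theorem sub_approx_zero (h : DecayingSolution p A K Ap a φ u) {t : ℝ} (ht : 0 < t)
    (x : Space N) :
    u t x - approx a p φ K u 0 t x = remainder K φ (powerTerm a p u) t x := by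
  rw [remainder_eq h.nonneg h.pos.le h.integrable_initial h.isSource ht, h.eq t ht]
  rfl

theorem sub_approx_succ (h : DecayingSolution p A K Ap a φ u) (n : ℕ) {t : ℝ} (ht : 0 < t)
    (x : Space N) :
    u t x - approx a p φ K u (n + 1) t x = remainder K φ
      (fun s x => powerTerm a p u s x - powerTerm a p (approx a p φ K u n) s x) t x := by
  rw [remainder_sub h.nonneg h.pos.le h.isSource (h.isSource_approx n) ht, approx_succ,
    ← h.sub_approx_zero ht]
  ring

theorem approx_succ_eq (h : DecayingSolution p A K Ap a φ u) (n : ℕ) {t : ℝ} (ht : 0 < t)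
    (x : Space N) :
    approx a p φ K u (n + 1) t x =
      (∑ α ∈ indicesUpTo N K, (moment α φ 0 + ∫ s in (0 : ℝ)..t,
        moment α (fun y => powerTerm a p u s y - powerTerm a p (approx a p φ K u n) s y) s) *
          gDeriv α t x) + duhamel (powerTerm a p (approx a p φ K u n)) t x := by
  have e := h.sub_approx_succ n ht x
  rw [remainder_eq h.nonneg h.pos.le h.integrable_initial (h.isSource.sub (h.isSource_approx n)) ht,
    h.eq t ht, h.isSource.duhamel_sub h.pos.le (h.isSource_approx n) ht] at e
  linarith

/-- A source of decay `γ` for `u - U_n` gives decay `σ` of that difference, hence by the Lipschitz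
bound a source of decay `A_p + σ` for `u - U_{n+1}`. The exponent is exactly `(n+1) A_p` until it
passes `K/2`, after which its value is immaterial; the disjunction records this. -/
theorem exists_source_sub_approx (h : DecayingSolution p A K Ap a φ u) (n : ℕ) :
    ∃ (f : ℝ → Space N → ℝ) (γ : ℝ), IsSource K γ f ∧ 0 < γ ∧
      (γ = ((n : ℝ) + 1) * Ap ∨ K / 2 < γ) ∧
      ∀ t > 0, ∀ x, u t x - approx a p φ K u n t x = remainder K φ f t x := by
  induction n with
  | zero =>
    exact ⟨_, Ap, h.isSource, h.pos, Or.inl (by simp), fun t ht x => h.sub_approx_zero ht x⟩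
  | succ n ih =>
    obtain ⟨f, γ, hf, hγ, hγ', he⟩ := ih
    obtain ⟨σ, hσγ, hσK, hσ, hσ'⟩ := exists_decay_exponent K γ h.pos
    have hdec : Decay K σ fun t x => u t x - approx a p φ K u n t x :=
      (hf.decay_remainder_of_le h.nonneg h.initial_meas h.initial_lt_top hσγ hσK hσ).congr
        fun t ht x => (he t ht x).symm
    have hp := h.pos
    have hK := h.nonneg
    refine ⟨_, Ap + σ, h.isSource_sub (h.approx_props n).1 (h.approx_props n).2.2 hdec, ?_, ?_,
      fun t ht x => h.sub_approx_succ n ht x⟩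
    · rcases hσ' with rfl | h1 <;> linarith
    · rcases hσ' with rfl | h1
      · rcases hγ' with rfl | h2
        · left
          push_cast
          ring
        · right
          linarith
      · exact Or.inr h1

theorem rate_sub_approx (h : DecayingSolution p A K Ap a φ u) (n : ℕ) :
    Rate K (((n : ℝ) + 1) * Ap)
      fun t => xnorm K (t + 1) fun x => u t x - approx a p φ K u n t x := by
  obtain ⟨f, γ, hf, hγ, hγ', he⟩ := h.exists_source_sub_approx n
  refine ((hf.rate_remainder h.nonneg h.initial_meas h.initial_lt_top hγ.le).of_lt hγ').mono
    one_pos ?_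
  filter_upwards [eventually_gt_atTop 0] with t ht
  rw [show (fun x => u t x - approx a p φ K u n t x) = _ from funext (he t ht)]
  simp

/-! #### The mass -/

theorem exists_abs_coeff_sub_integral_le (h : DecayingSolution p A K Ap a φ u) {α : MultiIndex N}
    (hα : (order α : ℝ) ≤ K) (hlt : (order α : ℝ) / 2 < Ap) :
    ∃ C : ℝ, 0 ≤ C ∧ ∀ t > 0, |coeff a p φ u α t - (moment α φ 0 +
      ∫ s in Ioi (0 : ℝ), moment α (powerTerm a p u s) s)| ≤
        C * (t + 1) ^ ((order α : ℝ) / 2 - Ap) := by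
  obtain ⟨C, hC, hb⟩ := h.isSource.exists_ae_abs_moment_le hα
  have hβ : (order α : ℝ) / 2 - Ap < 0 := by linarith
  refine ⟨C * (-((order α : ℝ) / 2 - Ap))⁻¹, mul_nonneg hC (inv_nonneg.2 (by linarith)),
    fun t ht => ?_⟩
  rw [coeff, add_sub_add_left_eq_sub]
  exact abs_intervalIntegral_sub_integral_Ioi_le hC hβ
    (h.isSource.integrableOn_Ioi_moment hα hlt) hb ht.le

theorem exists_abs_coeff_zero_sub_le (h : DecayingSolution p A K Ap a φ u) :
    ∃ C : ℝ, 0 ≤ C ∧ ∀ t > 0, |coeff a p φ u 0 t - totalMass a p φ u| ≤ C * (t + 1) ^ (-Ap) := by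
  have h0 : (order (0 : MultiIndex N) : ℝ) = 0 := by exact_mod_cast order_zero
  have := h.exists_abs_coeff_sub_integral_le (α := 0) (by rw [h0]; exact h.nonneg)
    (by rw [h0, zero_div]; exact h.pos)
  simpa [h0, moment_zero, totalMass, order_zero] using this

theorem tendsto_coeff_zero (h : DecayingSolution p A K Ap a φ u) :
    Tendsto (coeff a p φ u 0) atTop (𝓝 (totalMass a p φ u)) := by
  obtain ⟨C, hC, hb⟩ := h.exists_abs_coeff_zero_sub_le
  rw [tendsto_iff_norm_sub_tendsto_zero]
  have h1 : Tendsto (fun t : ℝ => C * t ^ (-Ap)) atTop (𝓝 (C * 0)) :=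
    (tendsto_rpow_neg_atTop h.pos).const_mul C
  rw [mul_zero] at h1
  refine squeeze_zero' (Eventually.of_forall fun t => norm_nonneg _) ?_ h1
  filter_upwards [eventually_gt_atTop 0] with t ht
  exact (hb t ht).trans (mul_le_mul_of_nonneg_left (add_one_rpow_le ht h.pos.le) hC)

theorem massTerm_eq (a : ℝ → Space N → ℝ) (p : ℝ) (φ : Space N → ℝ) (u : ℝ → Space N → ℝ) :
    massTerm a p φ u = powerTerm a p fun t x => totalMass a p φ u * gDeriv 0 t x := by
  simp_rw [gDeriv_zero]
  rfl

theorem jointlyMeasurable_mass_mul (M : ℝ) :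
    JointlyMeasurable fun t x => M * gDeriv (0 : MultiIndex N) t x :=
  JointlyMeasurable.coeff_mul_gDeriv aestronglyMeasurable_const 0

theorem decay_mass_mul {K : ℝ} (hK : 0 ≤ K) (M : ℝ) :
    Decay K 0 fun t x => M * gDeriv (0 : MultiIndex N) t x :=
  decay_mul_gDeriv hK ⟨|M|, abs_nonneg _, fun t _ => by simp [order_zero]⟩

theorem isSource_massTerm (h : DecayingSolution p A K Ap a φ u) {K' : ℝ} (hK' : 0 ≤ K') :
    IsSource K' Ap (massTerm a p φ u) := by
  rw [massTerm_eq]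
  exact h.coefficient.isSource_powerTerm h.one_le h.exponent (jointlyMeasurable_mass_mul _)
    (decay_mass_mul hK' _)

theorem isSource_sub_massTerm (h : DecayingSolution p A K Ap a φ u) {σ : ℝ}
    (hσ : Decay K σ fun t x => u t x - totalMass a p φ u * shiftedKernel t x) :
    IsSource K (Ap + σ) fun t x => powerTerm a p u t x - massTerm a p φ u t x := by
  rw [massTerm_eq]
  refine h.isSource_sub (jointlyMeasurable_mass_mul _) (decay_mass_mul h.nonneg _) ?_
  simpa only [gDeriv_zero] using hσ

theorem sub_mass_mul_eq (h : DecayingSolution p A K Ap a φ u) {t : ℝ} (ht : 0 < t)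
    (x : Space N) :
    u t x - totalMass a p φ u * shiftedKernel t x =
      (remainder K φ (powerTerm a p u) t x +
        (coeff a p φ u 0 t - totalMass a p φ u) * gDeriv 0 t x) +
        ∑ α ∈ (indicesUpTo N K).erase 0, coeff a p φ u α t * gDeriv α t x := by
  rw [← h.sub_approx_zero ht, ← gDeriv_zero]
  have : approx a p φ K u 0 t x = coeff a p φ u 0 t * gDeriv 0 t x +
      ∑ α ∈ (indicesUpTo N K).erase 0, coeff a p φ u α t * gDeriv α t x :=
    (Finset.add_sum_erase _ (fun α => coeff a p φ u α t * gDeriv α t x)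
      (zero_mem_indicesUpTo h.nonneg)).symm
  rw [this]
  ring

theorem decay_coeff_zero_sub (h : DecayingSolution p A K Ap a φ u) :
    Decay K Ap fun t (x : Space N) =>
      (coeff a p φ u 0 t - totalMass a p φ u) * gDeriv 0 t x := by
  refine decay_mul_gDeriv h.nonneg ?_
  simpa [order_zero] using h.exists_abs_coeff_zero_sub_le

theorem aestronglyMeasurable_remainder (h : DecayingSolution p A K Ap a φ u) {γ : ℝ}
    {f : ℝ → Space N → ℝ} (hf : IsSource K γ f) :
    ∀ t > 0, AEStronglyMeasurable (remainder K φ f t) := fun t ht =>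
  (aestronglyMeasurable_heatFlow t
    (aestronglyMeasurable_momentProj (by norm_num) h.initial_meas)).add
    (hf.aestronglyMeasurable_duhamel_momentProj ht)

theorem aestronglyMeasurable_tail : ∀ t > 0, AEStronglyMeasurable (fun x : Space N =>
    ∑ α ∈ (indicesUpTo N K).erase 0, coeff a p φ u α t * gDeriv α t x) volume := fun _ ht =>
  Finset.aestronglyMeasurable_fun_sum _ fun α _ => aestronglyMeasurable_mul_gDeriv _ α ht

theorem decay_sub_mass_mul (h : DecayingSolution p A K Ap a φ u) {σ : ℝ}
    (hr : Decay K σ (remainder K φ (powerTerm a p u))) (hσ : σ ≤ Ap)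
    (htail : Decay K σ fun t x =>
      ∑ α ∈ (indicesUpTo N K).erase 0, coeff a p φ u α t * gDeriv α t x) :
    Decay K σ fun t x => u t x - totalMass a p φ u * shiftedKernel t x := by
  have hm := h.aestronglyMeasurable_remainder h.isSource
  have hm0 : ∀ t > 0, AEStronglyMeasurable (fun x : Space N =>
    (coeff a p φ u 0 t - totalMass a p φ u) * gDeriv 0 t x) volume :=
    fun t ht => aestronglyMeasurable_mul_gDeriv _ _ ht
  exact ((hr.add (h.decay_coeff_zero_sub.mono hσ) hm hm0).add htail
    (fun t ht => (hm t ht).add (hm0 t ht)) aestronglyMeasurable_tail).congr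
    fun t ht x => (h.sub_mass_mul_eq ht x).symm

/-! #### The case `K < 1` -/

theorem tail_eq_zero (hK : 0 ≤ K) (hK1 : K < 1) (t : ℝ) (x : Space N) :
    ∑ α ∈ (indicesUpTo N K).erase 0, coeff a p φ u α t * gDeriv α t x = 0 := by
  rw [indicesUpTo_of_lt_one hK hK1]
  simp

theorem rate_sub_mass_mul (h : DecayingSolution p A K Ap a φ u) (hK1 : K < 1) :
    Rate K Ap fun t => xnorm K (t + 1) fun x => u t x - totalMass a p φ u * shiftedKernel t x := by
  refine ((h.isSource.rate_remainder h.nonneg h.initial_meas h.initial_lt_top h.pos.le).add_big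
    (h.decay_coeff_zero_sub.big h.pos.le)).mono one_pos ?_
  filter_upwards [eventually_gt_atTop 0] with t ht
  simp_rw [h.sub_mass_mul_eq ht, tail_eq_zero h.nonneg hK1, add_zero]
  rw [ENNReal.ofReal_one, one_mul]
  exact xnorm_add_le (h.aestronglyMeasurable_remainder h.isSource t ht)
    (aestronglyMeasurable_mul_gDeriv _ _ ht)

theorem exists_decay_sub_mass_mul (h : DecayingSolution p A K Ap a φ u) (hK1 : K < 1) :
    ∃ σ : ℝ, (σ = Ap ∨ K / 2 < Ap + σ) ∧
      Decay K σ fun t x => u t x - totalMass a p φ u * shiftedKernel t x := by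
  obtain ⟨σ, hσγ, hσK, hσ, hσ'⟩ := exists_decay_exponent K Ap h.pos
  refine ⟨σ, hσ', h.decay_sub_mass_mul (h.isSource.decay_remainder_of_le h.nonneg h.initial_meas
    h.initial_lt_top hσγ hσK hσ) hσγ ?_⟩
  exact (Decay.zero K σ).congr fun t _ x => (tail_eq_zero h.nonneg hK1 t x).symm

/-- For `K = 0` the rate reads `u - M g = o(1)` in a norm that dominates `L¹`, and `g` has mass one.
-/
theorem tendsto_integral (h : DecayingSolution p A K Ap a φ u) :
    Tendsto (fun t => ∫ x, u t x) atTop (𝓝 (totalMass a p φ u)) := by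
  have h0 := h.zero
  have hp := h.pos
  have hs := ((h0.rate_sub_mass_mul zero_lt_one).1 (by simpa using h.pos.ne')).small
    (by simpa using h.pos)
  rw [Metric.tendsto_atTop']
  intro ε hε
  obtain ⟨T, hT⟩ := eventually_atTop.1 ((hs (ε / 2) (by positivity)).and (eventually_gt_atTop 0))
  refine ⟨T, fun t ht => ?_⟩
  obtain ⟨hle, ht0⟩ := hT t ht.le
  obtain ⟨C, hC, hd⟩ := h0.decay
  have hg : Integrable (shiftedKernel t : Space N → ℝ) := by
    rw [← gDeriv_zero]
    exact integrable_gDeriv 0 (by linarith)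
  have hui : Integrable (u t) := integrable_of_wnorm_lt_top (h.meas_at t ht0)
    ((wnorm_le_xnorm _ _ _).trans_lt ((hd t ht0).trans_lt ENNReal.ofReal_lt_top))
  have e : (∫ x, u t x) - totalMass a p φ u =
      ∫ x, (u t x - totalMass a p φ u * shiftedKernel t x) := by
    rw [integral_sub hui (hg.const_mul _), integral_const_mul]
    unfold shiftedKernel
    rw [integral_heatKernel (by linarith), mul_one]
  rw [Real.dist_eq, e]
  have h1 : ‖∫ x, (u t x - totalMass a p φ u * shiftedKernel t x)‖ₑ ≤ ENNReal.ofReal (ε / 2) := by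
    refine (enorm_integral_le_lintegral_enorm _).trans
      (((lintegral_le_wnorm 0 (t + 1) _).trans (wnorm_le_xnorm _ _ _)).trans (hle.trans_eq ?_))
    simp
  rw [Real.enorm_eq_ofReal_abs, ENNReal.ofReal_le_ofReal_iff (by positivity)] at h1
  linarith

/-- For `K < 1` the only moment is the mass, so `u - ũ` is the remainder with source `f - f_M` minus
`g` times the part of the mass of that source still to come after time `t`. Since `u - M g` is
`O(t^(-σ))`, both terms are governed by `γ = A_p + σ`, which is `2 A_p` or exceeds `K/2`. -/
theorem rate_sub_profile (h : DecayingSolution p A K Ap a φ u) (hK1 : K < 1) :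
    Rate K (2 * Ap) fun t => xnorm K (t + 1) fun x => u t x - profile a p φ u t x := by
  obtain ⟨σ, hσ, hd⟩ := h.exists_decay_sub_mass_mul hK1
  set γ := Ap + σ with hγ
  have hp := h.pos
  have hK := h.nonneg
  have hγ0 : 0 < γ := by rcases hσ with h1 | h1 <;> linarith
  have hf := h.isSource_sub_massTerm hd
  have h0 : (order (0 : MultiIndex N) : ℝ) = 0 := by exact_mod_cast order_zero
  have hα : (order (0 : MultiIndex N) : ℝ) ≤ K := by rw [h0]; exact hK
  obtain ⟨C, hC, hb⟩ := hf.exists_ae_abs_moment_le hα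
  have hint := hf.integrableOn_Ioi_moment hα (by rw [h0]; linarith)
  simp only [h0, zero_div, zero_sub, moment_zero] at hb hint
  set m : ℝ → ℝ := fun s => ∫ x, (powerTerm a p u s x - massTerm a p φ u s x) with hm
  have htail : Decay K γ fun t (x : Space N) =>
      ((∫ s in (0 : ℝ)..t, m s) - ∫ s in Ioi 0, m s) * gDeriv 0 t x := by
    refine decay_mul_gDeriv hK ⟨C * (- -γ)⁻¹, by rw [neg_neg]; positivity, fun t ht => ?_⟩
    rw [h0, zero_div, zero_sub]
    exact abs_intervalIntegral_sub_integral_Ioi_le hC (by linarith) hint hb ht.le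
  refine (((hf.rate_remainder hK h.initial_meas h.initial_lt_top hγ0.le).add_big
    (htail.big hγ0.le)).of_lt ?_).mono one_pos ?_
  · rcases hσ with rfl | h1
    · left
      ring
    · exact Or.inr h1
  · filter_upwards [eventually_gt_atTop 0] with t ht
    have e : ∀ x, u t x - profile a p φ u t x = remainder K φ
        (fun s x => powerTerm a p u s x - massTerm a p φ u s x) t x +
        ((∫ s in (0 : ℝ)..t, m s) - ∫ s in Ioi 0, m s) * gDeriv 0 t x := by
      intro x
      rw [remainder_eq hK hγ0.le h.integrable_initial hf ht, indicesUpTo_of_lt_one hK hK1,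
        Finset.sum_singleton, h.isSource.duhamel_sub hp.le (h.isSource_massTerm hK) ht,
        h.eq t ht, profile, correctedMass]
      simp only [moment_zero, gDeriv_zero]
      ring
    rw [show (fun x => u t x - profile a p φ u t x) = _ from funext e, ENNReal.ofReal_one, one_mul]
    exact xnorm_add_le (h.aestronglyMeasurable_remainder hf t ht)
      (aestronglyMeasurable_mul_gDeriv _ _ ht)

end DecayingSolution


/-! ### Transfer of rates to the norms of the statement, and estimates for `1 ≤ K`. -/

theorem powInt_mono {β β' t : ℝ} (hβ : β ≤ β') (ht : 0 ≤ t) : powInt β t ≤ powInt β' t := by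
  refine intervalIntegral.integral_mono_on ht (intervalIntegrable_add_one_rpow le_rfl ht _)
    (intervalIntegrable_add_one_rpow le_rfl ht _) fun s hs => ?_
  exact Real.rpow_le_rpow_of_exponent_le (by linarith [hs.1]) (by linarith)

theorem exists_one_add_powInt_le {β δ : ℝ} (hδ : 0 ≤ δ) (hβ : β ≤ δ) (h : 0 < δ ∨ β < 0) :
    ∃ C : ℝ, 0 ≤ C ∧ ∀ t > 0, 1 + powInt β t ≤ C * (t + 1) ^ δ := by
  rcases hδ.eq_or_lt with rfl | hδ
  · have hβ0 := h.resolve_left (lt_irrefl _)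
    refine ⟨1 + (-β)⁻¹, add_nonneg zero_le_one (inv_nonneg.2 (by linarith)), fun t ht => ?_⟩
    rw [Real.rpow_zero, mul_one]
    gcongr
    exact powInt_le_of_neg hβ0 ht.le
  · refine ⟨1 + δ⁻¹, by positivity, fun t ht => ?_⟩
    rw [add_mul, one_mul]
    exact add_le_add (Real.one_le_rpow (by linarith) hδ.le)
      ((powInt_mono hβ ht.le).trans (powInt_le_of_pos hδ ht.le))

theorem add_one_rpow_le_two_rpow_mul {t β : ℝ} (ht : 1 ≤ t) (hβ : 0 ≤ β) :
    (t + 1) ^ β ≤ 2 ^ β * t ^ β := by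
  rw [← Real.mul_rpow zero_le_two (by linarith)]
  exact Real.rpow_le_rpow (by linarith) (by linarith) hβ

theorem eventually_one_le_log : ∀ᶠ t : ℝ in atTop, 1 ≤ Real.log t :=
  Real.tendsto_log_atTop.eventually_ge_atTop 1

theorem one_le_order_of_mem_erase {K : ℝ} {α : MultiIndex N} (hα : α ∈ (indicesUpTo N K).erase 0) :
    1 ≤ order α := by
  by_contra hlt
  have h0 : order α < 1 := not_le.1 hlt
  exact (Finset.mem_erase.1 hα).1 (eq_zero_of_order_lt_one zero_lt_one
    (by exact_mod_cast Nat.le_of_lt_succ h0))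

theorem Rate.scaledNorm {K γ l : ℝ} {w : ℝ → Space N → ℝ}
    (h : Rate K γ fun t => xnorm K (t + 1) (w t)) (hl : 0 ≤ l) (hlK : l ≤ K) {q : ℝ≥0∞}
    (hq : 1 ≤ q) : Rate K γ (HeatExpansion.scaledNorm q l w) := by
  obtain ⟨C, hC, hle⟩ := exists_scaledNorm_le (N := N) hl hlK hq
  exact h.mono hC ((eventually_ge_atTop 1).mono fun t ht => hle w t ht)

theorem Big.scaledNorm {K l : ℝ} {w : ℝ → Space N → ℝ} {r : ℝ → ℝ}
    (h : Big (fun t => xnorm K (t + 1) (w t)) r) (hl : 0 ≤ l) (hlK : l ≤ K) {q : ℝ≥0∞}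
    (hq : 1 ≤ q) : Big (HeatExpansion.scaledNorm q l w) r := by
  obtain ⟨C, hC, hle⟩ := exists_scaledNorm_le (N := N) hl hlK hq
  exact h.mono hC.le ((eventually_ge_atTop 1).mono fun t ht => hle w t ht)

theorem Decay.iSup_lt_top {K l : ℝ} {w : ℝ → Space N → ℝ} (h : Decay K 0 w) (hl : 0 ≤ l)
    (hlK : l ≤ K) {q : ℝ≥0∞} (hq : 1 ≤ q) :
    (⨆ t ∈ Ioi (0 : ℝ), ENNReal.ofReal (t ^ ((N : ℝ) / 2 * (1 - (q⁻¹).toReal))) *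
        eLpNorm (w t) q volume) +
      (⨆ t ∈ Ioi (0 : ℝ), ENNReal.ofReal ((1 + t) ^ (-l / 2)) * weightedNorm l (w t)) < ⊤ := by
  obtain ⟨C, hC, h⟩ := h
  have hb : ∀ t : ℝ, 0 < t → xnorm K (t + 1) (w t) ≤ ENNReal.ofReal C := fun t ht => by
    simpa using h t ht
  refine ENNReal.add_lt_top.2 ⟨?_, ?_⟩
  · refine lt_of_le_of_lt (b := ENNReal.ofReal C) (iSup₂_le fun t ht => ?_) ENNReal.ofReal_lt_top
    exact (rpow_mul_eLpNorm_le_xnorm ht (by linarith) hq (w t)).trans (hb t ht)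
  · refine lt_of_le_of_lt (b := 2 * ENNReal.ofReal C) (iSup₂_le fun t ht => ?_)
      (ENNReal.mul_lt_top (by simp) ENNReal.ofReal_lt_top)
    refine (one_add_rpow_mul_weightedNorm_le ht hl hlK (w t)).trans ?_
    gcongr
    exact (wnorm_le_xnorm _ _ _).trans (hb t ht)

/-- A source with two finite moments decays like `t ^ (-γ)`, `γ < 1`, once it is corrected and
the moments of order two are taken into account. -/
theorem IsSource.decay_duhamel_momentProj_one {γ : ℝ} (hγ : 0 ≤ γ) (hγ1 : γ < 1)
    {f : ℝ → Space N → ℝ} (hf : IsSource 2 γ f) (hf1 : IsSource 1 γ f) :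
    Decay 1 γ (duhamel fun s => HeatExpansion.momentProj 1 s (f s)) := by
  have hsub : indicesUpTo N 1 ⊆ indicesUpTo N 2 := fun α hα => by
    rw [mem_indicesUpTo (by norm_num)] at hα ⊢
    linarith
  -- With two moments the time integral has exponent `1 - γ > 0`, so no logarithm appears even for
  -- `γ = 1/2`. Passing from `P_2` back to `P_1` restores the terms with `|α| = 2`, which are of the
  -- same order `t^(-γ)`.
  have h2 := (Decay.of_powInt (hf.exists_xnorm_duhamel_momentProj_le zero_le_two)).1
    (by linarith)
  rw [sub_sub_cancel] at h2
  have hsum : Decay 1 γ fun t x => ∑ α ∈ indicesUpTo N 2 \ indicesUpTo N 1,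
      (∫ s in (0 : ℝ)..t, moment α (f s) s) * gDeriv α t x := by
    refine Decay.sum _ (fun α _ t ht => aestronglyMeasurable_mul_gDeriv _ α ht) fun α hα => ?_
    rw [Finset.mem_sdiff, mem_indicesUpTo zero_le_two, mem_indicesUpTo zero_le_one] at hα
    have ho : order α = 2 := by
      have h1 : order α ≤ 2 := by exact_mod_cast hα.1
      have h2 : ¬ order α ≤ 1 := fun h => hα.2 (by exact_mod_cast h)
      omega
    obtain ⟨C, hC, hb⟩ := hf.exists_ae_abs_moment_le hα.1
    refine decay_mul_gDeriv zero_le_one ⟨C * (1 - γ)⁻¹, mul_nonneg hC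
      (inv_nonneg.2 (by linarith)), fun t ht => (abs_intervalIntegral_le hb le_rfl ht.le).trans ?_⟩
    rw [mul_assoc]
    refine mul_le_mul_of_nonneg_left ?_ hC
    have e : (order α : ℝ) / 2 - γ = 1 - γ := by rw [ho]; norm_num
    rw [e]
    exact powInt_le_of_pos (by linarith) ht.le
  refine ((h2.of_le zero_le_one one_le_two).add hsum
    (fun t ht => hf.aestronglyMeasurable_duhamel_momentProj ht) fun t ht =>
    Finset.aestronglyMeasurable_fun_sum _ fun α _ => aestronglyMeasurable_mul_gDeriv _ α ht).congr
    fun t ht x => ?_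
  rw [hf.duhamel_momentProj zero_le_two hγ ht, hf1.duhamel_momentProj zero_le_one hγ ht,
    ← Finset.sum_sdiff hsub]
  ring

namespace DecayingSolution

variable {p A K Ap : ℝ} {a : ℝ → Space N → ℝ} {φ : Space N → ℝ} {u : ℝ → Space N → ℝ}

theorem isBigO_coeff_sub (h : DecayingSolution p A K Ap a φ u) {α : MultiIndex N}
    (hα : (order α : ℝ) ≤ K) (hlt : (order α : ℝ) / 2 < Ap) :
    ∃ c : ℝ, (fun t => |coeff a p φ u α t - c|) =O[atTop]
      fun t => t ^ (-Ap + (order α : ℝ) / 2) := by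
  obtain ⟨C, hC, hb⟩ := h.exists_abs_coeff_sub_integral_le hα hlt
  refine ⟨moment α φ 0 + ∫ s in Ioi (0 : ℝ), moment α (powerTerm a p u s) s,
    IsBigO.of_bound C ?_⟩
  filter_upwards [eventually_gt_atTop 0] with t ht
  rw [Real.norm_of_nonneg (abs_nonneg _), Real.norm_of_nonneg (by positivity)]
  refine (hb t ht).trans (mul_le_mul_of_nonneg_left ?_ hC)
  rw [show -Ap + (order α : ℝ) / 2 = -(Ap - (order α : ℝ) / 2) by ring,
    show (order α : ℝ) / 2 - Ap = -(Ap - (order α : ℝ) / 2) by ring]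
  exact add_one_rpow_le ht (by linarith)

theorem isBigO_coeff (h : DecayingSolution p A K Ap a φ u) {α : MultiIndex N}
    (hα : (order α : ℝ) ≤ K) (hlt : Ap < (order α : ℝ) / 2) :
    coeff a p φ u α =O[atTop] fun t => t ^ (-Ap + (order α : ℝ) / 2) := by
  obtain ⟨C, hC, hb⟩ := h.exists_abs_coeff_le hα
  have hβ : 0 < (order α : ℝ) / 2 - Ap := by linarith
  rw [show -Ap + (order α : ℝ) / 2 = (order α : ℝ) / 2 - Ap by ring]
  set β := (order α : ℝ) / 2 - Ap
  refine IsBigO.of_bound ((|moment α φ 0| + C * β⁻¹) * 2 ^ β) ?_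
  filter_upwards [eventually_ge_atTop 1] with t ht
  have ht0 : 0 < t := by linarith
  rw [Real.norm_eq_abs, Real.norm_of_nonneg (by positivity)]
  refine (hb t ht0).trans ?_
  have h1 : 1 ≤ (t + 1) ^ β := Real.one_le_rpow (by linarith) hβ.le
  calc |moment α φ 0| + C * powInt β t
      ≤ |moment α φ 0| * (t + 1) ^ β + C * (β⁻¹ * (t + 1) ^ β) := by
        refine add_le_add (le_mul_of_one_le_right (abs_nonneg _) h1) ?_
        gcongr
        exact powInt_le_of_pos hβ ht0.le
    _ = (|moment α φ 0| + C * β⁻¹) * (t + 1) ^ β := by ring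
    _ ≤ (|moment α φ 0| + C * β⁻¹) * (2 ^ β * t ^ β) := by
        gcongr
        exact add_one_rpow_le_two_rpow_mul ht hβ.le
    _ = _ := by ring

theorem isBigO_coeff_log (h : DecayingSolution p A K Ap a φ u) {α : MultiIndex N}
    (hα : (order α : ℝ) ≤ K) (heq : Ap = (order α : ℝ) / 2) :
    coeff a p φ u α =O[atTop] Real.log := by
  obtain ⟨C, hC, hb⟩ := h.exists_abs_coeff_le hα
  refine IsBigO.of_bound (|moment α φ 0| + C * 2) ?_
  filter_upwards [eventually_ge_atTop 2, eventually_one_le_log] with t ht hl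
  have ht0 : 0 < t := by linarith
  rw [Real.norm_eq_abs, Real.norm_of_nonneg (by linarith)]
  refine (hb t ht0).trans ?_
  rw [heq, sub_self, powInt_zero ht0.le, add_mul, mul_assoc]
  refine add_le_add (le_mul_of_one_le_right (abs_nonneg _) hl) ?_
  gcongr
  exact log_add_one_le ht

/-! #### The case `1 ≤ K` -/

/-- For `|α| ≥ 1` the growth of `c_α` beyond order one is exactly compensated by the decay of `g_α`,
so first order moments govern the whole tail. Dividing by the common factor `L` reduces the claim to
uniform decay of order `1/2`. -/
theorem exists_xnorm_tail_le (h : DecayingSolution p A K Ap a φ u) :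
    ∃ C : ℝ, 0 ≤ C ∧ ∀ t > 0, xnorm K (t + 1)
      (fun x => ∑ α ∈ (indicesUpTo N K).erase 0, coeff a p φ u α t * gDeriv α t x) ≤
        ENNReal.ofReal (C * (t + 1) ^ (-(1 / 2 : ℝ)) * (1 + powInt (1 / 2 - Ap) t)) := by
  set L : ℝ → ℝ := fun t => 1 + powInt (1 / 2 - Ap) t with hL
  have hL1 : ∀ t > 0, 1 ≤ L t := fun t ht => le_add_of_nonneg_right (powInt_nonneg _ (le_of_lt ht))
  have hm : ∀ α ∈ (indicesUpTo N K).erase 0, ∀ t > 0, AEStronglyMeasurable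
      (fun x => (coeff a p φ u α t / L t) * gDeriv α t x) :=
    fun α _ t ht => aestronglyMeasurable_mul_gDeriv _ α ht
  have hd : Decay K (1 / 2) fun t x =>
      ∑ α ∈ (indicesUpTo N K).erase 0, (coeff a p φ u α t / L t) * gDeriv α t x := by
    refine Decay.sum _ hm fun α hα => decay_mul_gDeriv h.nonneg ?_
    have hα1 : (1 : ℝ) ≤ order α := by exact_mod_cast one_le_order_of_mem_erase hα
    obtain ⟨C, hC, hb⟩ := h.exists_abs_coeff_le
      ((mem_indicesUpTo h.nonneg α).1 (Finset.mem_of_mem_erase hα))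
    refine ⟨|moment α φ 0| + C, by positivity, fun t ht => ?_⟩
    have hLt := hL1 t ht
    rw [abs_div, abs_of_pos (by linarith : 0 < L t), div_le_iff₀ (by linarith)]
    refine (hb t ht).trans ?_
    have h0 : 0 ≤ (order α : ℝ) / 2 - 1 / 2 := by linarith
    have h1 : 1 ≤ (t + 1) ^ ((order α : ℝ) / 2 - 1 / 2) := Real.one_le_rpow (by linarith) h0
    have h2 := powInt_add_le h0 (1 / 2 - Ap) ht.le
    rw [sub_add_sub_cancel] at h2
    have h3 : powInt (1 / 2 - Ap) t ≤ L t := le_add_of_nonneg_left zero_le_one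
    rw [mul_assoc, add_mul]
    refine add_le_add (le_mul_of_one_le_right (abs_nonneg _) (one_le_mul_of_one_le_of_one_le h1 hLt))
      (mul_le_mul_of_nonneg_left (h2.trans ?_) hC)
    gcongr
  obtain ⟨C, hC, hd⟩ := hd
  refine ⟨C, hC, fun t ht => ?_⟩
  have hLt := hL1 t ht
  have e : (fun x => ∑ α ∈ (indicesUpTo N K).erase 0, coeff a p φ u α t * gDeriv α t x) =
      fun x => L t * ∑ α ∈ (indicesUpTo N K).erase 0,
        (coeff a p φ u α t / L t) * gDeriv α t x := by
    ext x
    rw [Finset.mul_sum]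
    refine Finset.sum_congr rfl fun α _ => ?_
    rw [← mul_assoc, mul_div_cancel₀ _ (by linarith)]
  rw [e]
  refine (xnorm_const_mul_le _ (Finset.aestronglyMeasurable_fun_sum _ fun α hα =>
    hm α hα t ht)).trans ((mul_le_mul_right (hd t ht) _).trans_eq ?_)
  rw [Real.enorm_eq_ofReal (by linarith), ← ENNReal.ofReal_mul (by linarith), mul_comm]

/-- The parameter `δ` is the loss against `t^(-1/2)`: none for `A_p > 1/2`, `1/2 - A_p` for `A_p <
1/2`, and any positive amount in the critical case, where it absorbs the logarithm. -/
theorem decay_tail (h : DecayingSolution p A K Ap a φ u) {δ : ℝ} (hδ : 0 ≤ δ)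
    (hβ : 1 / 2 - Ap ≤ δ) (hlt : 0 < δ ∨ 1 / 2 < Ap) :
    Decay K (1 / 2 - δ) fun t (x : Space N) =>
      ∑ α ∈ (indicesUpTo N K).erase 0, coeff a p φ u α t * gDeriv α t x := by
  obtain ⟨C, hC, hb⟩ := h.exists_xnorm_tail_le
  obtain ⟨D, hD, hd⟩ := exists_one_add_powInt_le hδ hβ (hlt.imp_right fun h => by linarith)
  refine ⟨C * D, by positivity, fun t ht => (hb t ht).trans (ENNReal.ofReal_le_ofReal ?_)⟩
  have h1 : 0 < t + 1 := by linarith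
  calc C * (t + 1) ^ (-(1 / 2 : ℝ)) * (1 + powInt (1 / 2 - Ap) t)
      ≤ C * (t + 1) ^ (-(1 / 2 : ℝ)) * (D * (t + 1) ^ δ) := by
        gcongr
        exact hd t ht
    _ = C * D * ((t + 1) ^ (-(1 / 2 : ℝ)) * (t + 1) ^ δ) := by ring
    _ = _ := by
        rw [← Real.rpow_add h1]
        congr 2
        ring

theorem decay_sub_mass_mul_of_one_le (h : DecayingSolution p A K Ap a φ u) (hK1 : 1 ≤ K)
    {δ : ℝ} (hδ : 0 ≤ δ) (hβ : 1 / 2 - Ap ≤ δ) (hlt : 0 < δ ∨ 1 / 2 < Ap) :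
    Decay K (1 / 2 - δ) fun t x => u t x - totalMass a p φ u * shiftedKernel t x := by
  refine h.decay_sub_mass_mul (h.isSource.decay_remainder_of_le h.nonneg h.initial_meas
    h.initial_lt_top (by linarith) (by linarith) ?_) (by linarith) (h.decay_tail hδ hβ hlt)
  rcases hlt with h1 | h1
  · right
    linarith
  · left
    linarith

theorem xnorm_sub_mass_mul_le (h : DecayingSolution p A K Ap a φ u) {t : ℝ} (ht : 0 < t) :
    xnorm K (t + 1) (fun x => u t x - totalMass a p φ u * shiftedKernel t x) ≤
      xnorm K (t + 1) (remainder K φ (powerTerm a p u) t) +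
      xnorm K (t + 1)
        (fun x : Space N => (coeff a p φ u 0 t - totalMass a p φ u) * gDeriv 0 t x) +
      xnorm K (t + 1)
        (fun x => ∑ α ∈ (indicesUpTo N K).erase 0, coeff a p φ u α t * gDeriv α t x) := by
  have hm := h.aestronglyMeasurable_remainder h.isSource t ht
  have hm0 := aestronglyMeasurable_mul_gDeriv (coeff a p φ u 0 t - totalMass a p φ u)
    (0 : MultiIndex N) ht
  rw [show (fun x => u t x - totalMass a p φ u * shiftedKernel t x) = _ from
    funext (h.sub_mass_mul_eq ht)]
  refine (xnorm_add_le (hm.add hm0) (aestronglyMeasurable_tail t ht)).trans ?_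
  gcongr
  exact xnorm_add_le hm hm0

theorem big_sub_mass_mul_log (h : DecayingSolution p A K Ap a φ u) (hK1 : 1 ≤ K)
    (hAp : Ap = 1 / 2) :
    Big (fun t => xnorm K (t + 1) fun x => u t x - totalMass a p φ u * shiftedKernel t x)
      fun t => t ^ (-(1 : ℝ) / 2) * Real.log t := by
  have h1 : Big (fun t => xnorm K (t + 1) (remainder K φ (powerTerm a p u) t))
      fun t => t ^ (-(1 : ℝ) / 2) * Real.log t := by
    -- For `K = 1` the remainder is critical as well and contributes its own logarithm; for `K > 1`
    -- one has `A_p < K/2` and a pure power.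
    rcases hK1.eq_or_lt with h1 | h1
    · have := (h.isSource.rate_remainder h.nonneg h.initial_meas h.initial_lt_top h.pos.le).2
        (by rw [hAp, ← h1])
      rwa [← h1] at this ⊢
    · exact ((h.isSource.decay_remainder_of_le (σ := 1 / 2) h.nonneg h.initial_meas
        h.initial_lt_top hAp.ge (by linarith) (Or.inr (by linarith))).big (by norm_num)).rate
        (rpow_rate_log (by norm_num))
  have h2 := (h.decay_coeff_zero_sub.big h.pos.le).rate
    (rpow_rate_log (b := -(1 : ℝ) / 2) (by rw [hAp]; norm_num))
  have h3 : Big (fun t => xnorm K (t + 1) fun x : Space N =>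
      ∑ α ∈ (indicesUpTo N K).erase 0, coeff a p φ u α t * gDeriv α t x)
      fun t => t ^ (-(1 : ℝ) / 2) * Real.log t := by
    obtain ⟨C, hC, hb⟩ := h.exists_xnorm_tail_le
    refine ⟨C * 3, by positivity, ?_⟩
    filter_upwards [eventually_ge_atTop 2, eventually_one_le_log] with t ht hl
    refine (hb t (by linarith)).trans (ENNReal.ofReal_le_ofReal ?_)
    rw [hAp, sub_self, powInt_zero (by linarith), mul_assoc, mul_assoc C 3]
    refine mul_le_mul_of_nonneg_left ?_ hC
    calc (t + 1) ^ (-(1 / 2 : ℝ)) * (1 + Real.log (t + 1))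
        ≤ t ^ (-(1 / 2 : ℝ)) * (Real.log t + 2 * Real.log t) := by
          have hl' : 0 ≤ Real.log (t + 1) := Real.log_nonneg (by linarith)
          refine mul_le_mul (add_one_rpow_le (by linarith) (by norm_num))
            (add_le_add hl (log_add_one_le ht)) (by linarith) (Real.rpow_nonneg (by linarith) _)
      _ = _ := by
          rw [neg_div]
          ring
  refine ((h1.add h2).add h3).mono zero_le_one ?_
  filter_upwards [eventually_gt_atTop 0] with t ht
  rw [ENNReal.ofReal_one, one_mul]
  exact h.xnorm_sub_mass_mul_le ht

theorem isSource_sub_massTerm_critical (h : DecayingSolution p A K Ap a φ u) (hK1 : 1 ≤ K)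
    (hAp : Ap = 1 / 2) :
    IsSource K (3 / 4) fun t x => powerTerm a p u t x - massTerm a p φ u t x := by
  -- Any loss `0 < δ < 1/2` would serve: the source then has decay `1 - δ`, and only `1 - δ > 1/2`
  -- matters.
  have hd := h.decay_sub_mass_mul_of_one_le hK1 (δ := 1 / 4) (by norm_num) (by rw [hAp]; norm_num)
    (Or.inl (by norm_num))
  have := h.isSource_sub_massTerm hd
  rw [hAp] at this
  convert this using 1
  norm_num

/-- Only `K = 1` is delicate. There `f` is split as `(f - f_M) + f_M`. The first part has decay `3/4
> K/2`. The second inherits Gaussian decay in space, so its second moments are available although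
those of `φ` need not be, and the estimate at `K = 2` avoids the logarithm. -/
theorem decay_remainder_critical (h : DecayingSolution p A K Ap a φ u) (hK1 : 1 ≤ K)
    (hAp : Ap = 1 / 2) : Decay K (1 / 2) (remainder K φ (powerTerm a p u)) := by
  rcases hK1.eq_or_lt with rfl | h1
  · have hs := h.isSource_sub_massTerm_critical le_rfl hAp
    have hm1 := h.isSource_massTerm zero_le_one
    have hd := (h.isSource_massTerm zero_le_two).decay_duhamel_momentProj_one h.pos.le
      (by rw [hAp]; norm_num) hm1
    rw [hAp] at hd
    refine ((hs.decay_remainder_of_le (σ := 1 / 2) h.nonneg h.initial_meas h.initial_lt_top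
      (by norm_num) le_rfl (Or.inl (by norm_num))).add hd
      (h.aestronglyMeasurable_remainder hs) fun t ht =>
        hm1.aestronglyMeasurable_duhamel_momentProj ht).congr fun t ht x => ?_
    rw [remainder_sub h.nonneg h.pos.le h.isSource hm1 ht]
    ring
  · exact h.isSource.decay_remainder_of_le h.nonneg h.initial_meas h.initial_lt_top hAp.ge
      (by linarith) (Or.inr (by linarith))

/-- The first moments of `f - f_M` are integrable in time since `3/4 > 1/2`, and those of `f_M` by
hypothesis; hence `c_α` stays bounded for `|α| = 1`. For `|α| ≥ 2` the growth is a pure power and no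
hypothesis is needed. -/
theorem decay_tail_critical (h : DecayingSolution p A K Ap a φ u) (hK1 : 1 ≤ K)
    (hAp : Ap = 1 / 2) (hint : ∀ α : MultiIndex N, order α = 1 →
      IntegrableOn (fun t => moment α (massTerm a p φ u t) t) (Ioi 0)) :
    Decay K (1 / 2) fun t (x : Space N) =>
      ∑ α ∈ (indicesUpTo N K).erase 0, coeff a p φ u α t * gDeriv α t x := by
  refine Decay.sum _ (fun α _ t ht => aestronglyMeasurable_mul_gDeriv _ α ht) fun α hα =>
    decay_mul_gDeriv h.nonneg ?_
  have hαK := (mem_indicesUpTo h.nonneg α).1 (Finset.mem_of_mem_erase hα)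
  rcases (one_le_order_of_mem_erase hα).eq_or_lt with h1 | h1
  · have hs := h.isSource_sub_massTerm_critical hK1 hAp
    have hm := h.isSource_massTerm h.nonneg
    have hi : IntegrableOn (fun s => moment α (powerTerm a p u s) s) (Ioi 0) := by
      refine ((hs.integrableOn_Ioi_moment hαK (by rw [← h1]; norm_num)).add
        (hint α h1.symm)).congr ?_
      filter_upwards [h.isSource.ae_integrable_monomial, hm.ae_integrable_monomial] with s hs hs'
      simp only [Pi.add_apply]
      rw [moment_sub hαK hs hs']
      ring
    refine ⟨|moment α φ 0| + ∫ s in Ioi 0, |moment α (powerTerm a p u s) s|,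
      add_nonneg (abs_nonneg _) (integral_nonneg fun _ => abs_nonneg _), fun t ht => ?_⟩
    rw [← h1, Nat.cast_one, sub_self, Real.rpow_zero, mul_one]
    refine (abs_add_le _ _).trans ?_
    gcongr
    rw [intervalIntegral.integral_of_le (le_of_lt ht)]
    refine abs_integral_le_integral_abs.trans ?_
    exact setIntegral_mono_set hi.abs (Eventually.of_forall fun _ => abs_nonneg _)
      (Ioc_subset_Ioi_self.eventuallyLE)
  · obtain ⟨C, hC, hb⟩ := h.exists_abs_coeff_le hαK
    have h2 : (2 : ℝ) ≤ order α := by exact_mod_cast h1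
    have h0 : 0 < (order α : ℝ) / 2 - 1 / 2 := by linarith
    refine ⟨|moment α φ 0| + C * ((order α : ℝ) / 2 - 1 / 2)⁻¹, by positivity,
      fun t ht => (hb t ht).trans ?_⟩
    rw [hAp, add_mul, mul_assoc]
    refine add_le_add (le_mul_of_one_le_right (abs_nonneg _)
      (Real.one_le_rpow (by linarith) h0.le)) (mul_le_mul_of_nonneg_left ?_ hC)
    exact powInt_le_of_pos h0 (le_of_lt ht)

theorem isBigOAddBigOInf_of_ne (h : DecayingSolution p A K Ap a φ u) (hK1 : 1 ≤ K)
    (hne : Ap ≠ 1 / 2) {q : ℝ≥0∞} (hq : 1 ≤ q) {l : ℝ} (hl : 0 ≤ l) (hlK : l ≤ K) :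
    IsBigOAddBigOInf
      (scaledNorm q l fun t x => u t x - totalMass a p φ u * shiftedKernel t x)
      (fun t => t ^ (-(1 : ℝ) / 2)) (fun t => t ^ (-Ap)) := by
  rcases hne.lt_or_gt with h1 | h1
  · have hd := h.decay_sub_mass_mul_of_one_le hK1 (δ := 1 / 2 - Ap) (by linarith) le_rfl
      (Or.inl (by linarith))
    rw [sub_sub_cancel] at hd
    exact ((hd.big h.pos.le).scaledNorm hl hlK hq).isBigOAddBigOInf_right _
  · have hd := h.decay_sub_mass_mul_of_one_le hK1 (δ := 0) le_rfl (by linarith) (Or.inr h1)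
    rw [sub_zero] at hd
    have := (hd.big (by norm_num)).scaledNorm hl hlK hq
    rw [← neg_div] at this
    exact this.isBigOAddBigOInf_left _

theorem isBigOAddBigOInf_of_integrableOn (h : DecayingSolution p A K Ap a φ u) (hK1 : 1 ≤ K)
    (hint : ∀ α : MultiIndex N, order α = 1 →
      IntegrableOn (fun t => moment α (massTerm a p φ u t) t) (Ioi 0))
    {q : ℝ≥0∞} (hq : 1 ≤ q) {l : ℝ} (hl : 0 ≤ l) (hlK : l ≤ K) :
    IsBigOAddBigOInf
      (scaledNorm q l fun t x => u t x - totalMass a p φ u * shiftedKernel t x)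
      (fun t => t ^ (-(1 : ℝ) / 2)) (fun t => t ^ (-Ap)) := by
  rcases eq_or_ne Ap (1 / 2) with hAp | hAp
  · have hd := h.decay_sub_mass_mul (h.decay_remainder_critical hK1 hAp) hAp.ge
      (h.decay_tail_critical hK1 hAp hint)
    have := (hd.big (by norm_num)).scaledNorm hl hlK hq
    rw [← neg_div] at this
    exact this.isBigOAddBigOInf_left _
  · exact h.isBigOAddBigOInf_of_ne hK1 hAp hq hl hlK

end DecayingSolution

end HeatExpansion

/-! ### Assembly of the theorem. -/

theorem theorem6p1 (N : ℕ) (hN : 1 ≤ N) (p A K Ap : ℝ) (hp : 1 ≤ p) (hK : 0 ≤ K)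
    (hAp : Ap = -A + (N : ℝ) * (p - 1) / 2 - 1) (hAp_pos : 0 < Ap)
    (a : ℝ → Space N → ℝ)
    (ha_meas : AEStronglyMeasurable (fun z : ℝ × Space N => a z.1 z.2)
      ((volume.restrict (Ioi 0)).prod volume))
    (ha : essSup (fun t => ENNReal.ofReal ((1 + t) ^ (-A)) * eLpNorm (a t) ⊤ volume)
      (volume.restrict (Ioi 0)) < ⊤)
    (φ : Space N → ℝ) (hφ_top : MemLp φ ⊤ volume) (hφ_K : MemWeighted K φ)
    (u : ℝ → Space N → ℝ) (hu : IsSolution a p φ u)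
    (hu_decay : (⨆ t ∈ Ioi (0 : ℝ),
      ENNReal.ofReal ((1 + t) ^ ((N : ℝ) / 2)) * eLpNorm (u t) ⊤ volume) < ⊤) :
    -- (0) the integrals in the definitions of `c_α`, `U_n`, `M`, `M'`, `ũ` converge
    ((∀ᵐ s ∂volume.restrict (Ioi (0 : ℝ)), MemWeighted K (powerTerm a p u s)) ∧
      (∀ α : MultiIndex N, (order α : ℝ) ≤ K → ∀ t > 0,
        IntervalIntegrable (fun s => moment α (powerTerm a p u s) s) volume 0 t) ∧
      (∀ n : ℕ,
        (∀ t > 0, AEStronglyMeasurable (approx a p φ K u n t) volume) ∧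
        (∀ᵐ s ∂volume.restrict (Ioi (0 : ℝ)),
          MemWeighted K (powerTerm a p (approx a p φ K u n) s)) ∧
        (∀ t > 0, ∀ x,
          DuhamelIntegrable (powerTerm a p (approx a p φ K u n)) t x ∧
          DuhamelIntegrable
            (fun s => momentProj K s (powerTerm a p (approx a p φ K u n) s)) t x)) ∧
      Integrable (fun z : ℝ × Space N => powerTerm a p u z.1 z.2)
        ((volume.restrict (Ioi 0)).prod volume) ∧
      Integrable (fun z : ℝ × Space N => massTerm a p φ u z.1 z.2)
        ((volume.restrict (Ioi 0)).prod volume) ∧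
      (∀ t > 0, AEStronglyMeasurable (profile a p φ u t) volume) ∧
      (∀ t > 0, ∀ x, DuhamelIntegrable (massTerm a p φ u) t x)) ∧
    -- (1) behaviour of the coefficients `c_α`
    (∀ α : MultiIndex N, (order α : ℝ) ≤ K →
      (Ap > (order α : ℝ) / 2 → ∃ c : ℝ,
        (fun t => |coeff a p φ u α t - c|) =O[atTop]
          fun t => t ^ (-Ap + (order α : ℝ) / 2)) ∧
      (Ap < (order α : ℝ) / 2 →
        coeff a p φ u α =O[atTop] fun t => t ^ (-Ap + (order α : ℝ) / 2)) ∧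
      (Ap = (order α : ℝ) / 2 → coeff a p φ u α =O[atTop] Real.log)) ∧
    -- (2) the second formula for `U_n`, `n ≥ 1`, and the expansion of `u`
    (∀ n : ℕ, ∀ t > 0, ∀ x,
      approx a p φ K u (n + 1) t x =
        (∑ α ∈ indicesUpTo N K,
          (moment α φ 0 + ∫ s in (0 : ℝ)..t,
            moment α (fun y => powerTerm a p u s y -
              powerTerm a p (approx a p φ K u n) s y) s) * gDeriv α t x) +
        duhamel (powerTerm a p (approx a p φ K u n)) t x) ∧
    (∀ n : ℕ, ∀ q : ℝ≥0∞, 1 ≤ q → ∀ l : ℝ, 0 ≤ l → l ≤ K →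
      (⨆ t ∈ Ioi (0 : ℝ), ENNReal.ofReal (t ^ ((N : ℝ) / 2 * (1 - (q⁻¹).toReal))) *
          eLpNorm (approx a p φ K u n t) q volume) +
        (⨆ t ∈ Ioi (0 : ℝ), ENNReal.ofReal ((1 + t) ^ (-l / 2)) *
          weightedNorm l (approx a p φ K u n t)) < ⊤ ∧
      (((n : ℝ) + 1) * Ap ≠ K / 2 →
        IsLittleOAddBigOInf
          (scaledNorm q l fun t x => u t x - approx a p φ K u n t x)
          (fun t => t ^ (-K / 2)) (fun t => t ^ (-(((n : ℝ) + 1) * Ap)))) ∧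
      (((n : ℝ) + 1) * Ap = K / 2 →
        IsBigOInf
          (scaledNorm q l fun t x => u t x - approx a p φ K u n t x)
          (fun t => t ^ (-K / 2) * Real.log t))) ∧
    -- (3) convergence to `M g`
    Tendsto (fun t => ∫ x, u t x) atTop (𝓝 (totalMass a p φ u)) ∧
    Tendsto (coeff a p φ u 0) atTop (𝓝 (totalMass a p φ u)) ∧
    (∀ q : ℝ≥0∞, 1 ≤ q → ∀ l : ℝ, 0 ≤ l → l ≤ K →
      (K < 1 → Ap ≠ K / 2 →
        IsLittleOAddBigOInf
          (scaledNorm q l fun t x => u t x - totalMass a p φ u * shiftedKernel t x)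
          (fun t => t ^ (-K / 2)) (fun t => t ^ (-Ap))) ∧
      (K < 1 → Ap = K / 2 →
        IsBigOInf
          (scaledNorm q l fun t x => u t x - totalMass a p φ u * shiftedKernel t x)
          (fun t => t ^ (-K / 2) * Real.log t)) ∧
      (1 ≤ K → Ap ≠ 1 / 2 →
        IsBigOAddBigOInf
          (scaledNorm q l fun t x => u t x - totalMass a p φ u * shiftedKernel t x)
          (fun t => t ^ (-(1 : ℝ) / 2)) (fun t => t ^ (-Ap))) ∧
      (1 ≤ K → Ap = 1 / 2 →
        IsBigOInf
          (scaledNorm q l fun t x => u t x - totalMass a p φ u * shiftedKernel t x)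
          (fun t => t ^ (-(1 : ℝ) / 2) * Real.log t)) ∧
      (1 ≤ K →
        (∀ α : MultiIndex N, order α = 1 →
          IntegrableOn (fun t => moment α (massTerm a p φ u t) t) (Ioi 0)) →
        IsBigOAddBigOInf
          (scaledNorm q l fun t x => u t x - totalMass a p φ u * shiftedKernel t x)
          (fun t => t ^ (-(1 : ℝ) / 2)) (fun t => t ^ (-Ap)))) ∧
    -- (4) the refined profile for `K < 1`
    (K < 1 → ∀ q : ℝ≥0∞, 1 ≤ q → ∀ l : ℝ, 0 ≤ l → l ≤ K →
      (2 * Ap ≠ K / 2 →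
        IsLittleOAddBigOInf
          (scaledNorm q l fun t x => u t x - profile a p φ u t x)
          (fun t => t ^ (-K / 2)) (fun t => t ^ (-(2 * Ap)))) ∧
      (2 * Ap = K / 2 →
        IsBigOInf
          (scaledNorm q l fun t x => u t x - profile a p φ u t x)
          (fun t => t ^ (-K / 2) * Real.log t))) := by
  have hcoef := IsCoefficient.of_essSup (ha_meas : JointlyMeasurable a) ha
  have h : DecayingSolution p A K Ap a φ u := DecayingSolution.of_isSolution hp hK hAp hAp_pos hcoef
    hφ_top hφ_K hu (SupDecay.of_iSup hu_decay)
  have hs := h.isSource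
  have hsM := h.isSource_massTerm hK
  refine ⟨⟨hs.memWeighted hK, fun α hα t ht => hs.intervalIntegrable_moment hα (le_of_lt ht),
    fun n => ⟨(h.approx_props n).2.1, (h.isSource_approx n).memWeighted hK, fun t _ x =>
      ⟨(h.isSource_approx n).duhamelIntegrable hAp_pos.le t x,
        ((h.isSource_approx n).momentProj hK).duhamelIntegrable hAp_pos.le t x⟩⟩,
    hs.integrable_prod hAp_pos, hsM.integrable_prod hAp_pos, fun t ht => ?_,
    fun t _ x => hsM.duhamelIntegrable hAp_pos.le t x⟩,
    fun α hα => ⟨h.isBigO_coeff_sub hα, h.isBigO_coeff hα, h.isBigO_coeff_log hα⟩,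
    fun n t ht x => h.approx_succ_eq n ht x,
    fun n q hq l hl hlK => ⟨(h.approx_props n).2.2.iSup_lt_top hl hlK hq, fun hne => ?_,
      fun heq => ?_⟩,
    h.tendsto_integral, h.tendsto_coeff_zero, fun q hq l hl hlK => ⟨fun hK1 hne => ?_,
      fun hK1 heq => ?_, fun hK1 hne => h.isBigOAddBigOInf_of_ne hK1 hne hq hl hlK,
      fun hK1 heq => ?_,
      fun hK1 hint => h.isBigOAddBigOInf_of_integrableOn hK1 hint hq hl hlK⟩,
    fun hK1 q hq l hl hlK => ⟨fun hne => ?_, fun heq => ?_⟩⟩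
  · have hg : AEStronglyMeasurable (shiftedKernel t : Space N → ℝ) volume := by
      rw [← gDeriv_zero]
      exact (continuous_gDeriv 0 (by linarith)).aestronglyMeasurable
    exact (hg.const_mul _).add (hsM.meas.duhamel_at (le_of_lt ht))
  · exact (((h.rate_sub_approx n).scaledNorm hl hlK hq).1 hne).isLittleOAddBigOInf
  · exact (((h.rate_sub_approx n).scaledNorm hl hlK hq).2 heq).isBigOInf
  · exact (((h.rate_sub_mass_mul hK1).scaledNorm hl hlK hq).1 hne).isLittleOAddBigOInf
  · exact (((h.rate_sub_mass_mul hK1).scaledNorm hl hlK hq).2 heq).isBigOInf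
  · exact ((h.big_sub_mass_mul_log hK1 heq).scaledNorm hl hlK hq).isBigOInf
  · exact (((h.rate_sub_profile hK1).scaledNorm hl hlK hq).1 hne).isLittleOAddBigOInf
  · exact (((h.rate_sub_profile hK1).scaledNorm hl hlK hq).2 heq).isBigOInf
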